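/- Let $d\ge 2$ be a fixed dimension and let $H=\{h_1,\dots,h_n\}$ be a set of $n$ non-vertical hyperplanes $x_d=a_1x_1+\dots+a_{d-1}x_{d-1}+b$ in $\mathbb R^d$ (degeneracies are allowed). *Order type.* The order type of $H$ records which $(d-1)$-tuples of hyperplanes intersect in a line and, for each such line $\ell$, the left-to-right order (coincidences included) of the points in which $\ell$ meets the hyperplanes that intersect but do not contain it; left-to-right means by $x_1$, with ties broken by $x_2$, and so on. If $d\ge 2$ it also contains, recursively, the order type of the $(d-1)$-dimensional arrangement that $H$ induces, in the coordinates $x_2,\dots,x_d$, on the hyperplane $x_1+\varepsilon x_2+\dots+\varepsilon^{d-2}x_{d-1}=-M$, for all sufficiently small $\varepsilon>0$ and all $M$ sufficiently large in terms of $\varepsilon$. For $d=1$ it is the order of the points. (For lines in the plane, this is the left-to-right order of the intersections along each line together with the vertical order of the lines at $x=-\infty$.) *Search structures.* A search structure is a finite tree that contains no real numbers. Each inner node either tells the query procedure to load the constant $1$, a coordinate of the query point or a coefficient of some $h_i$ into a register, or to write the sum, difference, product or quotient (with $x/0=0$) of two registers into a register (all registers are $0$ initially), or else to compare a register with $0$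 and follow one of three pointers. Each leaf stores a sign vector in $\{-1,0,1\}^n$. The query time is the number of nodes visited. A query with $q\in\mathbb R^d$ is answered correctly if the leaf reached stores the face of the arrangement $\mathcal A(H)$ containing $q$, that is, for each $i$, whether $q$ lies above, on or below $h_i$. **Lemma.** There is an absolute constant $K$ such that for every $d\ge2$ there are a program $P$ (of a pointer machine working on pairs, i.e. cells with two pointers, with one step per elementary operation and no access to real numbers) and a constant $c=c(d)$ with the following property. For every set $H$ of $n$ non-vertical hyperplanes in $\mathbb R^d$, given only the order type of $H$ as input, $P$ constructs a search structure, which hence depends on the order type alone, in at most $c(n+1)^c$ steps. The structure occupies at most $c(n+1)^c$ cells. For every $q\in\mathbb R^d$, the query with $q$ (which may read the coefficients of the hyperplanes of $H$) is answered correctly, in time at most $K\,d^{K}\log(n+2)$. In particular, the preprocessing performs no operation on the real data, so that its polynomial running time and the storage cost nothing in the algebraic decision-tree model. -/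

import Mathlib

open Filter Topology

/-! ## Hyperplanes, arrangements and point location -/

/-- A non-vertical hyperplane `x_m = slope 0 * x_0 + ⋯ + slope (m-1) * x_{m-1} + icpt` of `ℝ^(m+1)`.
The ambient dimension is `d = m + 1`; the last coordinate is the vertical one. -/
structure Hyperplane (m : ℕ) where
  slope : Fin m → ℝ
  icpt : ℝ

/-- The height of the hyperplane over the projection of the point `x`. -/
def Hyperplane.height {m : ℕ} (H : Hyperplane m) (x : Fin (m + 1) → ℝ) : ℝ :=
  ∑ j : Fin m, H.slope j * x j.castSucc + H.icpt

/-- The hyperplane as a set of points. -/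
def Hyperplane.carrier {m : ℕ} (H : Hyperplane m) : Set (Fin (m + 1) → ℝ) :=
  {x | x (Fin.last m) = H.height x}

/-- The position of the point `x`: `1` above, `0` on, `-1` below the hyperplane. -/
noncomputable def Hyperplane.side {m : ℕ} (H : Hyperplane m) (x : Fin (m + 1) → ℝ) : SignType :=
  SignType.sign (x (Fin.last m) - H.height x)

/-- The faces (relatively open cells of all dimensions) of the arrangement of `h` are the non-empty
sets among these, for the sign vectors `σ`; they partition the space. -/
def arrangementFace {n m : ℕ} (h : Fin n → Hyperplane m) (σ : Fin n → SignType) :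
    Set (Fin (m + 1) → ℝ) :=
  {x | ∀ i, (h i).side x = σ i}

/-! ## The order type -/

/-- The intersection of the `m = d - 1` hyperplanes with indices `I`. -/
def commonFlat {n m : ℕ} (h : Fin n → Hyperplane m) (I : Fin m → Fin n) :
    Set (Fin (m + 1) → ℝ) :=
  {x | ∀ k, x ∈ (h (I k)).carrier}

def IsLineSet {k : ℕ} (s : Set (Fin k → ℝ)) : Prop :=
  ∃ p v : Fin k → ℝ, v ≠ 0 ∧ s = Set.range (fun t : ℝ => p + t • v)

/-- The hyperplane meets the set `s` but does not contain it. -/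
def Hyperplane.Crosses {m : ℕ} (H : Hyperplane m) (s : Set (Fin (m + 1) → ℝ)) : Prop :=
  (s ∩ H.carrier).Nonempty ∧ ¬ s ⊆ H.carrier

/-- What is recorded about the lines spanned by the hyperplanes: which `(d-1)`-tuples intersect in a
line, and, for the hyperplanes that meet but do not contain this line, the left-to-right order
of the intersection points along it. The entry `le I i j` says that the line of `I` meets both `i` and
`j`, each in one point, and that the point on `i` is to the left of the point on `j` or equal to it
(so `le I i i` says that `i` crosses the line). -/
structure LineTable (n m : ℕ) where
  isLine : (Fin m → Fin n) → Bool
  le : (Fin m → Fin n) → Fin n → Fin n → Bool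

/-- "Left" is lexicographically smaller: a smaller `x_0`-coordinate, ties broken by `x_1`, and so on
(which matters only for lines that are orthogonal to the `x_0`-axis). -/
def LeftOrEqual {n m : ℕ} (h : Fin n → Hyperplane m) (I : Fin m → Fin n) (i j : Fin n) : Prop :=
  IsLineSet (commonFlat h I) ∧
    (h i).Crosses (commonFlat h I) ∧ (h j).Crosses (commonFlat h I) ∧
    ∀ x ∈ commonFlat h I ∩ (h i).carrier, ∀ y ∈ commonFlat h I ∩ (h j).carrier, toLex x ≤ toLex y

open Classical in
noncomputable def lineTable {n m : ℕ} (h : Fin n → Hyperplane m) : LineTable n m where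
  isLine I := decide (IsLineSet (commonFlat h I))
  le I i j := decide (LeftOrEqual h I i j)

/-- The infinitely steep hyperplane used below is
`x_0 + ε x_1 + ε² x_2 + ⋯ + ε^m x_m = -M` in `ℝ^(m+2)`, for tiny `ε > 0` and huge `M`; it does not
involve the vertical coordinate `x_{m+1}`. This is the section of `H` by it, as a non-vertical hyperplane
in the coordinates `x_1, …, x_{m+1}`. In the plane it is the intersection with the line `x_0 = -M`. -/
def Hyperplane.farSection {m : ℕ} (ε M : ℝ) (H : Hyperplane (m + 1)) : Hyperplane m where
  slope j := H.slope j.succ - H.slope 0 * ε ^ (j.val + 1)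
  icpt := H.icpt - H.slope 0 * M

/-- `farSection` is the section announced in its description. -/
theorem Hyperplane.mem_farSection {m : ℕ} (ε M : ℝ) (H : Hyperplane (m + 1))
    (y : Fin (m + 1) → ℝ) :
    y ∈ (H.farSection ε M).carrier ↔
      Fin.cons (-M - ∑ j : Fin m, ε ^ (j.val + 1) * y j.castSucc) y ∈ H.carrier := by
  have key : (H.farSection ε M).height y =
      H.height (Fin.cons (-M - ∑ j : Fin m, ε ^ (j.val + 1) * y j.castSucc) y) := by
    simp only [Hyperplane.height, Hyperplane.farSection, Fin.sum_univ_succ, Fin.castSucc_zero,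
      Fin.cons_zero, ← Fin.succ_castSucc, Fin.cons_succ, sub_mul, Finset.sum_sub_distrib, mul_sub,
      Finset.mul_sum, mul_assoc]
    ring
  simp only [Hyperplane.carrier, Set.mem_ofPred_eq, key]
  rw [← Fin.succ_last, Fin.cons_succ]

/-- The order type data of `n` hyperplanes in `ℝ^(m+1)`: the line table, and recursively the order
type of the `m`-dimensional arrangement seen on an infinitely steep hyperplane far to the left. -/
def ArrOrderType (n : ℕ) : ℕ → Type
  | 0 => LineTable n 0
  | m + 1 => LineTable n (m + 1) × ArrOrderType n m

instance ArrOrderType.instNonempty (n : ℕ) : ∀ m, Nonempty (ArrOrderType n m)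
  | 0 => ⟨(⟨fun _ => false, fun _ _ _ => false⟩ : LineTable n 0)⟩
  | m + 1 =>
    let ⟨t⟩ := ArrOrderType.instNonempty n m
    ⟨((⟨fun _ => false, fun _ _ _ => false⟩, t) : LineTable n (m + 1) × ArrOrderType n m)⟩

/-- The value of `f ε M` for all sufficiently small `ε > 0` and all `M` that are sufficiently large in
terms of `ε`. (In the only use below, finitely many semialgebraic conditions on `(ε, M)` are evaluated,
so that such a value exists.) -/
noncomputable def stableValue {α : Type} [Nonempty α] (f : ℝ → ℝ → α) : α :=
  Classical.epsilon fun v => ∀ᶠ ε in 𝓝[>] (0 : ℝ), ∀ᶠ M in atTop, f ε M = v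

/-- The order type of a family of hyperplanes. For lines in the plane it consists of the left-to-right
order of the intersections along each line, and of the vertical order of the lines at `x_0 = -∞`. -/
noncomputable def orderType {n : ℕ} : ∀ {m : ℕ}, (Fin n → Hyperplane m) → ArrOrderType n m
  | 0, h => lineTable h
  | _ + 1, h => (lineTable h, stableValue fun ε M => orderType fun i => (h i).farSection ε M)

/-! ## Discrete computation: programs on binary trees with a step count

The preprocessing runs on a pointer machine: its data are cells that hold two pointers, and
each elementary operation on cells costs one step. There is no access to real numbers. -/

/-- Symbolic expressions built from pairs. -/
inductive SExp : Type
  | nil : SExp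
  | cons : SExp → SExp → SExp

namespace SExp

def fst : SExp → SExp
  | nil => nil
  | cons a _ => a

def snd : SExp → SExp
  | nil => nil
  | cons _ b => b

/-- The number of memory cells. -/
def size : SExp → ℕ
  | nil => 1
  | cons a b => a.size + b.size + 1

/-- Numbers are written in unary. -/
def ofNat : ℕ → SExp
  | 0 => nil
  | k + 1 => cons nil (ofNat k)

def ofBool : Bool → SExp
  | false => nil
  | true => cons nil nil

def ofList : List SExp → SExp
  | [] => nil
  | a :: l => cons a (ofList l)

def ofFamily {n : ℕ} (f : Fin n → SExp) : SExp :=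
  ofList (List.ofFn f)

/-- A table indexed by `k`-tuples, as a `k`-fold nested list. -/
def ofTable {n : ℕ} : ∀ k : ℕ, ((Fin k → Fin n) → SExp) → SExp
  | 0, f => f Fin.elim0
  | k + 1, f => ofFamily fun i => ofTable k fun I => f (Fin.cons i I)

def ofSign (s : SignType) : SExp :=
  if s = 0 then ofNat 0 else if s = 1 then ofNat 1 else ofNat 2

end SExp

/-- Programs. `comp g f` is "first `f`, then `g`"; `cond c f g` is "if `c` is not `nil` then `f` else `g`";
`loop f` is "while the first component is not `nil` do `f`". -/
inductive Code : Type
  | id : Code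
  | nil : Code
  | fst : Code
  | snd : Code
  | pair : Code → Code → Code
  | comp : Code → Code → Code
  | cond : Code → Code → Code → Code
  | loop : Code → Code

/-- `Run p x y t`: the program `p` halts on the input `x` with the output `y` after `t` steps. -/
inductive Code.Run : Code → SExp → SExp → ℕ → Prop
  | id (x : SExp) : Run Code.id x x 1
  | nil (x : SExp) : Run Code.nil x SExp.nil 1
  | fst (x : SExp) : Run Code.fst x x.fst 1
  | snd (x : SExp) : Run Code.snd x x.snd 1
  | pair {f g : Code} {x y z : SExp} {s t : ℕ} :
      Run f x y s → Run g x z t → Run (Code.pair f g) x (SExp.cons y z) (s + t + 1)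
  | comp {f g : Code} {x y z : SExp} {s t : ℕ} :
      Run f x y s → Run g y z t → Run (Code.comp g f) x z (s + t + 1)
  | condTrue {c f g : Code} {x b y : SExp} {s t : ℕ} :
      Run c x b s → b ≠ SExp.nil → Run f x y t → Run (Code.cond c f g) x y (s + t + 1)
  | condFalse {c f g : Code} {x y : SExp} {s t : ℕ} :
      Run c x SExp.nil s → Run g x y t → Run (Code.cond c f g) x y (s + t + 1)
  | loopStop {f : Code} {x : SExp} :
      x.fst = SExp.nil → Run (Code.loop f) x x 1
  | loopStep {f : Code} {x y z : SExp} {s t : ℕ} :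
      x.fst ≠ SExp.nil → Run f x y s → Run (Code.loop f) y z t →
      Run (Code.loop f) x z (s + t + 1)

def LineTable.encode {n m : ℕ} (T : LineTable n m) : SExp :=
  SExp.cons
    (SExp.ofTable m fun I => SExp.ofBool (T.isLine I))
    (SExp.ofTable m fun I =>
      SExp.ofFamily fun i => SExp.ofFamily fun j => SExp.ofBool (T.le I i j))

def ArrOrderType.encodeAux {n : ℕ} : ∀ {m : ℕ}, ArrOrderType n m → SExp
  | 0, T => LineTable.encode (m := 0) T
  | m + 1, T => SExp.cons (LineTable.encode (m := m + 1) T.1) (ArrOrderType.encodeAux (m := m) T.2)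

/-- The input of the preprocessing: the number of hyperplanes and the order type. -/
def ArrOrderType.encode {n m : ℕ} (T : ArrOrderType n m) : SExp :=
  SExp.cons (SExp.ofNat n) T.encodeAux

/-! ## Search structures and their query procedure -/

/-- The instructions that a query can execute in one step on a real RAM: load a constant,
a coordinate of the query point or a coefficient of a hyperplane, or perform an arithmetic operation on
the contents of two registers. -/
inductive RealOp (n m : ℕ) : Type
  | one : RealOp n m
  | point (j : Fin (m + 1)) : RealOp n m
  | slope (i : Fin n) (j : Fin m) : RealOp n m
  | icpt (i : Fin n) : RealOp n m
  | add (a b : ℕ) : RealOp n m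
  | sub (a b : ℕ) : RealOp n m
  | mul (a b : ℕ) : RealOp n m
  | div (a b : ℕ) : RealOp n m

/-- The result of an instruction when the registers contain `mem`. -/
noncomputable def RealOp.value {n m : ℕ} (h : Fin n → Hyperplane m) (q : Fin (m + 1) → ℝ)
    (mem : ℕ → ℝ) : RealOp n m → ℝ
  | one => 1
  | point j => q j
  | slope i j => (h i).slope j
  | icpt i => (h i).icpt
  | add a b => mem a + mem b
  | sub a b => mem a - mem b
  | mul a b => mem a * mem b
  | div a b => mem a / mem b

def RealOp.encode {n m : ℕ} : RealOp n m → SExp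
  | one => SExp.ofList [SExp.ofNat 0]
  | point j => SExp.ofList [SExp.ofNat 1, SExp.ofNat j]
  | slope i j => SExp.ofList [SExp.ofNat 2, SExp.ofNat i, SExp.ofNat j]
  | icpt i => SExp.ofList [SExp.ofNat 3, SExp.ofNat i]
  | add a b => SExp.ofList [SExp.ofNat 4, SExp.ofNat a, SExp.ofNat b]
  | sub a b => SExp.ofList [SExp.ofNat 5, SExp.ofNat a, SExp.ofNat b]
  | mul a b => SExp.ofList [SExp.ofNat 6, SExp.ofNat a, SExp.ofNat b]
  | div a b => SExp.ofList [SExp.ofNat 7, SExp.ofNat a, SExp.ofNat b]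

/-- A search structure for `n` hyperplanes in `ℝ^(m+1)`: a tree whose inner nodes tell the query
procedure to store the result of an instruction in the register `r`, or to compare the register `r`
with zero and to follow one of three pointers; a leaf stores a face of the arrangement. The structure
itself contains no real numbers. -/
inductive SearchTree (n m : ℕ) : Type
  | leaf (face : Fin n → SignType) : SearchTree n m
  | compute (r : ℕ) (op : RealOp n m) (next : SearchTree n m) : SearchTree n m
  | branch (r : ℕ) (neg zero pos : SearchTree n m) : SearchTree n m

namespace SearchTree

variable {n m : ℕ}

def encode : SearchTree n m → SExp
  | leaf face =>
      SExp.ofList [SExp.ofNat 0, SExp.ofFamily fun i => SExp.ofSign (face i)]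
  | compute r op next =>
      SExp.ofList [SExp.ofNat 1, SExp.ofNat r, op.encode, next.encode]
  | branch r neg zero pos =>
      SExp.ofList [SExp.ofNat 2, SExp.ofNat r, neg.encode, zero.encode, pos.encode]

/-- The query procedure, started with register contents `mem`: the face found, and the number of steps
(one for each node that is visited). -/
noncomputable def run (h : Fin n → Hyperplane m) (q : Fin (m + 1) → ℝ) :
    SearchTree n m → (ℕ → ℝ) → (Fin n → SignType) × ℕ
  | leaf face, _ => (face, 1)
  | compute r op next, mem =>
      let out := run h q next (Function.update mem r (op.value h q mem))
      (out.1, out.2 + 1)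
  | branch r neg zero pos, mem =>
      let out :=
        if mem r < 0 then run h q neg mem
        else if mem r = 0 then run h q zero mem
        else run h q pos mem
      (out.1, out.2 + 1)

/-- The face returned for the query point `q`; initially all registers are zero. -/
noncomputable def answer (T : SearchTree n m) (h : Fin n → Hyperplane m) (q : Fin (m + 1) → ℝ) :
    Fin n → SignType :=
  (T.run h q fun _ => 0).1

/-- The number of steps of the query `q`. -/
noncomputable def queryTime (T : SearchTree n m) (h : Fin n → Hyperplane m)
    (q : Fin (m + 1) → ℝ) : ℕ :=
  (T.run h q fun _ => 0).2

end SearchTree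

/-!
In homogeneous coordinates `(x, w)`, a hyperplane is a linear form, and a query point `q` is the
vector `(q, 1)`; `allForms h` collects the value of `w` and the values of all forms, so that the answer
to the query is the sign vector of `allForms h (q, 1)`.

**What the order type knows.** Call a vector elementary if, up to vectors on which all forms
vanish, it is determined up to a factor by the forms that vanish on it (`Elementary`). Elementary
vectors with `w ≥ 0` are the vertices and the directions of lines of the arrangement. Their sign vectors
(cocircuits) can be read off the order type: on a line, the positions of the intersections and the
side of each hyperplane on which the left end of the line lies determine all signs, and the left end of a
line is a vertex of the far section, so that the signs there come recursively from the next lower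
dimension (`exists_leftEnd`, `cocircuits_sound`). An arrangement without vertices is parallel to a
line, and then its elementary vectors can be moved into the far section (`mem_cocircuits`). This uses that
the order type of the far section is eventually constant: its entries are Boolean combinations of signs of
polynomials in `ε` and `M` (`orderType_farSection_eventually`).

**What a query does.** For a sample `T` of a number of hyperplanes that is polynomial in the dimension, a
gadget of polynomial depth writes the vector of the forms of the sample at `(q, 1)` as a sum of at
most `m + 2` conforming elementary vectors (`Prog.ok_locate`). Each of them is found by a walk that
stops at the first hyperplane, in each of `m + 2` directions; subtracting the largest possible multiple of
it lowers the dimension of the support (`finrank_supportSpace_lt`). The gadget outputs only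
combinatorial descriptions of these vectors. With the list of cocircuits they determine the signs of
all hyperplanes at the summands (`find?_fits`). Where these signs do not disagree, the sign at `q` follows
(`inferSign_of_decomposes`); they never disagree at members of the sample (`conflict_of_decomposes`).

**Why the depth is logarithmic.** The number of outcomes of the gadget is bounded in terms of the
dimension, and each outcome refers to few members of the sample. Hence a random sample of unresolved
hyperplanes hits, for each outcome, the set of hyperplanes at which the outcome does not determine the
sign, if that set has more than half of the unresolved hyperplanes (`exists_hitting_sample`). For such a
sample, which can be found by exhaustive search since all conditions on it involve only the
cocircuits, each query resolves at least half of the unresolved hyperplanes (`exists_good`).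
Repeating this `log n` times gives the search tree (`run_buildTree`).

**Why the preprocessing is polynomial.** `PolyTime` is the class of functions that a program computes in
polynomial time. It is closed under composition, pairing, bounded folds and the usual operations on
lists, so that it suffices to write the construction with list functions. The tree itself is built
as a word: each state is replaced by the nodes of its gadget, `log n` times (`expandAll`), and the
final word is parsed with a stack (`treeExp_eq`).
-/

/-! ### Polynomial time on typed data -/

/-- Types whose elements are represented by symbolic expressions. -/
class Enc (α : Type) where
  enc : α → SExp

open Enc

instance : Enc SExp := ⟨fun x => x⟩
instance : Enc ℕ := ⟨SExp.ofNat⟩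
instance : Enc Bool := ⟨SExp.ofBool⟩
instance : Enc SignType := ⟨SExp.ofSign⟩
instance {α : Type} [Enc α] : Enc (List α) := ⟨fun l => SExp.ofList (l.map enc)⟩
instance {α β : Type} [Enc α] [Enc β] : Enc (α × β) := ⟨fun p => SExp.cons (enc p.1) (enc p.2)⟩
instance {α : Type} [Enc α] : Enc (Option α) :=
  ⟨fun o => match o with | none => SExp.nil | some a => SExp.cons (enc a) SExp.nil⟩
instance : Enc Unit := ⟨fun _ => SExp.nil⟩

/-- The number of cells of the representation. -/
def esize {α : Type} [Enc α] (a : α) : ℕ := (enc a).size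

section PolyBdd

variable {α β γ σ : Type} [Enc α] [Enc β] [Enc γ] [Enc σ]

/-- Polynomially bounded in the size of the argument. -/
def PolyBdd (φ : α → ℕ) : Prop := ∃ c : ℕ, ∀ a, φ a ≤ c * (esize a + 1) ^ c

theorem PolyBdd.mono {φ ψ : α → ℕ} (h : PolyBdd ψ) (hle : ∀ a, φ a ≤ ψ a) : PolyBdd φ := by
  obtain ⟨c, hc⟩ := h
  exact ⟨c, fun a => (hle a).trans (hc a)⟩

theorem PolyBdd.const (k : ℕ) : PolyBdd (fun _ : α => k) :=
  ⟨k, fun a => Nat.le_mul_of_pos_right _ (by positivity)⟩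

theorem PolyBdd.size : PolyBdd (fun a : α => esize a) := ⟨1, fun a => by simp⟩

theorem PolyBdd.add {φ ψ : α → ℕ} (h : PolyBdd φ) (h' : PolyBdd ψ) :
    PolyBdd (fun a => φ a + ψ a) := by
  obtain ⟨c, hc⟩ := h
  obtain ⟨d, hd⟩ := h'
  refine ⟨c + d, fun a => ?_⟩
  have h1 := hc a
  have h2 := hd a
  have h3 : (esize a + 1) ^ c ≤ (esize a + 1) ^ (c + d) := Nat.pow_le_pow_right (by omega) (by omega)
  have h4 : (esize a + 1) ^ d ≤ (esize a + 1) ^ (c + d) := Nat.pow_le_pow_right (by omega) (by omega)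
  have := Nat.mul_le_mul_left c h3
  have := Nat.mul_le_mul_left d h4
  beta_reduce
  rw [add_mul]
  omega

theorem PolyBdd.mul {φ ψ : α → ℕ} (h : PolyBdd φ) (h' : PolyBdd ψ) :
    PolyBdd (fun a => φ a * ψ a) := by
  obtain ⟨c, hc⟩ := h
  obtain ⟨d, hd⟩ := h'
  refine ⟨c * d + c + d, fun a => ?_⟩
  calc φ a * ψ a ≤ (c * (esize a + 1) ^ c) * (d * (esize a + 1) ^ d) := Nat.mul_le_mul (hc a) (hd a)
    _ = (c * d) * (esize a + 1) ^ (c + d) := by ring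
    _ ≤ (c * d + c + d) * (esize a + 1) ^ (c * d + c + d) :=
      Nat.mul_le_mul (by omega) (Nat.pow_le_pow_right (by omega) (by omega))

theorem PolyBdd.pow {φ : α → ℕ} (h : PolyBdd φ) (k : ℕ) : PolyBdd (fun a => φ a ^ k) := by
  induction k with
  | zero => simpa using PolyBdd.const 1
  | succ k ih => simpa [pow_succ] using ih.mul h

theorem PolyBdd.comp {φ : β → ℕ} (h : PolyBdd φ) {f : α → β}
    (hf : PolyBdd fun a => esize (f a)) : PolyBdd (fun a => φ (f a)) := by
  obtain ⟨c, hc⟩ := h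
  exact ((PolyBdd.const c).mul ((hf.add (.const 1)).pow c)).mono fun a => hc (f a)

theorem esize_pair (a : α) (b : β) : esize (a, b) = esize a + esize b + 1 := rfl

theorem esize_nil : esize ([] : List α) = 1 := rfl

theorem esize_cons (a : α) (l : List α) : esize (a :: l) = esize a + esize l + 1 := rfl

theorem esize_pos (a : α) : 1 ≤ esize a := by
  unfold esize
  cases enc a <;> simp [SExp.size]

theorem esize_append (l l' : List α) : esize (l ++ l') + 1 = esize l + esize l' := by
  induction l with
  | nil => simp [esize_nil]; omega
  | cons a l ih => simp only [List.cons_append, esize_cons]; omega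

theorem esize_reverse (l : List α) : esize l.reverse = esize l := by
  induction l with
  | nil => rfl
  | cons a l ih =>
    have := esize_append l.reverse [a]
    simp only [List.reverse_cons, esize_cons, esize_nil] at *
    omega

theorem length_lt_esize (l : List α) : l.length < esize l := by
  induction l with
  | nil => simp [esize_nil]
  | cons a l ih => simp only [List.length_cons, esize_cons]; omega

theorem esize_mem_le {a : α} {l : List α} (h : a ∈ l) : esize a ≤ esize l := by
  induction l with
  | nil => simp at h
  | cons b l ih =>
    rw [esize_cons]
    rcases List.mem_cons.1 h with rfl | h
    · omega
    · have := ih h; omega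

theorem esize_le_of_forall (l : List α) (B : ℕ) (h : ∀ a ∈ l, esize a ≤ B) :
    esize l ≤ l.length * (B + 1) + 1 := by
  induction l with
  | nil => simp [esize_nil]
  | cons b l ih =>
    rw [esize_cons, List.length_cons, add_mul]
    have := ih fun a ha => h a (List.mem_cons_of_mem _ ha)
    have := h b List.mem_cons_self
    omega

theorem esize_nat (k : ℕ) : esize k = 2 * k + 1 := by
  unfold esize
  induction k with
  | zero => rfl
  | succ k ih =>
    have : (enc (k + 1)).size = 1 + (enc k).size + 1 := rfl
    omega

theorem esize_some (a : α) : esize (some a) = esize a + 2 := rfl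

theorem esize_none : esize (none : Option α) = 1 := rfl

theorem esize_sign (s : SignType) : esize s ≤ 5 := by
  cases s <;> decide

theorem esize_bool (b : Bool) : esize b ≤ 3 := by
  cases b <;> simp [esize, enc, SExp.ofBool, SExp.size]

/-- Functions that a program computes in polynomial time; the size of the result is also required
to be polynomial (cells can be shared, so that this is no consequence of the bound on the time). -/
def PolyTime (f : α → β) : Prop :=
  PolyBdd (fun a => esize (f a)) ∧
    ∃ (p : Code) (τ : α → ℕ), PolyBdd τ ∧ ∀ a, ∃ t ≤ τ a, p.Run (enc a) (enc (f a)) t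

end PolyBdd

namespace PolyTime

variable {α β γ σ : Type} [Enc α] [Enc β] [Enc γ] [Enc σ]

theorem bdd {f : α → β} (h : PolyTime f) : PolyBdd (fun a => esize (f a)) := h.1

protected theorem id : PolyTime (fun a : α => a) :=
  ⟨.size, Code.id, fun _ => 1, .const 1, fun _ => ⟨1, le_rfl, .id _⟩⟩

/-- The program that outputs a fixed expression. -/
def constCode : SExp → Code
  | SExp.nil => Code.nil
  | SExp.cons a b => Code.pair (constCode a) (constCode b)

theorem run_constCode (s x : SExp) : (constCode s).Run x s s.size := by
  induction s with
  | nil => exact .nil x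
  | cons a b iha ihb => exact .pair iha ihb

theorem const (b : β) : PolyTime (fun _ : α => b) :=
  ⟨.const _, constCode (enc b), fun _ => (enc b).size, .const _,
    fun _ => ⟨_, le_rfl, run_constCode _ _⟩⟩

theorem comp {g : β → γ} {f : α → β} (hg : PolyTime g) (hf : PolyTime f) :
    PolyTime (fun a => g (f a)) := by
  obtain ⟨hgb, p, τ, hτ, hp⟩ := hg
  obtain ⟨hfb, q, ρ, hρ, hq⟩ := hf
  refine ⟨hgb.comp hfb, Code.comp p q, fun a => ρ a + τ (f a) + 1,
    (hρ.add (hτ.comp hfb)).add (.const 1), fun a => ?_⟩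
  obtain ⟨t, ht, h1⟩ := hq a
  obtain ⟨s, hs, h2⟩ := hp (f a)
  exact ⟨t + s + 1, by beta_reduce; omega, .comp h1 h2⟩

theorem pair {f : α → β} {g : α → γ} (hf : PolyTime f) (hg : PolyTime g) :
    PolyTime (fun a => (f a, g a)) := by
  obtain ⟨hgb, p, τ, hτ, hp⟩ := hg
  obtain ⟨hfb, q, ρ, hρ, hq⟩ := hf
  refine ⟨(hfb.add hgb).add (.const 1), Code.pair q p, fun a => ρ a + τ a + 1,
    (hρ.add hτ).add (.const 1), fun a => ?_⟩
  obtain ⟨t, ht, h1⟩ := hq a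
  obtain ⟨s, hs, h2⟩ := hp a
  exact ⟨t + s + 1, by beta_reduce; omega, .pair h1 h2⟩

protected theorem fst : PolyTime (fun p : α × β => p.1) :=
  ⟨PolyBdd.size.mono fun p => by rw [show esize p = _ from esize_pair p.1 p.2]; beta_reduce; omega,
    Code.fst, fun _ => 1, .const 1, fun _ => ⟨1, le_rfl, .fst _⟩⟩

protected theorem snd : PolyTime (fun p : α × β => p.2) :=
  ⟨PolyBdd.size.mono fun p => by rw [show esize p = _ from esize_pair p.1 p.2]; beta_reduce; omega,
    Code.snd, fun _ => 1, .const 1, fun _ => ⟨1, le_rfl, .snd _⟩⟩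

theorem fst' {f : α → β × γ} (hf : PolyTime f) : PolyTime (fun a => (f a).1) := PolyTime.fst.comp hf

theorem snd' {f : α → β × γ} (hf : PolyTime f) : PolyTime (fun a => (f a).2) := PolyTime.snd.comp hf

/-- A function with the same representations of arguments and values as a polynomial-time one. -/
theorem of_enc {α' β' : Type} [Enc α'] [Enc β'] {g : α' → β'} (hg : PolyTime g) (f : α → β)
    (e : α → α') (he : ∀ a, enc (e a) = enc a) (hf : ∀ a, enc (f a) = enc (g (e a))) :
    PolyTime f := by
  obtain ⟨⟨c, hc⟩, p, τ, ⟨d, hd⟩, hp⟩ := hg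
  refine ⟨⟨c, fun a => ?_⟩, p, fun a => τ (e a), ⟨d, fun a => ?_⟩, fun a => ?_⟩
  · have := hc (e a)
    simpa only [esize, he, ← hf] using this
  · have := hd (e a)
    simpa only [esize, he] using this
  · have := hp (e a)
    rwa [he, ← hf] at this

theorem ite {c : α → Bool} {f g : α → β} (hc : PolyTime c) (hf : PolyTime f) (hg : PolyTime g) :
    PolyTime (fun a => if c a = true then f a else g a) := by
  obtain ⟨-, p, τ, hτ, hp⟩ := hc
  obtain ⟨hfb, q, ρ, hρ, hq⟩ := hf
  obtain ⟨hgb, r, θ, hθ, hr⟩ := hg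
  refine ⟨(hfb.add hgb).mono fun a => by beta_reduce; split <;> omega, Code.cond p q r,
    fun a => τ a + (ρ a + θ a) + 1, (hτ.add (hρ.add hθ)).add (.const 1), fun a => ?_⟩
  obtain ⟨t, ht, h1⟩ := hp a
  obtain ⟨s, hs, h2⟩ := hq a
  obtain ⟨u, hu, h3⟩ := hr a
  cases hca : c a with
  | true =>
    rw [hca] at h1
    exact ⟨t + s + 1, by beta_reduce; omega, by simpa [hca] using Code.Run.condTrue h1 (by simp [enc, SExp.ofBool]) h2⟩
  | false =>
    rw [hca] at h1
    exact ⟨t + u + 1, by beta_reduce; omega, by simpa [hca] using Code.Run.condFalse h1 h3⟩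

theorem not {c : α → Bool} (hc : PolyTime c) : PolyTime (fun a => !c a) :=
  (hc.ite (const false) (const true)).of_enc _ id (fun _ => rfl) fun a => by cases h : c a <;> simp [h]

theorem and {c d : α → Bool} (hc : PolyTime c) (hd : PolyTime d) : PolyTime (fun a => c a && d a) :=
  (hc.ite hd (const false)).of_enc _ id (fun _ => rfl) fun a => by cases h : c a <;> simp [h]

theorem or {c d : α → Bool} (hc : PolyTime c) (hd : PolyTime d) : PolyTime (fun a => c a || d a) :=
  (hc.ite (const true) hd).of_enc _ id (fun _ => rfl) fun a => by cases h : c a <;> simp [h]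

/-! ### Expressions, lists and options -/

theorem sexp_cons {f g : α → SExp} (hf : PolyTime f) (hg : PolyTime g) :
    PolyTime (fun a => SExp.cons (f a) (g a)) :=
  (hf.pair hg).of_enc _ id (fun _ => rfl) fun _ => rfl

theorem sexp_size_fst (x : SExp) : x.fst.size ≤ x.size := by
  cases x <;> simp [SExp.fst, SExp.size]; omega

theorem sexp_size_snd (x : SExp) : x.snd.size ≤ x.size := by
  cases x <;> simp [SExp.snd, SExp.size]; omega

theorem sexp_fst {f : α → SExp} (hf : PolyTime f) : PolyTime (fun a => (f a).fst) :=
  comp (g := SExp.fst) ⟨PolyBdd.size.mono sexp_size_fst, Code.fst, fun _ => 1, .const 1,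
    fun _ => ⟨1, le_rfl, .fst _⟩⟩ hf

theorem sexp_snd {f : α → SExp} (hf : PolyTime f) : PolyTime (fun a => (f a).snd) :=
  comp (g := SExp.snd) ⟨PolyBdd.size.mono sexp_size_snd, Code.snd, fun _ => 1, .const 1,
    fun _ => ⟨1, le_rfl, .snd _⟩⟩ hf

/-- Whether an expression, read as a truth value, is true. -/
def _root_.SExp.truthy : SExp → Bool
  | SExp.nil => false
  | SExp.cons _ _ => true

theorem truthy {f : α → SExp} (hf : PolyTime f) : PolyTime (fun a => (f a).truthy) :=
  comp (g := SExp.truthy) ⟨(PolyBdd.const 3).mono fun _ => esize_bool _,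
    Code.cond Code.id (constCode (enc true)) Code.nil, fun _ => 10, .const 10, fun x => by
      cases x with
      | nil => exact ⟨3, by beta_reduce; omega, .condFalse (.id _) (.nil _)⟩
      | cons a b =>
        exact ⟨1 + 3 + 1, by beta_reduce; omega, .condTrue (.id _) (by simp [enc]) (run_constCode _ _)⟩⟩ hf

theorem enc_ (f : α → β) (hf : PolyTime f) : PolyTime (fun a => enc (f a)) :=
  hf.of_enc _ id (fun _ => rfl) fun _ => rfl

theorem cons {f : α → β} {g : α → List β} (hf : PolyTime f) (hg : PolyTime g) :
    PolyTime (fun a => f a :: g a) :=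
  (hf.pair hg).of_enc _ id (fun _ => rfl) fun _ => rfl

theorem some {f : α → β} (hf : PolyTime f) : PolyTime (fun a => Option.some (f a)) :=
  (hf.pair (const ())).of_enc _ id (fun _ => rfl) fun _ => rfl

theorem isEmpty {f : α → List β} (hf : PolyTime f) : PolyTime (fun a => (f a).isEmpty) :=
  (hf.enc_).truthy.not.of_enc _ id (fun _ => rfl) fun a => by
    simp only [id]; cases h : f a <;> rfl

theorem isSome {f : α → Option β} (hf : PolyTime f) : PolyTime (fun a => (f a).isSome) :=
  (hf.enc_).truthy.of_enc _ id (fun _ => rfl) fun a => by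
    simp only [id]; cases h : f a <;> rfl

theorem head? {f : α → List β} (hf : PolyTime f) : PolyTime (fun a => (f a).head?) :=
  ((hf.enc_).truthy.ite (hf.enc_.sexp_fst.sexp_cons (const SExp.nil)) (const SExp.nil)).of_enc
    _ id (fun _ => rfl) fun a => by cases h : f a <;> simp only [id, h] <;> rfl

theorem tail {f : α → List β} (hf : PolyTime f) : PolyTime (fun a => (f a).tail) :=
  hf.enc_.sexp_snd.of_enc _ id (fun _ => rfl) fun a => by cases h : f a <;> simp only [id, h] <;> rfl

theorem getD {f : α → Option β} {d : α → β} (hf : PolyTime f) (hd : PolyTime d) :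
    PolyTime (fun a => (f a).getD (d a)) :=
  (hf.isSome.ite hf.enc_.sexp_fst hd.enc_).of_enc _ id (fun _ => rfl) fun a => by
    cases h : f a <;> simp only [id, h] <;> rfl

/-- Case distinction on an option; the default value `b` only serves to run the second branch on it. -/
theorem option_elim {f : α → Option β} {g : α → γ} {k : α → β → γ} (b : β) (hf : PolyTime f)
    (hg : PolyTime g) (hk : PolyTime fun p : α × β => k p.1 p.2) :
    PolyTime (fun a => (f a).elim (g a) (k a)) :=
  (hf.isSome.ite (hk.comp (PolyTime.id.pair (hf.getD (const b)))) hg).of_enc _ id (fun _ => rfl)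
    fun a => by cases h : f a <;> simp [h]

end PolyTime

open Enc

namespace PolyTime

variable {α β γ σ : Type} [Enc α] [Enc β] [Enc γ] [Enc σ]

/-- The body of the loop for a fold: the state consists of the remaining list, the accumulator and
the parameter. -/
def foldBody (step : Code) : Code :=
  .pair (.comp .snd .fst) (.pair
    (.comp step (.pair (.comp .snd .snd) (.pair (.comp .fst .snd) (.comp .fst .fst))))
    (.comp .snd .snd))

theorem run_of_eq {p : Code} {x y : SExp} {s t : ℕ} (h : p.Run x y s) (e : s = t) : p.Run x y t := e ▸ h

theorem run_foldBody {step : Code} {b l acc a acc' : SExp} {t : ℕ}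
    (h : step.Run (SExp.cons a (SExp.cons acc b)) acc' t) :
    (foldBody step).Run (SExp.cons (SExp.cons b l) (SExp.cons acc a))
      (SExp.cons l (SExp.cons acc' a)) (t + 20) := by
  have h1 : ∀ x y : SExp, Code.fst.Run (SExp.cons x y) x 1 := fun x y => .fst (SExp.cons x y)
  have h2 : ∀ x y : SExp, Code.snd.Run (SExp.cons x y) y 1 := fun x y => .snd (SExp.cons x y)
  have := Code.Run.pair (.comp (h1 (SExp.cons b l) (SExp.cons acc a)) (h2 _ _)) (.pair
    (.comp (.pair (.comp (h2 (SExp.cons b l) (SExp.cons acc a)) (h2 _ _))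
      (.pair (.comp (h2 _ _) (h1 _ _)) (.comp (h1 _ _) (h1 _ _)))) h)
    (.comp (h2 (SExp.cons b l) (SExp.cons acc a)) (h2 _ _)))
  exact run_of_eq this (by omega)

theorem run_foldLoop {f : α → σ → β → σ} {step : Code} {a : α} {B : ℕ} (l : List β) (s : σ)
    (h : ∀ k b, k < l.length → l[k]? = Option.some b →
      ∃ t ≤ B, step.Run (enc (a, (l.take k).foldl (f a) s, b)) (enc (f a ((l.take k).foldl (f a) s) b)) t) :
    ∃ t ≤ l.length * (B + 21) + 1, (Code.loop (foldBody step)).Run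
      (SExp.cons (enc l) (SExp.cons (enc s) (enc a)))
      (SExp.cons SExp.nil (SExp.cons (enc (l.foldl (f a) s)) (enc a))) t := by
  induction l generalizing s with
  | nil => exact ⟨1, by simp, .loopStop rfl⟩
  | cons b l ih =>
    obtain ⟨t, ht, h0⟩ := h 0 b (by simp) rfl
    obtain ⟨u, hu, h1⟩ := ih (f a s b) fun k c hk hc => by
      have := h (k + 1) c (by simpa using hk) (by simpa using hc)
      simpa using this
    refine ⟨(t + 20) + u + 1, ?_, .loopStep (by simp [SExp.fst, enc, SExp.ofList])
      (run_foldBody h0) h1⟩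
    rw [List.length_cons, add_mul]
    omega

/-- The recursion principle of this model: a fold over a list, if the size of the accumulator stays
polynomial. -/
theorem foldl {l : α → List β} {i : α → σ} {f : α → σ → β → σ} (hl : PolyTime l) (hi : PolyTime i)
    (hf : PolyTime fun p : α × σ × β => f p.1 p.2.1 p.2.2) {φ : α → ℕ} (hφ : PolyBdd φ)
    (hb : ∀ a k, esize (((l a).take k).foldl (f a) (i a)) ≤ φ a) :
    PolyTime (fun a => (l a).foldl (f a) (i a)) := by
  obtain ⟨hlb, p, τ, hτ, hp⟩ := hl
  obtain ⟨-, q, ρ, hρ, hq⟩ := hi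
  obtain ⟨-, r, θ, ⟨c, hc⟩, hr⟩ := hf
  refine ⟨hφ.mono fun a => by simpa using hb a (l a).length,
    .comp (.comp .fst .snd) (.comp (.loop (foldBody r)) (.pair p (.pair q .id))),
    fun a => (τ a + (ρ a + 1 + 1) + 1) + (esize (l a) *
      (c * ((esize a + φ a + esize (l a) + 2) + 1) ^ c + 21) + 1) + 1 + 3 + 1,
    (((((hτ.add ((hρ.add (.const _)).add (.const _))).add (.const _)).add
      ((hlb.mul (((PolyBdd.const c).mul ((((((PolyBdd.size.add hφ).add hlb).add (.const _)).add
        (.const _)).pow c))).add (.const _))).add (.const _))).add (.const _)).add (.const _)).add (.const _),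
    fun a => ?_⟩
  obtain ⟨t, ht, h1⟩ := hp a
  obtain ⟨s, hs, h2⟩ := hq a
  obtain ⟨u, hu, h3⟩ := run_foldLoop (f := f) (step := r) (a := a)
    (B := c * ((esize a + φ a + esize (l a) + 2) + 1) ^ c) (l a) (i a) (fun k b hk hbk => by
      obtain ⟨v, hv, h⟩ := hr (a, ((l a).take k).foldl (f a) (i a), b)
      refine ⟨v, hv.trans ((hc _).trans (Nat.mul_le_mul_left _ (Nat.pow_le_pow_left ?_ _))), h⟩
      have h1 := hb a k
      have h2 := esize_mem_le (List.mem_of_getElem? hbk)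
      rw [esize_pair, esize_pair]
      omega)
  refine ⟨(t + (s + 1 + 1) + 1) + u + 1 + (1 + 1 + 1) + 1, ?_, ?_⟩
  · have := (length_lt_esize (l a)).le
    have := Nat.mul_le_mul_right (c * ((esize a + φ a + esize (l a) + 2) + 1) ^ c + 21) this
    beta_reduce
    omega
  · have h4 := Code.Run.comp (Code.Run.comp (Code.Run.pair h1 (.pair h2 (.id _))) h3)
      (.comp (.snd _) (.fst _))
    exact run_of_eq h4 (by omega)

theorem reverse {f : α → List β} (hf : PolyTime f) : PolyTime (fun a => (f a).reverse) := by
  refine (foldl (l := f) (i := fun _ => ([] : List β)) (f := fun _ acc b => b :: acc) hf (const _)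
    (PolyTime.snd.snd'.cons PolyTime.snd.fst') hf.bdd fun a k => ?_).of_enc _ id (fun _ => rfl)
    fun a => by simp
  have h1 : (f a).take k ++ (f a).drop k = f a := List.take_append_drop k (f a)
  have h2 := esize_append ((f a).take k) ((f a).drop k)
  have h3 := esize_pos ((f a).drop k)
  rw [List.foldl_flip_cons_eq_append', List.append_nil, esize_reverse]
  rw [h1] at h2
  omega

theorem append {f g : α → List β} (hf : PolyTime f) (hg : PolyTime g) :
    PolyTime (fun a => f a ++ g a) := by
  refine (foldl (l := fun a => (f a).reverse) (i := g) (f := fun _ acc b => b :: acc) hf.reverse hg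
    (PolyTime.snd.snd'.cons PolyTime.snd.fst') (hf.bdd.add hg.bdd) fun a k => ?_).of_enc _ id
    (fun _ => rfl) fun a => by simp
  have h1 : (f a).reverse.take k ++ (f a).reverse.drop k = (f a).reverse := List.take_append_drop k _
  have h2 := esize_append ((f a).reverse.take k) ((f a).reverse.drop k)
  have h3 := esize_pos ((f a).reverse.drop k)
  have h4 := esize_append ((f a).reverse.take k).reverse (g a)
  rw [List.foldl_flip_cons_eq_append']
  rw [h1, esize_reverse] at h2
  rw [esize_reverse] at h4
  omega

theorem map {l : α → List β} {f : α → β → γ} (hl : PolyTime l)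
    (hf : PolyTime fun p : α × β => f p.1 p.2) : PolyTime (fun a => (l a).map (f a)) := by
  obtain ⟨c, hc⟩ := hf.bdd
  have key : ∀ a (l' : List β) (acc : List γ),
      l'.foldl (fun acc b => f a b :: acc) acc = (l'.map (f a)).reverse ++ acc := by
    intro a l'
    induction l' with
    | nil => simp
    | cons b l' ih => intro acc; simp [ih]
  refine (reverse (foldl (l := l) (i := fun _ => ([] : List γ)) (f := fun a acc b => f a b :: acc) hl
    (const _) ((hf.comp (PolyTime.fst.pair PolyTime.snd.snd')).cons PolyTime.snd.fst')
    (φ := fun a => esize (l a) * (c * (esize a + esize (l a) + 1 + 1) ^ c + 1) + 1)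
    ((hl.bdd.mul (((PolyBdd.const c).mul ((((PolyBdd.size.add hl.bdd).add (.const 1)).add
      (.const 1)).pow c)).add (.const 1))).add (.const 1)) fun a k => ?_)).of_enc _ id
    (fun _ => rfl) fun a => by simp [key]
  rw [key, List.append_nil, esize_reverse]
  refine (esize_le_of_forall _ (c * (esize a + esize (l a) + 1 + 1) ^ c) fun x hx => ?_).trans ?_
  · obtain ⟨b, hb, rfl⟩ := List.mem_map.1 hx
    refine (hc (a, b)).trans (Nat.mul_le_mul_left _ (Nat.pow_le_pow_left ?_ _))
    have := esize_mem_le (List.mem_of_mem_take hb)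
    rw [esize_pair]
    omega
  · gcongr
    simp only [List.length_map, List.length_take]
    exact (min_le_right _ _).trans (length_lt_esize _).le

theorem flatten {l : α → List (List β)} (hl : PolyTime l) : PolyTime (fun a => (l a).flatten) := by
  have key : ∀ (l' : List (List β)) (acc : List β),
      l'.foldl (fun acc b => acc ++ b) acc = acc ++ l'.flatten := by
    intro l'
    induction l' with
    | nil => simp
    | cons b l' ih => intro acc; simp [ih]
  have hsz : ∀ l' : List (List β), esize l'.flatten ≤ esize l' := by
    intro l'
    induction l' with
    | nil => simp [esize_nil]
    | cons b l' ih =>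
      have := esize_append b l'.flatten
      rw [esize_cons, List.flatten_cons]
      omega
  refine (foldl (l := l) (i := fun _ => ([] : List β)) (f := fun _ acc b => acc ++ b) hl
    (const _) (PolyTime.snd.fst'.append PolyTime.snd.snd') hl.bdd fun a k => ?_).of_enc _ id
    (fun _ => rfl) fun a => by simp [key]
  rw [key, List.nil_append]
  refine (hsz _).trans ?_
  have h1 : (l a).take k ++ (l a).drop k = l a := List.take_append_drop k _
  have h2 := esize_append ((l a).take k) ((l a).drop k)
  have h3 := esize_pos ((l a).drop k)
  rw [h1] at h2
  omega

theorem flatMap {l : α → List β} {f : α → β → List γ} (hl : PolyTime l)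
    (hf : PolyTime fun p : α × β => f p.1 p.2) : PolyTime (fun a => (l a).flatMap (f a)) :=
  (hl.map hf).flatten.of_enc _ id (fun _ => rfl) fun a => by simp [List.flatMap]

theorem filter {l : α → List β} {f : α → β → Bool} (hl : PolyTime l)
    (hf : PolyTime fun p : α × β => f p.1 p.2) : PolyTime (fun a => (l a).filter (f a)) := by
  refine (hl.flatMap (f := fun a b => if f a b = true then [b] else [])
    (hf.ite (PolyTime.snd.cons (const [])) (const []))).of_enc _ id (fun _ => rfl) fun a => ?_
  congr 1
  simp only [id]
  induction l a with
  | nil => rfl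
  | cons b l ih => by_cases h : f a b <;> simp [h, ih]

theorem find? {l : α → List β} {f : α → β → Bool} (hl : PolyTime l)
    (hf : PolyTime fun p : α × β => f p.1 p.2) : PolyTime (fun a => (l a).find? (f a)) :=
  (hl.filter hf).head?.of_enc _ id (fun _ => rfl) fun a => by simp

theorem any {l : α → List β} {f : α → β → Bool} (hl : PolyTime l)
    (hf : PolyTime fun p : α × β => f p.1 p.2) : PolyTime (fun a => (l a).any (f a)) :=
  (hl.find? hf).isSome.of_enc _ id (fun _ => rfl) fun a => by
    simp only [id]; congr 1; rw [Bool.eq_iff_iff]; simp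

theorem all {l : α → List β} {f : α → β → Bool} (hl : PolyTime l)
    (hf : PolyTime fun p : α × β => f p.1 p.2) : PolyTime (fun a => (l a).all (f a)) :=
  (hl.any (f := fun a b => !f a b) hf.not).not.of_enc _ id (fun _ => rfl) fun a => by
    congr 1; simp [List.all_eq_not_any_not]

/-! ### Natural numbers, represented as lists of units -/

theorem enc_replicate (k : ℕ) : enc (List.replicate k ()) = enc k := by
  induction k with
  | zero => rfl
  | succ k ih =>
    have : enc (List.replicate (k + 1) ()) = SExp.cons SExp.nil (enc (List.replicate k ())) := rfl
    rw [this, ih]; rfl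

theorem units {f : α → ℕ} (hf : PolyTime f) : PolyTime (fun a => List.replicate (f a) ()) :=
  hf.of_enc _ id (fun _ => rfl) fun _ => enc_replicate _

theorem of_units {f : α → ℕ} (hf : PolyTime (fun a => List.replicate (f a) ())) : PolyTime f :=
  hf.of_enc _ id (fun _ => rfl) fun _ => (enc_replicate _).symm

theorem foldl_replicate {σ : Type} (f : σ → σ) (k : ℕ) (s : σ) :
    (List.replicate k ()).foldl (fun s _ => f s) s = f^[k] s := by
  induction k generalizing s with
  | zero => rfl
  | succ k ih => simp [List.replicate_succ, ih]

theorem iterate {n : α → ℕ} {i : α → σ} {f : α → σ → σ} (hn : PolyTime n) (hi : PolyTime i)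
    (hf : PolyTime fun p : α × σ => f p.1 p.2) {φ : α → ℕ} (hφ : PolyBdd φ)
    (hb : ∀ a, ∀ k ≤ n a, esize ((f a)^[k] (i a)) ≤ φ a) : PolyTime (fun a => (f a)^[n a] (i a)) :=
  (foldl (l := fun a => List.replicate (n a) ()) (i := i) (f := fun a s _ => f a s) hn.units hi
    (hf.comp (PolyTime.fst.pair PolyTime.snd.fst')) hφ fun a k => by
      rw [List.take_replicate, foldl_replicate]; exact hb a _ (min_le_right _ _)).of_enc _ id
    (fun _ => rfl) fun a => by rw [id, foldl_replicate]

theorem succ {f : α → ℕ} (hf : PolyTime f) : PolyTime (fun a => f a + 1) :=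
  of_units (((const ()).cons hf.units).of_enc _ id (fun _ => rfl) fun _ => rfl)

theorem pred {f : α → ℕ} (hf : PolyTime f) : PolyTime (fun a => f a - 1) :=
  of_units (hf.units.tail.of_enc _ id (fun _ => rfl) fun a => by simp)

theorem add {f g : α → ℕ} (hf : PolyTime f) (hg : PolyTime g) : PolyTime (fun a => f a + g a) :=
  of_units ((hf.units.append hg.units).of_enc _ id (fun _ => rfl) fun a => by simp)

theorem sub {f g : α → ℕ} (hf : PolyTime f) (hg : PolyTime g) : PolyTime (fun a => f a - g a) := by
  have key : ∀ k m : ℕ, (fun x => x - 1)^[k] m = m - k := by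
    intro k
    induction k with
    | zero => simp
    | succ k ih => intro m; rw [Function.iterate_succ_apply, ih]; omega
  exact (iterate (n := g) (i := f) (f := fun _ x => x - 1) hg hf PolyTime.snd.pred hf.bdd fun a k _ => by
    rw [key, esize_nat, esize_nat]; omega).of_enc _ id (fun _ => rfl) fun a => by rw [id, key]

theorem nat_le {f g : α → ℕ} (hf : PolyTime f) (hg : PolyTime g) :
    PolyTime (fun a => decide (f a ≤ g a)) :=
  (hf.sub hg).units.isEmpty.of_enc _ id (fun _ => rfl) fun a => by
    congr 1; simp [Nat.sub_eq_zero_iff_le]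

theorem length {l : α → List β} (hl : PolyTime l) : PolyTime (fun a => (l a).length) :=
  of_units ((hl.map (f := fun _ _ => ()) (const ())).of_enc _ id (fun _ => rfl) fun a => by
    simp)

theorem range {f : α → ℕ} (hf : PolyTime f) : PolyTime (fun a => List.range (f a)) := by
  have key : ∀ k, (fun l : List ℕ => l.length :: l)^[k] [] = (List.range k).reverse := by
    intro k
    induction k with
    | zero => rfl
    | succ k ih => rw [Function.iterate_succ_apply', ih, List.range_succ]; simp
  refine ((iterate (n := f) (i := fun _ => ([] : List ℕ)) (f := fun _ l => l.length :: l) hf (const _)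
    (PolyTime.snd.length.cons PolyTime.snd) (φ := fun a => esize (f a) * (esize (f a) + 1) + 1)
    ((hf.bdd.mul (hf.bdd.add (.const 1))).add (.const 1)) fun a k hk => ?_).reverse).of_enc _ id
    (fun _ => rfl) fun a => by rw [key]; simp
  rw [key, esize_reverse]
  refine (esize_le_of_forall _ (esize (f a)) fun x hx => ?_).trans ?_
  · rw [esize_nat, esize_nat]
    have := List.mem_range.1 hx
    omega
  · gcongr
    rw [List.length_range, esize_nat]
    omega

/-- The `k`-th element of an expression that represents a list. -/
def _root_.SExp.nth (x : SExp) (k : ℕ) : SExp := (SExp.snd^[k] x).fst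

theorem size_iterate_snd (x : SExp) (k : ℕ) : (SExp.snd^[k] x).size ≤ x.size := by
  induction k generalizing x with
  | zero => rfl
  | succ k ih => exact (ih _).trans (sexp_size_snd x)

theorem _root_.SExp.size_nth (x : SExp) (k : ℕ) : (x.nth k).size ≤ x.size :=
  (sexp_size_fst _).trans (size_iterate_snd x k)

theorem nth {f : α → SExp} {g : α → ℕ} (hf : PolyTime f) (hg : PolyTime g) :
    PolyTime (fun a => (f a).nth (g a)) :=
  (iterate (n := g) (i := f) (f := fun _ x => x.snd) hg hf PolyTime.snd.sexp_snd hf.bdd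
    fun _ _ _ => size_iterate_snd _ _).sexp_fst

theorem _root_.SExp.nth_ofList (l : List SExp) (k : ℕ) :
    (SExp.ofList l).nth k = (l[k]?).getD SExp.nil := by
  induction l generalizing k with
  | nil =>
    have : ∀ k, SExp.snd^[k] SExp.nil = SExp.nil := fun k => by
      induction k with
      | zero => rfl
      | succ k ih => rw [Function.iterate_succ_apply']; rw [ih]; rfl
    simp [SExp.nth, SExp.ofList, this]; rfl
  | cons a l ih =>
    cases k with
    | zero => rfl
    | succ k =>
      have : (SExp.ofList (a :: l)).nth (k + 1) = (SExp.ofList l).nth k := rfl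
      rw [this, ih, List.getElem?_cons_succ]

/-- Random access to a list; the default value has to be represented by the empty expression. -/
theorem list_getD {l : α → List β} {g : α → ℕ} {d : β} (hd : enc d = SExp.nil) (hl : PolyTime l)
    (hg : PolyTime g) : PolyTime (fun a => (l a).getD (g a) d) :=
  (hl.enc_.nth hg).of_enc _ id (fun _ => rfl) fun a => by
    have : enc (l a) = SExp.ofList ((l a).map enc) := rfl
    simp only [id, this, SExp.nth_ofList, List.getD_eq_getElem?_getD, List.getElem?_map]
    cases (l a)[g a]? with
    | none => exact hd
    | some b => rfl

/-- All functions on a finite type whose encoding is recognizable are admissible. -/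
theorem sign_eq (s : SignType) {f : α → SignType} (hf : PolyTime f) :
    PolyTime (fun a => decide (f a = s)) := by
  have h0 : PolyTime fun a => (enc (f a)).truthy := hf.enc_.truthy
  have h1 : PolyTime fun a => (enc (f a)).snd.truthy := hf.enc_.sexp_snd.truthy
  cases s
  · exact h0.not.of_enc _ id (fun _ => rfl) fun a => by simp only [id]; generalize f a = s; cases s <;> rfl
  · exact h1.of_enc _ id (fun _ => rfl) fun a => by simp only [id]; generalize f a = s; cases s <;> rfl
  · exact (h0.and h1.not).of_enc _ id (fun _ => rfl) fun a => by simp only [id]; generalize f a = s; cases s <;> rfl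

theorem sign_neg {f : α → SignType} (hf : PolyTime f) : PolyTime (fun a => -(f a)) :=
  ((hf.sign_eq 0).ite (const (0 : SignType)) ((hf.sign_eq 1).ite (const (-1)) (const 1))).of_enc _ id
    (fun _ => rfl) fun a => by
      rw [id]; rcases f a <;> rfl

end PolyTime

/-! ### Homogeneous coordinates and lines -/

/-- Homogeneous vectors: `(x, 1)` is the point `x`, and `(u, 0)` is the direction `u`. -/
abbrev HVec (m : ℕ) : Type := (Fin (m + 1) → ℝ) × ℝ

/-- The linear form that is positive above the hyperplane and negative below it. -/
def Hyperplane.form {m : ℕ} (H : Hyperplane m) : HVec m →ₗ[ℝ] ℝ where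
  toFun v := v.1 (Fin.last m) - ∑ j, H.slope j * v.1 j.castSucc - H.icpt * v.2
  map_add' v w := by
    simp only [Prod.fst_add, Prod.snd_add, Pi.add_apply, mul_add, Finset.sum_add_distrib]
    ring
  map_smul' c v := by
    simp only [Prod.smul_fst, Prod.smul_snd, Pi.smul_apply, smul_eq_mul, RingHom.id_apply, mul_sub,
      Finset.mul_sum]
    refine congrArg₂ _ (congrArg₂ _ rfl (Finset.sum_congr rfl fun j _ => ?_)) ?_ <;> ring

theorem Hyperplane.form_apply {m : ℕ} (H : Hyperplane m) (v : HVec m) :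
    H.form v = v.1 (Fin.last m) - ∑ j, H.slope j * v.1 j.castSucc - H.icpt * v.2 := rfl

theorem Hyperplane.side_eq {m : ℕ} (H : Hyperplane m) (x : Fin (m + 1) → ℝ) :
    H.side x = SignType.sign (H.form (x, 1)) := by
  rw [Hyperplane.side, Hyperplane.height, Hyperplane.form_apply]
  congr 1
  ring

theorem Hyperplane.mem_carrier {m : ℕ} (H : Hyperplane m) (x : Fin (m + 1) → ℝ) :
    x ∈ H.carrier ↔ H.form (x, 1) = 0 := by
  rw [Hyperplane.form_apply]
  simp only [Hyperplane.carrier, Hyperplane.height, Set.mem_ofPred_eq]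
  constructor <;> intro h <;> linarith

theorem Hyperplane.form_add_smul {m : ℕ} (H : Hyperplane m) (p u : Fin (m + 1) → ℝ) (t w : ℝ) :
    H.form (p + t • u, w) = H.form (p, w) + t * H.form (u, 0) := by
  have : ((p + t • u, w) : HVec m) = (p, w) + t • (u, 0) := by ext <;> simp
  rw [this, map_add, map_smul, smul_eq_mul]

variable {n m : ℕ}

/-- The functional `g` is not constant on lines that are parallel to the hyperplanes `I`, and these
hyperplanes meet in a line. -/
def Transversal (h : Fin n → Hyperplane m) (g : (Fin (m + 1) → ℝ) →ₗ[ℝ] ℝ) (I : Fin m → Fin n) :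
    Prop :=
  ∀ y, g y = 0 → (∀ k, (h (I k)).form (y, 0) = 0) → y = 0

theorem mem_commonFlat {h : Fin n → Hyperplane m} {I : Fin m → Fin n} {x : Fin (m + 1) → ℝ} :
    x ∈ commonFlat h I ↔ ∀ k, (h (I k)).form (x, 1) = 0 := by
  simp [commonFlat, Hyperplane.mem_carrier]

theorem Transversal.exists_line {h : Fin n → Hyperplane m} {g : (Fin (m + 1) → ℝ) →ₗ[ℝ] ℝ}
    {I : Fin m → Fin n} (ht : Transversal h g I) :
    ∃ p u, g u = 1 ∧ commonFlat h I = Set.range (fun t : ℝ => p + t • u) := by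
  let Ψ : (Fin (m + 1) → ℝ) →ₗ[ℝ] (Fin (m + 1) → ℝ) := LinearMap.pi
    (Fin.cons g fun k => (h (I k)).form ∘ₗ LinearMap.inl ℝ _ _)
  have h0 : ∀ y, Ψ y 0 = g y := fun y => rfl
  have hs : ∀ y k, Ψ y (Fin.succ k) = (h (I k)).form (y, 0) := fun y k => rfl
  have inj : Function.Injective Ψ := by
    rw [injective_iff_map_eq_zero]
    intro y hy
    exact ht y (by rw [← h0, hy]; rfl) fun k => by rw [← hs, hy]; rfl
  have surj := LinearMap.injective_iff_surjective.1 inj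
  obtain ⟨u, hu⟩ := surj (Fin.cons 1 0)
  obtain ⟨p, hp⟩ := surj (Fin.cons 0 fun k => (h (I k)).icpt)
  have hu0 : g u = 1 := by rw [← h0, hu]; rfl
  have hus : ∀ k, (h (I k)).form (u, 0) = 0 := fun k => by rw [← hs, hu]; rfl
  have hp0 : g p = 0 := by rw [← h0, hp]; rfl
  have hps : ∀ k, (h (I k)).form (p, 1) = 0 := fun k => by
    have : (h (I k)).form (p, 0) = (h (I k)).icpt := by rw [← hs, hp]; rfl
    rw [Hyperplane.form_apply] at this ⊢
    simp only at this ⊢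
    linarith
  refine ⟨p, u, hu0, Set.ext fun x => ?_⟩
  rw [mem_commonFlat, Set.mem_range]
  constructor
  · intro hx
    refine ⟨g x, ?_⟩
    have : x - (p + g x • u) = 0 := by
      refine ht _ (by simp [hp0, hu0]) fun k => ?_
      have : ((x - (p + g x • u), 0) : HVec m) = (x, 1) - (p, 1) - g x • (u, 0) := by
        ext <;> simp [sub_sub]
      rw [this, map_sub, map_sub, map_smul, hx, hps, hus]
      simp
    exact (sub_eq_zero.1 this).symm
  · rintro ⟨t, rfl⟩ k
    rw [Hyperplane.form_add_smul, hps, hus]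
    simp

theorem form_dir_eq_zero {h : Fin n → Hyperplane m} {I : Fin m → Fin n} {p u : Fin (m + 1) → ℝ}
    (hl : commonFlat h I = Set.range (fun t : ℝ => p + t • u)) (k : Fin m) :
    (h (I k)).form (u, 0) = 0 := by
  have h0 : p + (0 : ℝ) • u ∈ commonFlat h I := hl ▸ ⟨0, rfl⟩
  have h1 : p + (1 : ℝ) • u ∈ commonFlat h I := hl ▸ ⟨1, rfl⟩
  have h0 := mem_commonFlat.1 h0 k
  have h1 := mem_commonFlat.1 h1 k
  rw [Hyperplane.form_add_smul] at h0 h1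
  linarith

theorem exists_smul_of_line {h : Fin n → Hyperplane m} {I : Fin m → Fin n} {p u : Fin (m + 1) → ℝ}
    (hl : commonFlat h I = Set.range (fun t : ℝ => p + t • u)) {y : Fin (m + 1) → ℝ}
    (hy : ∀ k, (h (I k)).form (y, 0) = 0) : ∃ c : ℝ, y = c • u := by
  have h0 : p + (0 : ℝ) • u ∈ commonFlat h I := hl ▸ ⟨0, rfl⟩
  have : p + y ∈ commonFlat h I := by
    rw [mem_commonFlat] at h0 ⊢
    intro k
    have := (h (I k)).form_add_smul p y 1 1
    rw [one_smul] at this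
    have h0 := h0 k
    rw [zero_smul, add_zero] at h0
    rw [this, h0, hy]
    simp
  rw [hl] at this
  obtain ⟨t, ht⟩ := this
  exact ⟨t, (add_left_cancel ht).symm⟩

theorem transversal_of_line {h : Fin n → Hyperplane m} {I : Fin m → Fin n} {p u : Fin (m + 1) → ℝ}
    (hl : commonFlat h I = Set.range (fun t : ℝ => p + t • u)) {g : (Fin (m + 1) → ℝ) →ₗ[ℝ] ℝ}
    (hg : g u ≠ 0) : Transversal h g I := by
  intro y hy hk
  obtain ⟨c, rfl⟩ := exists_smul_of_line hl hk
  rw [map_smul, smul_eq_mul, mul_eq_zero] at hy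
  rw [hy.resolve_right hg, zero_smul]

theorem Transversal.isLineSet {h : Fin n → Hyperplane m} {g : (Fin (m + 1) → ℝ) →ₗ[ℝ] ℝ}
    {I : Fin m → Fin n} (ht : Transversal h g I) : IsLineSet (commonFlat h I) := by
  obtain ⟨p, u, hu, hl⟩ := ht.exists_line
  exact ⟨p, u, fun h0 => by simp [h0] at hu, hl⟩

theorem isLineSet_iff {h : Fin n → Hyperplane m} {I : Fin m → Fin n} :
    IsLineSet (commonFlat h I) ↔ ∃ k, Transversal h (LinearMap.proj k) I := by
  constructor
  · rintro ⟨p, u, hu, hl⟩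
    obtain ⟨k, hk⟩ := Function.ne_iff.1 hu
    exact ⟨k, transversal_of_line hl hk⟩
  · rintro ⟨k, hk⟩
    exact hk.isLineSet

theorem crosses_iff {h : Fin n → Hyperplane m} {I : Fin m → Fin n} {p u : Fin (m + 1) → ℝ}
    (hl : commonFlat h I = Set.range (fun t : ℝ => p + t • u)) (H : Hyperplane m) :
    H.Crosses (commonFlat h I) ↔ H.form (u, 0) ≠ 0 := by
  rw [hl]
  constructor
  · rintro ⟨⟨x, ⟨t, rfl⟩, ht⟩, h2⟩ h0
    refine h2 ?_
    rintro _ ⟨s, rfl⟩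
    rw [Hyperplane.mem_carrier] at ht ⊢
    simp only [Hyperplane.form_add_smul, h0] at ht ⊢
    linarith
  · intro h0
    refine ⟨⟨p + (-(H.form (p, 1)) / H.form (u, 0)) • u, ⟨_, rfl⟩, ?_⟩, fun hsub => h0 ?_⟩
    · rw [Hyperplane.mem_carrier, Hyperplane.form_add_smul]
      field_simp
      ring
    · have h1 := hsub ⟨0, rfl⟩
      have h2 := hsub ⟨1, rfl⟩
      rw [Hyperplane.mem_carrier] at h1 h2
      simp only [Hyperplane.form_add_smul] at h1 h2
      linarith

/-- The linear part of the equation of the hyperplane. -/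
def Hyperplane.lin (H : Hyperplane m) : (Fin (m + 1) → ℝ) →ₗ[ℝ] ℝ :=
  H.form ∘ₗ LinearMap.inl ℝ _ _

theorem Hyperplane.lin_apply (H : Hyperplane m) (y : Fin (m + 1) → ℝ) : H.lin y = H.form (y, 0) := rfl

theorem line_and_crosses_iff {h : Fin n → Hyperplane m} {I : Fin m → Fin n} {H : Hyperplane m} :
    IsLineSet (commonFlat h I) ∧ H.Crosses (commonFlat h I) ↔ Transversal h H.lin I := by
  constructor
  · rintro ⟨⟨p, u, hu, hl⟩, hc⟩
    exact transversal_of_line hl ((crosses_iff hl H).1 hc)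
  · intro ht
    obtain ⟨p, u, hu, hl⟩ := ht.exists_line
    refine ⟨ht.isLineSet, (crosses_iff hl H).2 ?_⟩
    rw [← Hyperplane.lin_apply, hu]
    exact one_ne_zero

/-! ### Order types of tame families -/

/-- The predicate is eventually true or eventually false. -/
def EvDec {τ : Type} (l : Filter τ) (P : τ → Prop) : Prop := (∀ᶠ t in l, P t) ∨ ∀ᶠ t in l, ¬ P t

namespace EvDec

variable {τ : Type} {l : Filter τ} {P Q : τ → Prop}

theorem congr (hP : EvDec l P) (h : ∀ t, P t ↔ Q t) : EvDec l Q := by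
  simpa only [EvDec, h] using hP

theorem not (hP : EvDec l P) : EvDec l fun t => ¬ P t := by
  rcases hP with h | h
  · exact .inr (h.mono fun _ h h' => h' h)
  · exact .inl h

theorem and (hP : EvDec l P) (hQ : EvDec l Q) : EvDec l fun t => P t ∧ Q t := by
  rcases hP with h | h
  · rcases hQ with h' | h'
    · exact .inl (h.and h')
    · exact .inr (h'.mono fun _ h h' => h h'.2)
  · exact .inr (h.mono fun _ h h' => h h'.1)

theorem or (hP : EvDec l P) (hQ : EvDec l Q) : EvDec l fun t => P t ∨ Q t :=
  (hP.not.and hQ.not).not.congr fun _ => by tauto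

theorem forall_ {ι : Type} [Finite ι] {P : ι → τ → Prop} (hP : ∀ i, EvDec l (P i)) :
    EvDec l fun t => ∀ i, P i t := by
  by_cases h : ∀ i, ∀ᶠ t in l, P i t
  · exact .inl (eventually_all.2 h)
  · obtain ⟨i, hi⟩ := not_forall.1 h
    exact .inr (((hP i).resolve_left fun h => hi h).mono fun t ht h => ht (h i))

theorem exists_ {ι : Type} [Finite ι] {P : ι → τ → Prop} (hP : ∀ i, EvDec l (P i)) :
    EvDec l fun t => ∃ i, P i t :=
  (forall_ fun i => (hP i).not).not.congr fun _ => by push Not; rfl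

theorem imp_const {A : Prop} (hP : EvDec l P) : EvDec l fun t => A → P t := by
  by_cases h : A
  · exact hP.congr fun t => by simp [h]
  · exact .inl (Eventually.of_forall fun t hA => absurd hA h)

end EvDec

/-- A ring of functions, each of which eventually has a constant sign. -/
def Tame {τ : Type} (l : Filter τ) (R : Subring (τ → ℝ)) : Prop :=
  ∀ f ∈ R, (∀ᶠ t in l, f t = 0) ∨ (∀ᶠ t in l, 0 < f t) ∨ ∀ᶠ t in l, f t < 0

namespace Tame

variable {τ : Type} {l : Filter τ} {R : Subring (τ → ℝ)}

theorem evDec_zero (hR : Tame l R) {f : τ → ℝ} (hf : f ∈ R) : EvDec l fun t => f t = 0 := by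
  rcases hR f hf with h | h | h
  · exact .inl h
  · exact .inr (h.mono fun _ h => h.ne')
  · exact .inr (h.mono fun _ h => h.ne)

theorem evDec_pos (hR : Tame l R) {f : τ → ℝ} (hf : f ∈ R) : EvDec l fun t => 0 < f t := by
  rcases hR f hf with h | h | h
  · exact .inr (h.mono fun _ h => by simp [h])
  · exact .inl h
  · exact .inr (h.mono fun _ h => h.not_gt)

/-- The functions of the ring as functions that do not depend on the new variable. -/
def baseHom (R : Subring (τ → ℝ)) : R →+* (τ × ℝ → ℝ) where
  toFun f q := f.1 q.1
  map_one' := rfl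
  map_mul' _ _ := rfl
  map_zero' := rfl
  map_add' _ _ := rfl

theorem baseHom_apply (f : R) (q : τ × ℝ) : baseHom R f q = f.1 q.1 := rfl

/-- A polynomial in a new variable with coefficients in the ring, as a function of the old arguments and
of the value of the new variable. -/
noncomputable def evalHom (R : Subring (τ → ℝ)) : Polynomial R →+* (τ × ℝ → ℝ) :=
  Polynomial.eval₂RingHom (baseHom R) (fun q => q.2)

/-- The polynomials in a new variable with coefficients in the given ring of functions. -/
noncomputable def adjoin (R : Subring (τ → ℝ)) : Subring (τ × ℝ → ℝ) := (evalHom R).range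

theorem evalHom_C (f : R) (q : τ × ℝ) : evalHom R (Polynomial.C f) q = f.1 q.1 := by
  simp [evalHom, baseHom_apply]

theorem evalHom_X (q : τ × ℝ) : evalHom R Polynomial.X q = q.2 := by
  simp [evalHom]

theorem mem_adjoin {f : τ → ℝ} (hf : f ∈ R) : (fun q : τ × ℝ => f q.1) ∈ adjoin R :=
  ⟨Polynomial.C ⟨f, hf⟩, funext fun q => evalHom_C _ q⟩

theorem var_mem_adjoin : (fun q : τ × ℝ => q.2) ∈ adjoin R :=
  ⟨Polynomial.X, funext fun q => evalHom_X q⟩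

theorem evalHom_continuous (P : Polynomial R) (t : τ) : Continuous fun z => evalHom R P (t, z) := by
  induction P using Polynomial.induction_on' with
  | add p q hp hq =>
    simp only [map_add, Pi.add_apply]
    exact hp.add hq
  | monomial k a =>
    have : (fun z => evalHom R (Polynomial.monomial k a) (t, z)) = fun z => a.1 t * z ^ k := by
      funext z
      simp [evalHom, baseHom_apply]
    rw [this]
    fun_prop

theorem adjoin_small (hR : Tame l R) : Tame (l.curry (𝓝[>] (0 : ℝ))) (adjoin R) := by
  rintro _ ⟨P, rfl⟩
  simp only [eventually_curry_iff]
  induction hN : P.natDegree using Nat.strong_induction_on generalizing P with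
  | _ N ih =>
    have hev : ∀ t z, evalHom R P (t, z) = evalHom R P.divX (t, z) * z + (P.coeff 0).1 t := by
      intro t z
      conv_lhs => rw [← Polynomial.divX_mul_X_add P]
      simp [evalHom_C, evalHom_X]
    have hcont : ∀ t, Tendsto (fun z => evalHom R P (t, z)) (𝓝[>] 0) (𝓝 ((P.coeff 0).1 t)) := by
      intro t
      have := (evalHom_continuous P t).tendsto 0
      rw [hev] at this
      simpa using this.mono_left nhdsWithin_le_nhds
    rcases hR _ (P.coeff 0).2 with h0 | h0 | h0
    · -- the constant coefficient vanishes, so that the variable can be divided out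
      by_cases hdeg : N = 0
      · left
        have hP := Polynomial.eq_C_of_natDegree_eq_zero (hN.trans hdeg)
        filter_upwards [h0] with t ht
        refine Eventually.of_forall fun z => ?_
        rw [hP, evalHom_C]
        exact ht
      · have hlt : P.divX.natDegree < N := by
          rw [Polynomial.natDegree_divX_eq_natDegree_tsub_one]; omega
        have hz : ∀ᶠ z in 𝓝[>] (0 : ℝ), 0 < z := self_mem_nhdsWithin
        rcases ih _ hlt P.divX rfl with h | h | h
        · left
          filter_upwards [h0, h] with t ht h
          filter_upwards [h] with z h
          simp [hev, h, ht]
        · right; left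
          filter_upwards [h0, h] with t ht h
          filter_upwards [h, hz] with z h hz
          rw [hev, ht, add_zero]
          exact mul_pos h hz
        · right; right
          filter_upwards [h0, h] with t ht h
          filter_upwards [h, hz] with z h hz
          rw [hev, ht, add_zero]
          exact mul_neg_of_neg_of_pos h hz
    · right; left
      exact h0.mono fun t ht => (hcont t).eventually_const_lt ht
    · right; right
      exact h0.mono fun t ht => (hcont t).eventually_lt_const ht

theorem evalHom_eq_eval (P : Polynomial R) (t : τ) (z : ℝ) : evalHom R P (t, z) =
    (P.map ((Pi.evalRingHom (fun _ : τ => ℝ) t).comp R.subtype)).eval z := by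
  induction P using Polynomial.induction_on' with
  | add p q hp hq => simp [hp, hq]
  | monomial k a => simp [evalHom, baseHom_apply]

theorem adjoin_large (hR : Tame l R) : Tame (l.curry (atTop : Filter ℝ)) (adjoin R) := by
  rintro _ ⟨P, rfl⟩
  simp only [eventually_curry_iff]
  -- the sign for large arguments is that of the leading coefficient
  induction hN : P.support.card using Nat.strong_induction_on generalizing P with
  | _ N ih =>
    by_cases hP0 : P = 0
    · left
      simp [hP0]
    have key : ∀ t, 0 < P.leadingCoeff.1 t → ∀ᶠ z in atTop, 0 < evalHom R P (t, z) := by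
      intro t ht
      set f := (Pi.evalRingHom (fun _ : τ => ℝ) t).comp R.subtype
      have hlc : f P.leadingCoeff ≠ 0 := ht.ne'
      have hl := Polynomial.leadingCoeff_map_of_leadingCoeff_ne_zero f hlc
      simp only [evalHom_eq_eval]
      by_cases hd : (P.map f).natDegree = 0
      · rw [Polynomial.eq_C_of_natDegree_eq_zero hd]
        rw [Polynomial.leadingCoeff, hd] at hl
        simp only [Polynomial.eval_C, hl]
        exact Eventually.of_forall fun _ => ht
      · exact (Polynomial.tendsto_atTop_of_leadingCoeff_nonneg _
          (Polynomial.natDegree_pos_iff_degree_pos.1 (Nat.pos_of_ne_zero hd)) (hl ▸ ht.le)).eventually_gt_atTop 0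
    have keyneg : ∀ t, P.leadingCoeff.1 t < 0 → ∀ᶠ z in atTop, evalHom R P (t, z) < 0 := by
      intro t ht
      set f := (Pi.evalRingHom (fun _ : τ => ℝ) t).comp R.subtype
      have hlc : f P.leadingCoeff ≠ 0 := ht.ne
      have hl := Polynomial.leadingCoeff_map_of_leadingCoeff_ne_zero f hlc
      simp only [evalHom_eq_eval]
      by_cases hd : (P.map f).natDegree = 0
      · rw [Polynomial.eq_C_of_natDegree_eq_zero hd]
        rw [Polynomial.leadingCoeff, hd] at hl
        simp only [Polynomial.eval_C, hl]
        exact Eventually.of_forall fun _ => ht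
      · exact (Polynomial.tendsto_atBot_of_leadingCoeff_nonpos _
          (Polynomial.natDegree_pos_iff_degree_pos.1 (Nat.pos_of_ne_zero hd)) (hl ▸ ht.le)).eventually_lt_atBot 0
    rcases hR _ P.leadingCoeff.2 with h0 | h0 | h0
    · have hev : ∀ t, P.leadingCoeff.1 t = 0 → ∀ z,
          evalHom R P (t, z) = evalHom R P.eraseLead (t, z) := by
        intro t ht z
        conv_lhs => rw [← Polynomial.eraseLead_add_monomial_natDegree_leadingCoeff P]
        rw [map_add]; simp [evalHom, baseHom_apply, ht]
      have hlt := Polynomial.eraseLead_support_card_lt hP0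
      rcases ih _ (hN ▸ hlt) P.eraseLead rfl with h | h | h
      · left
        filter_upwards [h0, h] with t ht h
        simpa only [hev t ht] using h
      · right; left
        filter_upwards [h0, h] with t ht h
        simpa only [hev t ht] using h
      · right; right
        filter_upwards [h0, h] with t ht h
        simpa only [hev t ht] using h
    · right; left
      exact h0.mono key
    · right; right
      exact h0.mono keyneg

end Tame

/-- The normal vector of the hyperplane. -/
def Hyperplane.normal (H : Hyperplane m) : Fin (m + 1) → ℝ :=
  fun k => Fin.lastCases (motive := fun _ => ℝ) 1 (fun j => -H.slope j) k

theorem Hyperplane.form_eq_dotProduct (H : Hyperplane m) (v : HVec m) :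
    H.form v = H.normal ⬝ᵥ v.1 - H.icpt * v.2 := by
  simp only [Hyperplane.form_apply, dotProduct, Fin.sum_univ_castSucc, Hyperplane.normal,
    Fin.lastCases_castSucc, Fin.lastCases_last, neg_mul, Finset.sum_neg_distrib]
  ring

/-- The coefficient matrix of the functional `c` and the hyperplanes `H`. -/
def coeffMatrix (c : Fin (m + 1) → ℝ) (H : Fin m → Hyperplane m) :
    Matrix (Fin (m + 1)) (Fin (m + 1)) ℝ :=
  Matrix.of (Fin.cons c fun k => (H k).normal)

theorem coeffMatrix_mulVec (c : Fin (m + 1) → ℝ) (H : Fin m → Hyperplane m) (y : Fin (m + 1) → ℝ) :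
    (coeffMatrix c H).mulVec y = Fin.cons (c ⬝ᵥ y) fun k => (H k).normal ⬝ᵥ y := by
  funext i
  refine Fin.cases ?_ (fun k => ?_) i <;> rfl

theorem transversal_iff_det {h : Fin n → Hyperplane m} {I : Fin m → Fin n}
    {g : (Fin (m + 1) → ℝ) →ₗ[ℝ] ℝ} {c : Fin (m + 1) → ℝ} (hg : ∀ y, g y = c ⬝ᵥ y) :
    Transversal h g I ↔ (coeffMatrix c fun k => h (I k)).det ≠ 0 := by
  have key : ∀ y, (coeffMatrix c fun k => h (I k)).mulVec y = 0 ↔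
      g y = 0 ∧ ∀ k, (h (I k)).form (y, 0) = 0 := by
    intro y
    rw [coeffMatrix_mulVec, funext_iff, Fin.forall_fin_succ, hg]
    simp [Hyperplane.form_eq_dotProduct]
  rw [Ne, ← Matrix.exists_mulVec_eq_zero_iff]
  simp only [key, Transversal]
  push Not
  exact forall_congr' fun y => ⟨fun h hy hg => by_contra fun hne => hy (h hg (not_exists_not.1 fun ⟨k, hk⟩ => hne ⟨k, hk⟩)),
    fun h hg hk => by_contra fun hy => (h hy hg).elim fun k hk' => hk' (hk k)⟩

/-- The lexicographic condition on a vector to be zero or to have a positive first non-zero entry. -/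
def LexNonneg {k : ℕ} (d : Fin k → ℝ) : Prop :=
  (∀ l, d l = 0) ∨ ∃ l, (∀ l' < l, d l' = 0) ∧ 0 < d l

theorem toLex_le_iff {k : ℕ} (x y : Fin k → ℝ) : toLex x ≤ toLex y ↔ LexNonneg (y - x) := by
  have hlt : toLex x < toLex y ↔ ∃ i, (∀ j, j < i → x j = y j) ∧ x i < y i := Iff.rfl
  refine le_iff_eq_or_lt.trans (or_congr ⟨fun h l => ?_, fun h => ?_⟩
    (hlt.trans (exists_congr fun l => and_congr ?_ ?_)))
  · rw [toLex_inj.1 h]; simp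
  · rw [toLex_inj]; funext l; have := h l; simp only [Pi.sub_apply] at this; linarith
  · refine forall₂_congr fun j _ => ?_
    simp only [Pi.sub_apply]
    constructor <;> intro h <;> linarith
  · simp

theorem lexNonneg_mul {k : ℕ} (d : Fin k → ℝ) {a : ℝ} (ha : 0 < a) :
    LexNonneg (fun l => d l * a) ↔ LexNonneg d := by
  simp [LexNonneg, ha.ne', ha]

/-- The numerators of the coordinates of the intersection of the hyperplanes `I` and `H`. -/
noncomputable def vertexNumerator (h : Fin n → Hyperplane m) (I : Fin m → Fin n) (H : Hyperplane m) :
    Fin (m + 1) → ℝ :=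
  (coeffMatrix H.normal fun k => h (I k)).cramer (Fin.cons H.icpt fun k => (h (I k)).icpt)

/-- The common denominator of the coordinates of the intersection of the hyperplanes `I` and `H`. -/
noncomputable def vertexDenominator (h : Fin n → Hyperplane m) (I : Fin m → Fin n)
    (H : Hyperplane m) : ℝ :=
  (coeffMatrix H.normal fun k => h (I k)).det

theorem mem_inter_iff_mulVec {h : Fin n → Hyperplane m} {I : Fin m → Fin n} {H : Hyperplane m}
    {x : Fin (m + 1) → ℝ} : x ∈ commonFlat h I ∩ H.carrier ↔
      (coeffMatrix H.normal fun k => h (I k)).mulVec x = Fin.cons H.icpt fun k => (h (I k)).icpt := by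
  rw [coeffMatrix_mulVec, funext_iff, Fin.forall_fin_succ, Set.mem_inter_iff, mem_commonFlat,
    Hyperplane.mem_carrier, and_comm]
  simp [Hyperplane.form_eq_dotProduct, sub_eq_zero]

theorem mem_inter_iff {h : Fin n → Hyperplane m} {I : Fin m → Fin n} {H : Hyperplane m}
    (hd : vertexDenominator h I H ≠ 0) {x : Fin (m + 1) → ℝ} :
    x ∈ commonFlat h I ∩ H.carrier ↔
      x = (vertexDenominator h I H)⁻¹ • vertexNumerator h I H := by
  rw [mem_inter_iff_mulVec]
  constructor
  · intro hx
    rw [vertexNumerator, Matrix.cramer_eq_adjugate_mulVec, ← hx, Matrix.mulVec_mulVec,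
      Matrix.adjugate_mul, Matrix.smul_mulVec, Matrix.one_mulVec, smul_smul]
    exact (by rw [inv_mul_cancel₀ hd, one_smul] : x = ((vertexDenominator h I H)⁻¹ *
      vertexDenominator h I H) • x)
  · rintro rfl
    rw [Matrix.mulVec_smul, vertexNumerator, Matrix.mulVec_cramer, smul_smul]
    exact (by intro y; rw [inv_mul_cancel₀ hd, one_smul] : ∀ y : Fin (m + 1) → ℝ,
      ((vertexDenominator h I H)⁻¹ * vertexDenominator h I H) • y = y) _

theorem transversal_lin_iff {h : Fin n → Hyperplane m} {I : Fin m → Fin n} {H : Hyperplane m} :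
    Transversal h H.lin I ↔ vertexDenominator h I H ≠ 0 :=
  transversal_iff_det fun y => by simp [Hyperplane.lin_apply, Hyperplane.form_eq_dotProduct]

theorem leftOrEqual_iff {h : Fin n → Hyperplane m} {I : Fin m → Fin n} {i j : Fin n} :
    LeftOrEqual h I i j ↔ vertexDenominator h I (h i) ≠ 0 ∧ vertexDenominator h I (h j) ≠ 0 ∧
      LexNonneg (fun l => (vertexNumerator h I (h j) l * vertexDenominator h I (h i) -
        vertexNumerator h I (h i) l * vertexDenominator h I (h j)) *
        (vertexDenominator h I (h i) * vertexDenominator h I (h j))) := by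
  have e : LeftOrEqual h I i j ↔ (IsLineSet (commonFlat h I) ∧ (h i).Crosses (commonFlat h I)) ∧
      (IsLineSet (commonFlat h I) ∧ (h j).Crosses (commonFlat h I)) ∧
      ∀ x ∈ commonFlat h I ∩ (h i).carrier, ∀ y ∈ commonFlat h I ∩ (h j).carrier,
        toLex x ≤ toLex y := by
    rw [LeftOrEqual]; tauto
  rw [e, line_and_crosses_iff, line_and_crosses_iff, transversal_lin_iff, transversal_lin_iff]
  refine and_congr_right fun hi => and_congr_right fun hj => ?_
  simp only [mem_inter_iff hi, mem_inter_iff hj, forall_eq, toLex_le_iff]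
  set Δ := vertexDenominator h I (h i)
  set Δ' := vertexDenominator h I (h j)
  have hpos : 0 < (Δ * Δ') ^ 2 := by positivity
  rw [← lexNonneg_mul _ hpos]
  refine iff_of_eq (congrArg _ (funext fun l => ?_))
  simp only [Pi.sub_apply, Pi.smul_apply, smul_eq_mul]
  field_simp

theorem isLineSet_iff_det {h : Fin n → Hyperplane m} {I : Fin m → Fin n} :
    IsLineSet (commonFlat h I) ↔ ∃ k, (coeffMatrix (Pi.single k 1) fun k => h (I k)).det ≠ 0 := by
  rw [isLineSet_iff]
  exact exists_congr fun k => transversal_iff_det fun y => by simp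

section Tame

variable {τ : Type} {l : Filter τ} {R : Subring (τ → ℝ)}

theorem det_mem {ι : Type} [Fintype ι] [DecidableEq ι] {M : τ → Matrix ι ι ℝ}
    (hM : ∀ i j, (fun t => M t i j) ∈ R) : (fun t => (M t).det) ∈ R := by
  have : (fun t => (M t).det) = ∑ σ : Equiv.Perm ι, (Equiv.Perm.sign σ : ℤ) •
      ∏ i, fun t => M t (σ i) i := by
    funext t
    simp [Matrix.det_apply, Finset.sum_apply, Finset.prod_apply, Units.smul_def]
  rw [this]
  exact sum_mem fun σ _ => zsmul_mem (prod_mem fun i _ => hM _ _) _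

/-- A family of arrangements whose coefficients lie in the given ring of functions. -/
def CoeffsIn (R : Subring (τ → ℝ)) (h : τ → Fin n → Hyperplane m) : Prop :=
  (∀ i j, (fun t => (h t i).slope j) ∈ R) ∧ ∀ i, (fun t => (h t i).icpt) ∈ R

theorem CoeffsIn.normal {h : τ → Fin n → Hyperplane m} (hh : CoeffsIn R h) (i : Fin n)
    (k : Fin (m + 1)) : (fun t => (h t i).normal k) ∈ R := by
  refine Fin.lastCases ?_ (fun j => ?_) k
  · simp only [Hyperplane.normal, Fin.lastCases_last]
    exact R.one_mem
  · simp only [Hyperplane.normal, Fin.lastCases_castSucc]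
    exact R.neg_mem (hh.1 i j)

theorem CoeffsIn.coeffMatrix {h : τ → Fin n → Hyperplane m} (hh : CoeffsIn R h)
    {c : τ → Fin (m + 1) → ℝ} (hc : ∀ k, (fun t => c t k) ∈ R) (I : Fin m → Fin n)
    (a b : Fin (m + 1)) : (fun t => coeffMatrix (c t) (fun k => h t (I k)) a b) ∈ R := by
  refine Fin.cases ?_ (fun k => ?_) a
  · exact hc b
  · exact hh.normal (I k) b

theorem CoeffsIn.vertexDenominator {h : τ → Fin n → Hyperplane m} (hh : CoeffsIn R h)
    (I : Fin m → Fin n) (i : Fin n) : (fun t => vertexDenominator (h t) I (h t i)) ∈ R :=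
  det_mem fun a b => hh.coeffMatrix (hh.normal i) I a b

theorem CoeffsIn.vertexNumerator {h : τ → Fin n → Hyperplane m} (hh : CoeffsIn R h)
    (I : Fin m → Fin n) (i : Fin n) (k : Fin (m + 1)) :
    (fun t => vertexNumerator (h t) I (h t i) k) ∈ R := by
  simp only [_root_.vertexNumerator, Matrix.cramer_apply]
  refine det_mem fun a b => ?_
  simp only [Matrix.updateCol_apply]
  by_cases hb : b = k
  · simp only [hb, if_true]
    refine Fin.cases ?_ (fun k => ?_) a
    · exact hh.2 i
    · exact hh.2 (I k)
  · simpa only [hb, if_false] using hh.coeffMatrix (hh.normal i) I a b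

theorem Tame.evDec_lexNonneg (hR : Tame l R) {k : ℕ} {d : τ → Fin k → ℝ}
    (hd : ∀ j, (fun t => d t j) ∈ R) : EvDec l fun t => LexNonneg (d t) :=
  (EvDec.forall_ fun j => hR.evDec_zero (hd j)).or
    (EvDec.exists_ fun j => (EvDec.forall_ fun j' => (hR.evDec_zero (hd j')).imp_const).and
      (hR.evDec_pos (hd j)))

theorem Tame.evDec_isLineSet (hR : Tame l R) {h : τ → Fin n → Hyperplane m} (hh : CoeffsIn R h)
    (I : Fin m → Fin n) : EvDec l fun t => IsLineSet (commonFlat (h t) I) := by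
  simp only [isLineSet_iff_det]
  refine EvDec.exists_ fun k => (hR.evDec_zero (det_mem fun a b => hh.coeffMatrix (fun j => ?_) I a b)).not
  by_cases hj : j = k
  · simp only [hj, Pi.single_eq_same]
    exact R.one_mem
  · simp only [Pi.single_eq_of_ne hj]
    exact R.zero_mem

theorem Tame.evDec_leftOrEqual (hR : Tame l R) {h : τ → Fin n → Hyperplane m} (hh : CoeffsIn R h)
    (I : Fin m → Fin n) (i j : Fin n) : EvDec l fun t => LeftOrEqual (h t) I i j := by
  simp only [leftOrEqual_iff]
  have hi := hh.vertexDenominator I i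
  have hj := hh.vertexDenominator I j
  exact (hR.evDec_zero hi).not.and ((hR.evDec_zero hj).not.and (hR.evDec_lexNonneg fun k =>
    R.mul_mem (R.sub_mem (R.mul_mem (hh.vertexNumerator I j k) hi)
      (R.mul_mem (hh.vertexNumerator I i k) hj)) (R.mul_mem hi hj)))

theorem EvDec.exists_bool {P : τ → Prop} [∀ t, Decidable (P t)] (h : EvDec l P) :
    ∃ b : Bool, ∀ᶠ t in l, decide (P t) = b := by
  rcases h with h | h
  · exact ⟨true, h.mono fun t ht => by simpa using ht⟩
  · exact ⟨false, h.mono fun t ht => by simpa using ht⟩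

theorem Tame.lineTable_eventually_const (hR : Tame l R) {h : τ → Fin n → Hyperplane m}
    (hh : CoeffsIn R h) : ∃ T, ∀ᶠ t in l, lineTable (h t) = T := by
  classical
  choose a ha using fun I => (hR.evDec_isLineSet hh I).exists_bool
  choose b hb using fun I i j => (hR.evDec_leftOrEqual hh I i j).exists_bool
  refine ⟨⟨a, b⟩, ?_⟩
  filter_upwards [eventually_all.2 ha, eventually_all.2 fun I => eventually_all.2 fun i =>
    eventually_all.2 (hb I i)] with t h1 h2
  simp only [lineTable, LineTable.mk.injEq]
  exact ⟨funext fun I => by convert h1 I, funext fun I => funext fun i => funext fun j => by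
    convert h2 I i j⟩

end Tame

theorem stableValue_eq {α : Type} [Nonempty α] {f : ℝ → ℝ → α} {v : α}
    (h : ∀ᶠ ε in 𝓝[>] (0 : ℝ), ∀ᶠ M in atTop, f ε M = v) : stableValue f = v := by
  have h' : ∀ᶠ ε in 𝓝[>] (0 : ℝ), ∀ᶠ M in atTop, f ε M = stableValue f :=
    Classical.epsilon_spec (p := fun v => ∀ᶠ ε in 𝓝[>] (0 : ℝ), ∀ᶠ M in atTop, f ε M = v) ⟨v, h⟩
  obtain ⟨ε, h1, h2⟩ := (h.and h').exists
  obtain ⟨M, h3, h4⟩ := (h1.and h2).exists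
  exact h4.symm.trans h3

/-- The order type of a tame family is eventually constant. The far sections of the family, with the
two parameters as new variables, form a tame family again. -/
theorem Tame.orderType_eventually_const {m : ℕ} : ∀ {τ : Type} {l : Filter τ} {R : Subring (τ → ℝ)},
    Tame l R → ∀ {h : τ → Fin n → Hyperplane m}, CoeffsIn R h →
      ∃ T, ∀ᶠ t in l, orderType (h t) = T := by
  induction m with
  | zero => exact fun hR _ hh => hR.lineTable_eventually_const hh
  | succ m ih =>
    intro τ l R hR h hh
    obtain ⟨T, hT⟩ := hR.lineTable_eventually_const hh
    have hR' := hR.adjoin_small.adjoin_large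
    have base : ∀ {f : τ → ℝ}, f ∈ R → (fun q : (τ × ℝ) × ℝ => f q.1.1) ∈ Tame.adjoin (Tame.adjoin R) :=
      fun hf => Tame.mem_adjoin (Tame.mem_adjoin hf)
    have hε : (fun q : (τ × ℝ) × ℝ => q.1.2) ∈ Tame.adjoin (Tame.adjoin R) :=
      Tame.mem_adjoin Tame.var_mem_adjoin
    have hM : (fun q : (τ × ℝ) × ℝ => q.2) ∈ Tame.adjoin (Tame.adjoin R) := Tame.var_mem_adjoin
    obtain ⟨T', hT'⟩ := ih hR' (h := fun q i => (h q.1.1 i).farSection q.1.2 q.2)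
      ⟨fun i j => sub_mem (base (hh.1 i j.succ)) (mul_mem (base (hh.1 i 0)) (pow_mem hε _)),
        fun i => sub_mem (base (hh.2 i)) (mul_mem (base (hh.1 i 0)) hM)⟩
    simp only [eventually_curry_iff] at hT'
    refine ⟨(T, T'), ?_⟩
    filter_upwards [hT, hT'] with t h1 h2
    rw [← h1, ← stableValue_eq h2]
    rfl

/-- The recursive part of the order type is the order type of a far section whose hyperplane is
steep enough and far enough to the left. -/
theorem orderType_farSection_eventually (h : Fin n → Hyperplane (m + 1)) :
    ∀ᶠ ε in 𝓝[>] (0 : ℝ), ∀ᶠ M in atTop,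
      orderType (fun i => (h i).farSection ε M) = (orderType h).2 := by
  have hR : Tame (pure ()) (⊤ : Subring (Unit → ℝ)) := fun f _ => by
    simp only [eventually_pure]
    rcases lt_trichotomy (f ()) 0 with h | h | h <;> simp [h]
  have hR' := hR.adjoin_small.adjoin_large
  have base : ∀ {f : Unit → ℝ}, (fun q : (Unit × ℝ) × ℝ => f q.1.1) ∈
      Tame.adjoin (Tame.adjoin ⊤) :=
    fun {f} => Tame.mem_adjoin (Tame.mem_adjoin (Subring.mem_top f))
  have hε : (fun q : (Unit × ℝ) × ℝ => q.1.2) ∈ Tame.adjoin (Tame.adjoin ⊤) :=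
    Tame.mem_adjoin Tame.var_mem_adjoin
  have hM : (fun q : (Unit × ℝ) × ℝ => q.2) ∈ Tame.adjoin (Tame.adjoin ⊤) := Tame.var_mem_adjoin
  obtain ⟨T', hT'⟩ := hR'.orderType_eventually_const
    (h := fun q i => (h i).farSection q.1.2 q.2)
    ⟨fun i j => sub_mem (base (f := fun _ => (h i).slope j.succ))
      (mul_mem (base (f := fun _ => (h i).slope 0)) (pow_mem hε _)),
      fun i => sub_mem (base (f := fun _ => (h i).icpt))
        (mul_mem (base (f := fun _ => (h i).slope 0)) hM)⟩
  simp only [eventually_curry_iff, eventually_pure] at hT'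
  have : (orderType h).2 = T' := stableValue_eq hT'
  rw [this]
  exact hT'

/-! ### Reading sign vectors off the order type -/

/-- The table of the lines in the representation of an order type in dimension `m + 1`. -/
def lineTbl : ℕ → SExp → SExp
  | 0, x => x
  | _ + 1, x => x.fst

/-- Whether the hyperplanes of `I` intersect in a line, read off the table of the lines. -/
def isLineB (t : SExp) (I : List ℕ) : Bool := (I.foldl SExp.nth t.fst).truthy

/-- Whether the line of `I` meets the hyperplane `i` not after the hyperplane `j`, read off the table of
the lines; with `i = j`, whether it meets this hyperplane in a single point. -/
def leB (t : SExp) (I : List ℕ) (i j : ℕ) : Bool := (((I.foldl SExp.nth t.snd).nth i).nth j).truthy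

/-- The side of the hyperplane `j` on which the intersection of the line of `I` with the hyperplane
`i` lies, if `s` is the side on which the left end of the line lies. -/
def signFrom (t : SExp) (I : List ℕ) (i j : ℕ) (s : SignType) : SignType :=
  if leB t I j j = true then
    if leB t I i j = true then if leB t I j i = true then 0 else s else -s
  else s

/-- The side of the hyperplane `j` on which the left end of the line of `I` lies. In dimension one
this is below; otherwise the left end is a vertex of the far section. -/
def leftSign : ℕ → SExp → List ℕ → ℕ → SignType
  | 0, _, _, _ => -1
  | m + 1, x, I, j =>
    signFrom (lineTbl m x.snd) I.tail (I.head?.getD 0) j (leftSign m x.snd I.tail j)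

/-- All lists of `k` indices below `n`. -/
def tuples (n : ℕ) : ℕ → List (List ℕ)
  | 0 => [[]]
  | k + 1 => (List.range n).flatMap fun i => (tuples n k).map fun I => i :: I

/-- The signs of the hyperplane at infinity and of the hyperplanes at the rightward direction of a
line. -/
def directionSigns (m : ℕ) (x : SExp) (n : ℕ) (I : List ℕ) : List SignType :=
  0 :: (List.range n).map fun j => if leB (lineTbl m x) I j j = true then -leftSign m x I j else 0

/-- The signs of the hyperplane at infinity and of the hyperplanes at a vertex. -/
def vertexSigns (m : ℕ) (x : SExp) (n : ℕ) (I : List ℕ) (i : ℕ) : List SignType :=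
  1 :: (List.range n).map fun j => signFrom (lineTbl m x) I i j (leftSign m x I j)

/-- The sign vectors of both directions of each line of the arrangement and of all vertices on it. -/
def ownCocircuits (m : ℕ) (x : SExp) (n : ℕ) : List (List SignType) :=
  (tuples n m).flatMap fun I =>
    if isLineB (lineTbl m x) I = true then
      directionSigns m x n I :: (directionSigns m x n I).map (fun s => -s) ::
        ((List.range n).filter fun i => leB (lineTbl m x) I i i).map (vertexSigns m x n I)
    else []

/-- The sign vectors of the vertices and of the directions of lines of the arrangement and of its
iterated far sections. The far sections matter for arrangements without vertices. -/
def cocircuits : ℕ → SExp → ℕ → List (List SignType)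
  | 0, x, n => ownCocircuits 0 x n
  | m + 1, x, n => ownCocircuits (m + 1) x n ++ cocircuits m x.snd n

/-! ### Tables of line sets and of orders along lines -/

theorem truthy_ofBool (b : Bool) : (SExp.ofBool b).truthy = b := by cases b <;> rfl

theorem nth_ofFamily {k : ℕ} (f : Fin k → SExp) (i : Fin k) : (SExp.ofFamily f).nth i = f i := by
  rw [SExp.ofFamily, SExp.nth_ofList]
  simp

/-- A tuple of indices as a list of natural numbers. -/
def tupleList {k : ℕ} (I : Fin k → Fin n) : List ℕ := List.ofFn fun a => (I a : ℕ)

theorem foldl_nth_ofTable : ∀ {k : ℕ} (f : (Fin k → Fin n) → SExp) (I : Fin k → Fin n),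
    (tupleList I).foldl SExp.nth (SExp.ofTable k f) = f I
  | 0, f, I => by
    simp only [tupleList, List.ofFn_zero, List.foldl_nil, SExp.ofTable]
    exact congrArg f (Subsingleton.elim _ _)
  | k + 1, f, I => by
    have h1 : tupleList I = (I 0 : ℕ) :: tupleList fun a => I a.succ := by
      simp [tupleList, List.ofFn_succ]
    rw [h1, List.foldl_cons, SExp.ofTable, nth_ofFamily, foldl_nth_ofTable]
    exact congrArg f (Fin.cons_self_tail I)

theorem lineTbl_encodeAux : ∀ {m : ℕ} (h : Fin n → Hyperplane m),
    lineTbl m (orderType h).encodeAux = (lineTable h).encode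
  | 0, _ => rfl
  | _ + 1, _ => rfl

theorem isLineB_iff {h : Fin n → Hyperplane m} {I : Fin m → Fin n} :
    isLineB (lineTbl m (orderType h).encodeAux) (tupleList I) = true ↔ IsLineSet (commonFlat h I) := by
  rw [lineTbl_encodeAux, isLineB, LineTable.encode, SExp.fst, foldl_nth_ofTable, truthy_ofBool]
  simp [lineTable]

theorem leB_iff {h : Fin n → Hyperplane m} {I : Fin m → Fin n} {i j : Fin n} :
    leB (lineTbl m (orderType h).encodeAux) (tupleList I) i j = true ↔ LeftOrEqual h I i j := by
  rw [lineTbl_encodeAux, leB, LineTable.encode, SExp.snd, foldl_nth_ofTable, nth_ofFamily,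
    nth_ofFamily, truthy_ofBool]
  simp [lineTable]

theorem mem_tuples {k : ℕ} {I : List ℕ} : I ∈ tuples n k ↔ ∃ J : Fin k → Fin n, I = tupleList J := by
  induction k generalizing I with
  | zero => simp [tuples, tupleList]
  | succ k ih =>
    simp only [tuples, List.mem_flatMap, List.mem_range, List.mem_map, ih]
    constructor
    · rintro ⟨i, hi, _, ⟨J, rfl⟩, rfl⟩
      exact ⟨Fin.cons ⟨i, hi⟩ J, by simp [tupleList, List.ofFn_succ]⟩
    · rintro ⟨J, rfl⟩
      exact ⟨J 0, (J 0).2, _, ⟨fun a => J a.succ, rfl⟩, by simp [tupleList, List.ofFn_succ]⟩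

/-! ### Left ends of lines -/

/-- The first non-zero entry is positive: a direction to the right. -/
def LexPos {k : ℕ} (d : Fin k → ℝ) : Prop := ∃ l, (∀ l' < l, d l' = 0) ∧ 0 < d l

theorem lexPos_or {k : ℕ} {u : Fin k → ℝ} (hu : u ≠ 0) : LexPos u ∨ LexPos (-u) := by
  rcases le_total (toLex 0) (toLex u) with h | h <;> rw [toLex_le_iff] at h
  · rw [sub_zero] at h
    exact .inl (h.resolve_left fun h0 => hu (funext h0))
  · rw [zero_sub] at h
    exact .inr (h.resolve_left fun h0 => hu (neg_eq_zero.1 (funext h0)))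

theorem LexPos.lexNonneg_smul_iff {k : ℕ} {u : Fin k → ℝ} (hu : LexPos u) (c : ℝ) :
    LexNonneg (c • u) ↔ 0 ≤ c := by
  obtain ⟨l, hl, hpos⟩ := hu
  constructor
  · intro h
    by_contra hc
    push Not at hc
    rcases h with h | ⟨l', hl', hpos'⟩
    · have := h l
      simp only [Pi.smul_apply, smul_eq_mul] at this
      exact (mul_neg_of_neg_of_pos hc hpos).ne this
    · simp only [Pi.smul_apply, smul_eq_mul] at hl' hpos'
      rcases lt_trichotomy l l' with hlt | rfl | hlt
      · exact (mul_neg_of_neg_of_pos hc hpos).ne (hl' l hlt)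
      · exact (mul_neg_of_neg_of_pos hc hpos).not_gt hpos'
      · rw [hl l' hlt, mul_zero] at hpos'
        exact hpos'.false
  · intro hc
    rcases hc.eq_or_lt with rfl | hc
    · exact .inl fun l => by simp
    · exact .inr ⟨l, fun l' hl' => by simp [hl l' hl'], by simpa using mul_pos hc hpos⟩

/-- The point `p` lies on the line of `I`, of the rightward direction `u`, to the left of all
intersections with hyperplanes. -/
structure LeftEnd (h : Fin n → Hyperplane m) (I : Fin m → Fin n) (p u : Fin (m + 1) → ℝ) : Prop where
  lexPos : LexPos u
  line : commonFlat h I = Set.range fun t : ℝ => p + t • u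
  left : ∀ j, (h j).form (u, 0) ≠ 0 →
    SignType.sign ((h j).form (p, 1)) = -SignType.sign ((h j).form (u, 0))

namespace LeftEnd

variable {h : Fin n → Hyperplane m} {I : Fin m → Fin n} {p u : Fin (m + 1) → ℝ}

theorem ne_zero (hp : LeftEnd h I p u) : u ≠ 0 := by
  obtain ⟨l, -, hl⟩ := hp.lexPos
  rintro rfl
  exact hl.false

theorem isLineSet (hp : LeftEnd h I p u) : IsLineSet (commonFlat h I) := ⟨p, u, hp.ne_zero, hp.line⟩

theorem inter_eq (hp : LeftEnd h I p u) {j : Fin n} (hj : (h j).form (u, 0) ≠ 0) :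
    commonFlat h I ∩ (h j).carrier =
      {p + (-(h j).form (p, 1) / (h j).form (u, 0)) • u} := by
  ext x
  rw [hp.line, Set.mem_inter_iff, Set.mem_range, Hyperplane.mem_carrier, Set.mem_singleton_iff]
  constructor
  · rintro ⟨⟨t, rfl⟩, ht⟩
    simp only [Hyperplane.form_add_smul] at ht
    congr 2
    rw [eq_div_iff hj]
    linarith
  · rintro rfl
    refine ⟨⟨_, rfl⟩, ?_⟩
    rw [Hyperplane.form_add_smul, div_mul_cancel₀ _ hj]
    ring

theorem leftOrEqual_iff (hp : LeftEnd h I p u) {i j : Fin n} :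
    LeftOrEqual h I i j ↔ (h i).form (u, 0) ≠ 0 ∧ (h j).form (u, 0) ≠ 0 ∧
      -(h i).form (p, 1) / (h i).form (u, 0) ≤ -(h j).form (p, 1) / (h j).form (u, 0) := by
  rw [LeftOrEqual, crosses_iff hp.line, crosses_iff hp.line]
  refine ⟨fun h => ⟨h.2.1, h.2.2.1, ?_⟩, fun h => ⟨hp.isLineSet, h.1, h.2.1, ?_⟩⟩
  · have h4 := h.2.2.2
    rw [hp.inter_eq h.2.1, hp.inter_eq h.2.2.1] at h4
    have h5 := h4 _ rfl _ rfl
    rw [toLex_le_iff, add_sub_add_left_eq_sub, ← sub_smul, hp.lexPos.lexNonneg_smul_iff] at h5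
    linarith
  · rw [hp.inter_eq h.1, hp.inter_eq h.2.1]
    rintro _ rfl _ rfl
    rw [toLex_le_iff, add_sub_add_left_eq_sub, ← sub_smul, hp.lexPos.lexNonneg_smul_iff]
    linarith [h.2.2]

theorem leftOrEqual_self_iff (hp : LeftEnd h I p u) {j : Fin n} :
    LeftOrEqual h I j j ↔ (h j).form (u, 0) ≠ 0 := by
  rw [hp.leftOrEqual_iff]; simp

theorem signFrom_eq (hp : LeftEnd h I p u) {i j : Fin n} {x : Fin (m + 1) → ℝ}
    (hi : (h i).form (u, 0) ≠ 0) (hx : x ∈ commonFlat h I ∩ (h i).carrier) {s : SignType}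
    (hs : s = SignType.sign ((h j).form (p, 1))) :
    signFrom (lineTbl m (orderType h).encodeAux) (tupleList I) i j s =
      SignType.sign ((h j).form (x, 1)) := by
  rw [hp.inter_eq hi, Set.mem_singleton_iff] at hx
  simp only [signFrom, leB_iff, hp.leftOrEqual_self_iff]
  split_ifs with hj h1 h2
  · rw [leB_iff] at h1 h2
    have e := le_antisymm (hp.leftOrEqual_iff.1 h1).2.2 (hp.leftOrEqual_iff.1 h2).2.2
    rw [hx, e, Hyperplane.form_add_smul, div_mul_cancel₀ _ hj]
    simp
  · rw [leB_iff] at h1 h2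
    have h1 := (hp.leftOrEqual_iff.1 h1).2.2
    rw [hp.leftOrEqual_iff] at h2
    push Not at h2
    have h2 := h2 hj hi
    rw [hs, hp.left j hj, hx, Hyperplane.form_add_smul]
    have e : (h j).form (p, 1) = -(-(h j).form (p, 1) / (h j).form (u, 0)) * (h j).form (u, 0) := by
      field_simp
    rw [e, ← add_mul, sign_mul, sign_neg (by linarith : _ + _ < (0 : ℝ))]
    simp
  · rw [leB_iff] at h1
    have h1 : -(h j).form (p, 1) / (h j).form (u, 0) < -(h i).form (p, 1) / (h i).form (u, 0) := by
      by_contra hlt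
      exact h1 (hp.leftOrEqual_iff.2 ⟨hi, hj, not_lt.1 hlt⟩)
    rw [hs, hp.left j hj, hx, Hyperplane.form_add_smul, neg_neg]
    have e : (h j).form (p, 1) = -(-(h j).form (p, 1) / (h j).form (u, 0)) * (h j).form (u, 0) := by
      field_simp
    rw [e, ← add_mul, sign_mul, sign_pos (by linarith : (0 : ℝ) < _ + _)]
    simp
  · push Not at hj
    rw [hs, hx, Hyperplane.form_add_smul, hj]
    simp

end LeftEnd

/-! ### Far sections -/

/-- A homogeneous vector of the far section as one of the whole space. -/
def liftVec (ε M : ℝ) (v : HVec m) : HVec (m + 1) :=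
  (Fin.cons (-M * v.2 - ∑ j : Fin m, ε ^ (j.val + 1) * v.1 j.castSucc) v.1, v.2)

theorem form_farSection (ε M : ℝ) (H : Hyperplane (m + 1)) (v : HVec m) :
    (H.farSection ε M).form v = H.form (liftVec ε M v) := by
  simp only [Hyperplane.form_apply, Hyperplane.farSection, liftVec, Fin.sum_univ_succ,
    Fin.castSucc_zero, Fin.cons_zero, ← Fin.succ_castSucc, Fin.cons_succ, sub_mul,
    Finset.sum_sub_distrib, mul_sub, Finset.mul_sum, mul_assoc]
  rw [← Fin.succ_last, Fin.cons_succ]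
  ring

/-- The functional whose level set is the hyperplane of the far section. -/
def steep (ε : ℝ) (y : Fin (m + 2) → ℝ) : ℝ := ∑ l : Fin (m + 1), ε ^ (l : ℕ) * y l.castSucc

theorem steep_add_smul (ε : ℝ) (p u : Fin (m + 2) → ℝ) (t : ℝ) :
    steep ε (p + t • u) = steep ε p + t * steep ε u := by
  simp only [steep, Pi.add_apply, Pi.smul_apply, smul_eq_mul, mul_add, Finset.sum_add_distrib,
    Finset.mul_sum]
  congr 1
  exact Finset.sum_congr rfl fun l _ => by ring

theorem steep_eq (ε : ℝ) (y : Fin (m + 2) → ℝ) :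
    steep ε y = y 0 + ∑ j : Fin m, ε ^ (j.val + 1) * Fin.tail y j.castSucc := by
  rw [steep, Fin.sum_univ_succ]
  simp [Fin.tail]

theorem steep_liftVec (ε M : ℝ) (v : HVec m) : steep ε (liftVec ε M v).1 = -M * v.2 := by
  rw [steep_eq]
  simp [liftVec]

theorem liftVec_tail {ε M : ℝ} {y : Fin (m + 2) → ℝ} {w : ℝ} (hy : steep ε y = -M * w) :
    liftVec ε M (Fin.tail y, w) = (y, w) := by
  rw [steep_eq] at hy
  refine Prod.ext ?_ rfl
  simp only [liftVec]
  rw [← hy, add_sub_cancel_right, Fin.cons_self_tail]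

theorem eventually_sum_pow_pos : ∀ {k : ℕ} (c : Fin k → ℝ), LexPos c →
    ∀ᶠ ε in 𝓝[>] (0 : ℝ), 0 < ∑ l : Fin k, ε ^ (l : ℕ) * c l
  | 0, _, ⟨l, _⟩ => l.elim0
  | k + 1, c, ⟨l, hl, hpos⟩ => by
    have e : ∀ ε : ℝ, ∑ l : Fin (k + 1), ε ^ (l : ℕ) * c l =
        c 0 + ε * ∑ l : Fin k, ε ^ (l : ℕ) * c l.succ := by
      intro ε
      rw [Fin.sum_univ_succ, Finset.mul_sum]
      simp [pow_succ', mul_assoc]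
    simp only [e]
    induction l using Fin.cases with
    | zero =>
      have hc : Tendsto (fun ε : ℝ => c 0 + ε * ∑ l : Fin k, ε ^ (l : ℕ) * c l.succ) (𝓝[>] 0)
          (𝓝 (c 0 + 0 * ∑ l : Fin k, (0 : ℝ) ^ (l : ℕ) * c l.succ)) :=
        (Continuous.tendsto (by fun_prop) 0).mono_left nhdsWithin_le_nhds
      rw [zero_mul, add_zero] at hc
      exact hc.eventually_const_lt hpos
    | succ l =>
      have ih := eventually_sum_pow_pos (fun l => c l.succ)
        ⟨l, fun l' hl' => hl _ (Fin.succ_lt_succ_iff.2 hl'), hpos⟩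
      have hz : ∀ᶠ z in 𝓝[>] (0 : ℝ), 0 < z := self_mem_nhdsWithin
      filter_upwards [ih, hz] with ε h1 h2
      rw [hl 0 (Fin.succ_pos l), zero_add]
      exact mul_pos h2 h1

theorem eventually_steep_pos {u : Fin (m + 2) → ℝ} (hu : LexPos u)
    (hv : ∃ l : Fin (m + 1), u l.castSucc ≠ 0) : ∀ᶠ ε in 𝓝[>] (0 : ℝ), 0 < steep ε u := by
  obtain ⟨l, hl, hpos⟩ := hu
  obtain ⟨k, hk⟩ := hv
  refine eventually_sum_pow_pos (fun l => u l.castSucc) ?_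
  induction l using Fin.lastCases with
  | last => exact absurd (hl _ (Fin.castSucc_lt_last k)) hk
  | cast l => exact ⟨l, fun l' hl' => hl _ (Fin.castSucc_lt_castSucc_iff.2 hl'), hpos⟩

theorem eventually_steep_ne_zero {u : Fin (m + 2) → ℝ} (hv : ∃ l : Fin (m + 1), u l.castSucc ≠ 0) :
    ∀ᶠ ε in 𝓝[>] (0 : ℝ), steep ε u ≠ 0 := by
  have h0 : u ≠ 0 := by
    rintro rfl
    obtain ⟨l, hl⟩ := hv
    exact hl rfl
  rcases lexPos_or h0 with h | h
  · exact (eventually_steep_pos h hv).mono fun _ h => h.ne'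
  · refine (eventually_steep_pos h (by simpa using hv)).mono fun ε h => ?_
    have : steep ε (-u) = -steep ε u := by simp [steep]
    rw [this] at h
    linarith

/-- A direction of a non-vertical hyperplane is not vertical. -/
theorem exists_ne_zero_of_form_eq_zero {H : Hyperplane m} {u : Fin (m + 1) → ℝ} (hu : u ≠ 0)
    (hH : H.form (u, 0) = 0) : ∃ l : Fin m, u l.castSucc ≠ 0 := by
  by_contra hne
  push Not at hne
  refine hu (funext fun l => ?_)
  induction l using Fin.lastCases with
  | last => simpa [Hyperplane.form_apply, hne] using hH
  | cast l => exact hne l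

/-- In dimension at least two, the point left of all intersections is the vertex of the line in the far section; the recursive part of
the order type determines the signs of the hyperplanes there. -/
theorem exists_leftEnd : ∀ {m : ℕ} {h : Fin n → Hyperplane m} {I : Fin m → Fin n},
    IsLineSet (commonFlat h I) → ∃ p u, LeftEnd h I p u ∧ ∀ j : Fin n,
      leftSign m (orderType h).encodeAux (tupleList I) j = SignType.sign ((h j).form (p, 1)) := by
  intro m
  induction m with
  | zero =>
    intro h I _
    -- on the line, all hyperplanes are points, and they are bounded from below
    obtain ⟨b, hb⟩ := (Set.finite_range fun j => (h j).icpt).bddBelow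
    have hneg : ∀ j, (h j).form (fun _ => b - 1, 1) < 0 := fun j => by
      have := hb ⟨j, rfl⟩
      simp only at this
      simp only [Hyperplane.form_apply, Finset.univ_eq_empty, Finset.sum_empty]
      linarith
    refine ⟨fun _ => b - 1, fun _ => 1, ⟨⟨0, fun l' hl' => by omega, one_pos⟩, ?_, fun j _ => ?_⟩,
      fun j => ?_⟩
    · ext x
      refine iff_of_true (mem_commonFlat.2 fun k => k.elim0) ⟨x 0 - (b - 1), funext fun l => ?_⟩
      obtain rfl : l = 0 := Fin.fin_one_eq_zero l
      simp
    · rw [sign_neg (hneg j)]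
      simp [Hyperplane.form_apply]
    · rw [sign_neg (hneg j)]; rfl
  | succ m ih =>
    rintro h I ⟨p₀, u₀, hu₀, hl₀⟩
    -- orient the line to the right
    obtain ⟨u, hu, hl⟩ : ∃ u, LexPos u ∧ commonFlat h I = Set.range fun t : ℝ => p₀ + t • u := by
      rcases lexPos_or hu₀ with h0 | h0
      · exact ⟨u₀, h0, hl₀⟩
      · refine ⟨-u₀, h0, hl₀.trans (Set.ext fun x => ⟨?_, ?_⟩)⟩
        · rintro ⟨t, rfl⟩; exact ⟨-t, by simp⟩
        · rintro ⟨t, rfl⟩; exact ⟨-t, by simp⟩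
    have hu0 : u ≠ 0 := by
      obtain ⟨l, -, h0⟩ := hu
      rintro rfl
      exact h0.false
    have hvert := exists_ne_zero_of_form_eq_zero hu0 (form_dir_eq_zero hl 0)
    -- a far section that has the recorded order type and meets the line to the left of all
    -- hyperplanes
    obtain ⟨ε, hε, hO⟩ :=
      ((eventually_steep_pos hu hvert).and (orderType_farSection_eventually h)).exists
    obtain ⟨M, hO, hM⟩ := (hO.and (eventually_all.2 fun j : Fin n =>
      (eventually_gt_atTop (-steep ε (p₀ + (-(h j).form (p₀, 1) / (h j).form (u, 0)) • u))))).exists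
    obtain ⟨p, hp, s, hps⟩ : ∃ p, steep ε p = -M * 1 ∧ ∃ s : ℝ, p = p₀ + s • u :=
      ⟨_, by rw [steep_add_smul, div_mul_cancel₀ _ hε.ne', add_sub_cancel],
        (-M * 1 - steep ε p₀) / steep ε u, rfl⟩
    have hline : commonFlat h I = Set.range fun t : ℝ => p + t • u := by
      rw [hl]
      ext x
      constructor
      · rintro ⟨t, rfl⟩; exact ⟨t - s, by simp only [hps, add_assoc, ← add_smul]; congr 2; ring⟩
      · rintro ⟨t, rfl⟩; exact ⟨t + s, by simp only [hps, add_assoc, ← add_smul]; congr 2; ring⟩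
    refine ⟨p, u, ⟨hu, hline, fun j hj => ?_⟩, fun j => ?_⟩
    · have hMj := hM j
      set t := -(h j).form (p₀, 1) / (h j).form (u, 0)
      rw [steep_add_smul] at hMj
      rw [hps, steep_add_smul] at hp
      have hts : s < t := by
        have : s * steep ε u < t * steep ε u := by linarith
        exact lt_of_mul_lt_mul_right this hε.le
      have e : (h j).form (p₀, 1) = -t * (h j).form (u, 0) := by
        simp only [t]; field_simp
      rw [hps, Hyperplane.form_add_smul, e, ← add_mul, sign_mul,
        sign_neg (by linarith : _ + _ < (0 : ℝ))]
      simp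
    · set h' : Fin n → Hyperplane m := fun i => (h i).farSection ε M with hh'
      have hform : ∀ j v, (h' j).form v = (h j).form (liftVec ε M v) := fun j v =>
        form_farSection ε M (h j) v
      have htr : Transversal h' (h' (I 0)).lin fun k => I k.succ := by
        intro y hy hk
        set z := liftVec ε M (y, 0) with hz
        have hz2 : z = (z.1, 0) := rfl
        have hall : ∀ k, (h (I k)).form (z.1, 0) = 0 := by
          intro k
          rw [← hz2, ← hform]
          exact Fin.cases hy hk k
        obtain ⟨c, hc⟩ := exists_smul_of_line hline hall
        have h1 : steep ε z.1 = 0 := by rw [hz, steep_liftVec]; simp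
        have h2 : steep ε z.1 = c * steep ε u := by
          have := steep_add_smul ε 0 u c
          rw [zero_add] at this
          rw [hc, this]
          simp [steep]
        rw [h1] at h2
        have hc0 : c = 0 := by
          rcases mul_eq_zero.1 h2.symm with h | h
          · exact h
          · exact absurd h hε.ne'
        have h3 : z.1 = 0 := by rw [hc, hc0, zero_smul]
        funext l
        exact congrFun h3 l.succ
      obtain ⟨p', u', hpu', hleft⟩ := ih htr.isLineSet
      have hmem : Fin.tail p ∈ commonFlat h' (fun k => I k.succ) ∩ (h' (I 0)).carrier := by
        have hp0 : p ∈ commonFlat h I := hline ▸ ⟨0, by simp⟩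
        rw [mem_commonFlat] at hp0
        rw [Set.mem_inter_iff, mem_commonFlat, Hyperplane.mem_carrier]
        simp only [hform, liftVec_tail hp]
        exact ⟨fun k => hp0 _, hp0 0⟩
      have hne : (h' (I 0)).form (u', 0) ≠ 0 :=
        (crosses_iff hpu'.line _).1 (line_and_crosses_iff.2 htr).2
      have key := hpu'.signFrom_eq hne hmem (hleft j)
      rw [hform, liftVec_tail hp, hO] at key
      have hI : (tupleList I).tail = tupleList fun k => I k.succ := by
        simp [tupleList, List.ofFn_succ]
      have hI0 : (tupleList I).head?.getD 0 = (I 0 : ℕ) := by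
        simp [tupleList, List.ofFn_succ]
      rw [leftSign, hI, hI0]
      have hsnd : (orderType h).encodeAux.snd = ArrOrderType.encodeAux (orderType h).2 := rfl
      rw [hsnd, ← key, ← hO]

/-! ### The list of cocircuits is sound and complete -/

/-- The values at a homogeneous vector of the form of the hyperplane at infinity (index `0`) and of
the forms of the hyperplanes. -/
def allForms (h : Fin n → Hyperplane m) : HVec m →ₗ[ℝ] (Fin (n + 1) → ℝ) :=
  LinearMap.pi (Fin.cons (LinearMap.snd ℝ _ _) fun i => (h i).form)

theorem allForms_zero (h : Fin n → Hyperplane m) (v : HVec m) : allForms h v 0 = v.2 := rfl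

theorem allForms_succ (h : Fin n → Hyperplane m) (v : HVec m) (i : Fin n) :
    allForms h v i.succ = (h i).form v := rfl

theorem allForms_eq_iff {h : Fin n → Hyperplane m} {v : HVec m} {f : Fin (n + 1) → ℝ} :
    allForms h v = f ↔ v.2 = f 0 ∧ ∀ i, (h i).form v = f i.succ := by
  rw [funext_iff, Fin.forall_fin_succ]
  rfl

/-- The sign vector of a homogeneous vector. -/
noncomputable def signs (h : Fin n → Hyperplane m) (v : HVec m) : List SignType :=
  List.ofFn fun i => SignType.sign (allForms h v i)

theorem signs_eq {h : Fin n → Hyperplane m} {v : HVec m} {f : ℕ → SignType}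
    (hf : ∀ j : Fin n, f j = SignType.sign ((h j).form v)) :
    SignType.sign v.2 :: (List.range n).map f = signs h v := by
  rw [signs, List.ofFn_succ]
  refine congrArg₂ _ rfl (List.ext_getElem (by simp) fun k h1 h2 => ?_)
  simp only [List.length_map, List.length_range] at h1
  simpa [allForms_succ] using hf ⟨k, h1⟩

theorem signs_smul {h : Fin n → Hyperplane m} {v : HVec m} {c : ℝ} (hc : 0 < c) :
    signs h (c • v) = signs h v := by
  simp [signs, sign_mul, sign_pos hc]

theorem signs_neg {h : Fin n → Hyperplane m} {v : HVec m} :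
    signs h (-v) = (signs h v).map fun s => -s := by
  simp [signs, Left.sign_neg, Function.comp_def]

theorem directionSigns_eq {h : Fin n → Hyperplane m} {I : Fin m → Fin n} {p u : Fin (m + 1) → ℝ}
    (hp : LeftEnd h I p u) (hs : ∀ j : Fin n, leftSign m (orderType h).encodeAux (tupleList I) j =
      SignType.sign ((h j).form (p, 1))) :
    directionSigns m (orderType h).encodeAux n (tupleList I) = signs h (u, 0) := by
  rw [← signs_eq (f := fun j => if leB (lineTbl m (orderType h).encodeAux) (tupleList I) j j = true
    then -leftSign m (orderType h).encodeAux (tupleList I) j else 0)]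
  · simp [directionSigns]
  · intro j
    simp only [leB_iff, hp.leftOrEqual_self_iff]
    split_ifs with hj
    · rw [hs, hp.left j hj, neg_neg]
    · push Not at hj
      rw [hj, sign_zero]

theorem vertexSigns_eq {h : Fin n → Hyperplane m} {I : Fin m → Fin n} {p u : Fin (m + 1) → ℝ}
    (hp : LeftEnd h I p u) (hs : ∀ j : Fin n, leftSign m (orderType h).encodeAux (tupleList I) j =
      SignType.sign ((h j).form (p, 1))) {i : Fin n} (hi : (h i).form (u, 0) ≠ 0)
    {x : Fin (m + 1) → ℝ} (hx : x ∈ commonFlat h I ∩ (h i).carrier) :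
    vertexSigns m (orderType h).encodeAux n (tupleList I) i = signs h (x, 1) := by
  rw [← signs_eq (f := fun j => signFrom (lineTbl m (orderType h).encodeAux) (tupleList I) i j
    (leftSign m (orderType h).encodeAux (tupleList I) j))]
  · simp [vertexSigns]
  · exact fun j => hp.signFrom_eq hi hx (hs j)

theorem ownCocircuits_sound {h : Fin n → Hyperplane m} {e : List SignType}
    (he : e ∈ ownCocircuits m (orderType h).encodeAux n) : ∃ v, e = signs h v := by
  simp only [ownCocircuits, List.mem_flatMap, mem_tuples] at he
  obtain ⟨_, ⟨I, rfl⟩, he⟩ := he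
  split_ifs at he with hI
  · obtain ⟨p, u, hp, hs⟩ := exists_leftEnd (isLineB_iff.1 hI)
    rw [directionSigns_eq hp hs, List.mem_cons, List.mem_cons, List.mem_map] at he
    rcases he with rfl | rfl | ⟨i, hi, rfl⟩
    · exact ⟨_, rfl⟩
    · exact ⟨-(u, 0), signs_neg.symm⟩
    · rw [List.mem_filter, List.mem_range] at hi
      obtain ⟨hin, hi⟩ := hi
      have hi := hp.leftOrEqual_self_iff.1 (leB_iff (i := ⟨i, hin⟩) (j := ⟨i, hin⟩).1 hi)
      exact ⟨(_, 1), vertexSigns_eq hp hs (i := ⟨i, hin⟩) hi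
        ((Set.ext_iff.1 (hp.inter_eq hi) _).2 rfl)⟩
  · simp at he

theorem allForms_farSection (h : Fin n → Hyperplane (m + 1)) (ε M : ℝ) (v : HVec m) :
    allForms (fun i => (h i).farSection ε M) v = allForms h (liftVec ε M v) :=
  allForms_eq_iff.2 ⟨rfl, fun _ => form_farSection ε M _ v⟩

/-- Every vector in the list is the sign vector of an actual homogeneous vector: of a point or a direction, or
of one in an iterated far section that is mapped back by `liftVec`. -/
theorem cocircuits_sound : ∀ {m : ℕ} {h : Fin n → Hyperplane m} {e : List SignType},
    e ∈ cocircuits m (orderType h).encodeAux n → ∃ v, e = signs h v := by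
  intro m
  induction m with
  | zero => exact fun he => ownCocircuits_sound he
  | succ m ih =>
    intro h e he
    rcases List.mem_append.1 he with he | he
    · exact ownCocircuits_sound he
    · obtain ⟨ε, h1⟩ := (orderType_farSection_eventually h).exists
      obtain ⟨M, h1⟩ := h1.exists
      have he' : e ∈ cocircuits m (orderType h).2.encodeAux n := he
      rw [← h1] at he'
      obtain ⟨v, rfl⟩ := ih he'
      exact ⟨liftVec ε M v, by rw [signs, allForms_farSection]; rfl⟩

/-- The vector is, up to vectors on which all forms vanish, determined up to a factor by the forms
that vanish on it. -/
def Elementary (h : Fin n → Hyperplane m) (v : HVec m) : Prop :=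
  allForms h v ≠ 0 ∧ ∀ u, (∀ i, allForms h v i = 0 → allForms h u i = 0) →
    ∃ c : ℝ, allForms h u = c • allForms h v

theorem exists_separating_subfamily {V ι : Type} [AddCommGroup V] [Module ℝ V]
    [FiniteDimensional ℝ V] (φ : ι → V →ₗ[ℝ] ℝ) : ∀ (k : ℕ) (K : Submodule ℝ V),
    Module.finrank ℝ K = k → (∀ y ∈ K, (∀ i, φ i y = 0) → y = 0) →
      ∃ I : Fin k → ι, ∀ y ∈ K, (∀ a, φ (I a) y = 0) → y = 0 := by
  intro k
  induction k with
  | zero =>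
    intro K hK _
    rw [Submodule.finrank_eq_zero] at hK
    exact ⟨fun a => a.elim0, fun y hy _ => by simpa [hK] using hy⟩
  | succ k ih =>
    intro K hK hsep
    have hne : K ≠ ⊥ := by
      rintro rfl
      simp at hK
    obtain ⟨y, hy, hy0⟩ := K.exists_mem_ne_zero_of_ne_bot hne
    obtain ⟨i, hi⟩ : ∃ i, φ i y ≠ 0 := by
      by_contra hcon
      push Not at hcon
      exact hy0 (hsep y hy hcon)
    let f : Module.Dual ℝ K := (φ i).domRestrict K
    have hf : f ≠ 0 := fun h0 => hi (by simpa [f] using LinearMap.congr_fun h0 ⟨y, hy⟩)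
    have hker := Module.Dual.finrank_ker_add_one_of_ne_zero hf
    obtain ⟨I, hI⟩ := ih ((LinearMap.ker f).map K.subtype)
      (by rw [Submodule.finrank_map_subtype_eq]; omega) fun y hy => hsep y (by
        obtain ⟨z, -, rfl⟩ := hy
        exact z.2)
    refine ⟨Fin.cons i I, fun y hy hall => hI y ⟨⟨y, hy⟩, ?_, rfl⟩ fun a => hall a.succ⟩
    exact hall 0

theorem exists_transversal {h : Fin n → Hyperplane m} {Z : Set (Fin n)}
    {g : (Fin (m + 1) → ℝ) →ₗ[ℝ] ℝ} (hg : g ≠ 0)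
    (hsep : ∀ y, g y = 0 → (∀ j ∈ Z, (h j).form (y, 0) = 0) → y = 0) :
    ∃ I : Fin m → Fin n, (∀ a, I a ∈ Z) ∧ Transversal h g I := by
  have hker := Module.Dual.finrank_ker_add_one_of_ne_zero (f := g) hg
  obtain ⟨I, hI⟩ := exists_separating_subfamily (fun j : Z => (h j).lin) m (LinearMap.ker g)
    (by simpa using hker) fun y hy hall => hsep y hy fun j hj => hall ⟨j, hj⟩
  exact ⟨fun a => I a, fun a => (I a).2, fun y hy hall => hI y hy hall⟩

theorem mem_ownCocircuits {h : Fin n → Hyperplane m}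
    (hfull : ∀ y, (∀ j, (h j).form (y, 0) = 0) → y = 0) {v : HVec m} (hv : Elementary h v)
    (h0 : 0 ≤ v.2) : signs h v ∈ ownCocircuits m (orderType h).encodeAux n := by
  have hel : ∀ u : HVec m, (v.2 = 0 → u.2 = 0) → (∀ j, (h j).form v = 0 → (h j).form u = 0) →
      ∃ c : ℝ, u = c • v := by
    intro u hu0 hu
    obtain ⟨c, hc⟩ := hv.2 u (Fin.forall_fin_succ.2 ⟨hu0, hu⟩)
    refine ⟨c, ?_⟩
    have hz : allForms h (u - c • v) = 0 := by rw [map_sub, map_smul, hc, sub_self]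
    have h2 : (u - c • v).2 = 0 := congrFun hz 0
    have h1 : (u - c • v).1 = 0 := hfull _ fun j => by
      have e : (((u - c • v).1, 0) : HVec m) = u - c • v := Prod.ext rfl h2.symm
      rw [e]
      exact congrFun hz j.succ
    exact sub_eq_zero.1 (Prod.ext h1 h2)
  simp only [ownCocircuits, List.mem_flatMap, mem_tuples]
  rcases h0.eq_or_lt with h0 | h0
  · -- a direction
    obtain ⟨x, w⟩ := v
    obtain rfl : 0 = w := h0
    have hx : x ≠ 0 := by
      rintro rfl
      exact hv.1 (map_zero _)
    obtain ⟨k, hk⟩ := Function.ne_iff.1 hx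
    obtain ⟨I, hIZ, hI⟩ := exists_transversal (h := h) (Z := {j | (h j).form (x, 0) = 0})
      (g := LinearMap.proj k) (fun h0 => hk (LinearMap.congr_fun h0 x)) fun y hy hall => by
        obtain ⟨c, hc⟩ := hel (y, 0) (fun _ => rfl) hall
        have hy' : y = c • x := congrArg Prod.fst hc
        have hyk : y k = 0 := hy
        rw [hy', Pi.smul_apply, smul_eq_mul, mul_eq_zero] at hyk
        rw [hy', hyk.resolve_right hk, zero_smul]
    refine ⟨_, ⟨I, rfl⟩, ?_⟩
    rw [if_pos (isLineB_iff.2 hI.isLineSet)]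
    obtain ⟨p, u, hp, hs⟩ := exists_leftEnd hI.isLineSet
    rw [directionSigns_eq hp hs, ← signs_neg, List.mem_cons, List.mem_cons]
    obtain ⟨c, rfl⟩ := exists_smul_of_line hp.line hIZ
    have e : ((c • u, 0) : HVec m) = c • (u, 0) := by ext <;> simp
    rcases lt_trichotomy c 0 with hc | rfl | hc
    · right; left
      have e' : c • ((u, 0) : HVec m) = -c • -(u, 0) := by rw [smul_neg, neg_smul, neg_neg]
      rw [e, e', signs_smul (neg_pos.2 hc)]
    · simp at hx
    · left
      rw [e, signs_smul hc]
  · -- a vertex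
    have hsep : ∀ y, (∀ j ∈ {j | (h j).form v = 0}, (h j).form (y, 0) = 0) → y = 0 := by
      intro y hall
      obtain ⟨c, hc⟩ := hel (y, 0) (fun h => absurd h h0.ne') hall
      have h2 : 0 = c * v.2 := congrArg Prod.snd hc
      have hy : y = c • v.1 := congrArg Prod.fst hc
      rw [hy, (mul_eq_zero.1 h2.symm).resolve_right h0.ne', zero_smul]
    obtain ⟨i, hi⟩ : ∃ i, (h i).form v = 0 := by
      by_contra hcon
      have := hsep (fun _ => 1) fun j hj => absurd ⟨j, hj⟩ hcon
      simpa using congrFun this 0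
    have hlin : (h i).lin ≠ 0 := fun h0 => by
      have := LinearMap.congr_fun h0 (Pi.single (Fin.last m) 1)
      simp [Hyperplane.lin_apply, Hyperplane.form_apply, Fin.castSucc_ne_last] at this
    obtain ⟨I, hIZ, hI⟩ := exists_transversal (h := h) (Z := {j | (h j).form v = 0})
      (g := (h i).lin) hlin fun y _ hall => hsep y hall
    refine ⟨_, ⟨I, rfl⟩, ?_⟩
    rw [if_pos (isLineB_iff.2 hI.isLineSet)]
    obtain ⟨p, u, hp, hs⟩ := exists_leftEnd hI.isLineSet
    have hiu : (h i).form (u, 0) ≠ 0 := (crosses_iff hp.line _).1 (line_and_crosses_iff.2 hI).2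
    have e : ((v.2⁻¹ • v.1, 1) : HVec m) = v.2⁻¹ • v := by
      ext <;> simp [h0.ne']
    have hx : v.2⁻¹ • v.1 ∈ commonFlat h I ∩ (h i).carrier := by
      rw [Set.mem_inter_iff, mem_commonFlat, Hyperplane.mem_carrier, e]
      simp only [map_smul, hi, smul_zero, and_true]
      intro k
      rw [show (h (I k)).form v = 0 from hIZ k, smul_zero]
    rw [List.mem_cons, List.mem_cons, List.mem_map]
    refine .inr (.inr ⟨i, List.mem_filter.2 ⟨List.mem_range.2 i.2, ?_⟩, ?_⟩)
    · exact leB_iff.2 (hp.leftOrEqual_self_iff.2 hiu)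
    · rw [vertexSigns_eq hp hs hiu hx, e, signs_smul (inv_pos.2 h0)]

/-- If the hyperplanes are all parallel to a line, an elementary vector can be moved along this line
into the far section. -/
theorem mem_cocircuits : ∀ {m : ℕ} {h : Fin n → Hyperplane m}, 0 < n → ∀ {v : HVec m},
    Elementary h v → 0 ≤ v.2 → signs h v ∈ cocircuits m (orderType h).encodeAux n := by
  intro m
  induction m with
  | zero =>
    intro h hn v hv h0
    refine mem_ownCocircuits (fun y hy => funext fun l => ?_) hv h0
    obtain rfl : l = 0 := Fin.fin_one_eq_zero l
    simpa [Hyperplane.form_apply] using hy ⟨0, hn⟩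
  | succ m ih =>
    intro h hn v hv h0
    rw [cocircuits, List.mem_append]
    by_cases hfull : ∀ y, (∀ j, (h j).form (y, 0) = 0) → y = 0
    · exact .inl (mem_ownCocircuits hfull hv h0)
    · right
      push Not at hfull
      obtain ⟨y, hy, hy0⟩ := hfull
      obtain ⟨ε, hO, hε⟩ := ((orderType_farSection_eventually h).and (eventually_steep_ne_zero
        (exists_ne_zero_of_form_eq_zero hy0 (hy ⟨0, hn⟩)))).exists
      obtain ⟨M, hO⟩ := hO.exists
      set c := (-M * v.2 - steep ε v.1) / steep ε y
      have hz : steep ε (v.1 + c • y) = -M * v.2 := by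
        rw [steep_add_smul, div_mul_cancel₀ _ hε, add_sub_cancel]
      have hall : allForms (fun i => (h i).farSection ε M) (Fin.tail (v.1 + c • y), v.2) =
          allForms h v := by
        rw [allForms_farSection, liftVec_tail hz]
        exact allForms_eq_iff.2 ⟨rfl, fun i => by
          rw [Hyperplane.form_add_smul, hy, mul_zero, add_zero]; rfl⟩
      have key := ih (h := fun i => (h i).farSection ε M) hn
        (v := (Fin.tail (v.1 + c • y), v.2)) ⟨by rw [hall]; exact hv.1, fun u hu => by
          rw [hall] at hu ⊢
          rw [allForms_farSection] at hu ⊢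
          exact hv.2 _ hu⟩ h0
      rw [signs, hall, hO] at key
      exact key

/-! ### Conformal decompositions -/

section Decomposition

variable {M : ℕ}

/-- The non-zero entries of `a` have the same signs as those of `b`. -/
def Conforms (a b : Fin M → ℝ) : Prop := ∀ p, a p ≠ 0 → SignType.sign (a p) = SignType.sign (b p)

theorem Conforms.refl (a : Fin M → ℝ) : Conforms a a := fun _ _ => rfl

theorem Conforms.ne_zero {a b : Fin M → ℝ} (h : Conforms a b) {p : Fin M} (hp : a p ≠ 0) : b p ≠ 0 := by
  intro hb
  have := h p hp
  rw [hb, sign_zero, sign_eq_zero_iff] at this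
  exact hp this

theorem Conforms.trans {a b c : Fin M → ℝ} (h : Conforms a b) (h' : Conforms b c) : Conforms a c :=
  fun p hp => (h p hp).trans (h' p (h.ne_zero hp))

/-- The outcome of a search for the first zero on the line through `Y` of direction `G`: `none` if
the entries are constant along the line, and otherwise an entry that vanishes first. -/
def IsFirstHit (Y G : Fin M → ℝ) (o : Option (Fin M)) : Prop :=
  (o = none ∧ ∀ p, G p = 0) ∨
    ∃ i, o = some i ∧ G i ≠ 0 ∧ ∀ p, G p ≠ 0 → (Y i / G i) ^ 2 ≤ (Y p / G p) ^ 2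

theorem conforms_of_firstHit {Y G : Fin M → ℝ} {i : Fin M}
    (hmin : ∀ p, G p ≠ 0 → (Y i / G i) ^ 2 ≤ (Y p / G p) ^ 2) :
    Conforms (Y - (Y i / G i) • G) Y := by
  intro p hp
  set c := Y i / G i
  simp only [Pi.sub_apply, Pi.smul_apply, smul_eq_mul] at hp ⊢
  by_cases hG : G p = 0
  · rw [hG, mul_zero, sub_zero]
  · have h1 := sq_le_sq.1 (hmin p hG)
    set ρ := Y p / G p with hρ
    have hY : Y p = ρ * G p := by rw [hρ, div_mul_cancel₀ _ hG]
    rw [hY, ← sub_mul, sign_mul, sign_mul]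
    rw [hY, ← sub_mul] at hp
    have hne : ρ - c ≠ 0 := left_ne_zero_of_mul hp
    congr 1
    rcases lt_trichotomy ρ 0 with h | h | h
    · rw [sign_neg h, sign_neg]
      rw [abs_of_neg h] at h1
      exact lt_of_le_of_ne (by linarith [neg_abs_le c]) hne
    · rw [h, abs_zero, abs_nonpos_iff] at h1
      exact absurd (by rw [h, h1, sub_zero]) hne
    · rw [sign_pos h, sign_pos]
      rw [abs_of_pos h] at h1
      exact lt_of_le_of_ne (by linarith [le_abs_self c]) hne.symm

/-- The subspace spanned by a list of vectors. -/
def listSpan (Gs : List (Fin M → ℝ)) : Submodule ℝ (Fin M → ℝ) := Submodule.span ℝ {x | x ∈ Gs}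

theorem mem_listSpan {Gs : List (Fin M → ℝ)} {g : Fin M → ℝ} (hg : g ∈ Gs) : g ∈ listSpan Gs :=
  Submodule.subset_span hg

theorem listSpan_le {Gs : List (Fin M → ℝ)} {X : Submodule ℝ (Fin M → ℝ)} :
    listSpan Gs ≤ X ↔ ∀ g ∈ Gs, g ∈ X := Submodule.span_le

/-- Elimination of the `i`-th entry by means of `G`. -/
noncomputable def eliminate (i : Fin M) (G g : Fin M → ℝ) : Fin M → ℝ := g - (g i / G i) • G

theorem eliminate_apply {i : Fin M} {G : Fin M → ℝ} (hG : G i ≠ 0) (g : Fin M → ℝ) :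
    eliminate i G g i = 0 := by
  simp [eliminate, hG]

theorem apply_eq_zero_of_mem_eliminate {i : Fin M} {G : Fin M → ℝ} (hG : G i ≠ 0)
    {Gs : List (Fin M → ℝ)} {u : Fin M → ℝ} (hu : u ∈ listSpan (Gs.map (eliminate i G))) : u i = 0 := by
  have : listSpan (Gs.map (eliminate i G)) ≤ LinearMap.ker (LinearMap.proj i) := by
    rw [listSpan_le]
    intro g hg
    obtain ⟨g', -, rfl⟩ := List.mem_map.1 hg
    exact eliminate_apply hG g'
  exact this hu

theorem eliminate_span_le {i : Fin M} {G : Fin M → ℝ} {Gs : List (Fin M → ℝ)}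
    {X : Submodule ℝ (Fin M → ℝ)} (hG : G ∈ X) (hGs : ∀ g ∈ Gs, g ∈ X) :
    listSpan (Gs.map (eliminate i G)) ≤ X := by
  rw [listSpan_le]
  intro g hg
  obtain ⟨g', hg', rfl⟩ := List.mem_map.1 hg
  exact X.sub_mem (hGs g' hg') (X.smul_mem _ hG)

theorem mem_eliminate {i : Fin M} {G : Fin M → ℝ} (hG : G i ≠ 0) {Gs : List (Fin M → ℝ)}
    {u : Fin M → ℝ} (hu : u ∈ listSpan (G :: Gs)) (hui : u i = 0) :
    u ∈ listSpan (Gs.map (eliminate i G)) := by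
  have hle : listSpan (G :: Gs) ≤ Submodule.span ℝ {G} ⊔ listSpan (Gs.map (eliminate i G)) := by
    rw [listSpan_le]
    have hGm : G ∈ Submodule.span ℝ {G} ⊔ listSpan (Gs.map (eliminate i G)) :=
      Submodule.mem_sup_left (Submodule.mem_span_singleton_self G)
    intro g hg
    rcases List.mem_cons.1 hg with rfl | hg
    · exact hGm
    · have h1 : eliminate i G g ∈ Submodule.span ℝ {G} ⊔ listSpan (Gs.map (eliminate i G)) :=
        Submodule.mem_sup_right (mem_listSpan (List.mem_map_of_mem hg))
      have h2 := Submodule.add_mem _ h1 (Submodule.smul_mem _ (g i / G i) hGm)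
      rwa [eliminate, sub_add_cancel] at h2
  obtain ⟨a, ha, b, hb, rfl⟩ := Submodule.mem_sup.1 (hle hu)
  obtain ⟨c, rfl⟩ := Submodule.mem_span_singleton.1 ha
  have hbi := apply_eq_zero_of_mem_eliminate hG hb
  simp only [Pi.add_apply, Pi.smul_apply, smul_eq_mul, hbi, add_zero, mul_eq_zero, hG, or_false] at hui
  rw [hui, zero_smul, zero_add]
  exact hb

/-- The outcome of a walk from `Y` in directions spanned by `Gs`: a vector `V` that conforms to `Y`
and that is determined by the vanishing of the entries `hits`. -/
structure IsWalk (Y : Fin M → ℝ) (Gs : List (Fin M → ℝ)) (V : Fin M → ℝ) (hits : List (Fin M)) :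
    Prop where
  conforms : Conforms V Y
  mem : V - Y ∈ listSpan Gs
  vanish : ∀ i ∈ hits, V i = 0
  unique : ∀ u ∈ listSpan Gs, (∀ i ∈ hits, u i = 0) → u = 0

theorem IsWalk.nil (Y : Fin M → ℝ) : IsWalk Y [] Y [] where
  conforms := .refl Y
  mem := by simp
  vanish := by simp
  unique u hu _ := by simpa [listSpan] using hu

theorem IsWalk.skip {Y G V : Fin M → ℝ} {Gs : List (Fin M → ℝ)} {hits : List (Fin M)}
    (hG : ∀ p, G p = 0) (h : IsWalk Y Gs V hits) : IsWalk Y (G :: Gs) V hits where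
  conforms := h.conforms
  mem := listSpan_le.2 (fun _ hg => mem_listSpan (List.mem_cons_of_mem _ hg)) h.mem
  vanish := h.vanish
  unique u hu := h.unique u (listSpan_le.2 (fun g hg => by
    rcases List.mem_cons.1 hg with rfl | hg
    · rw [show g = 0 from funext hG]; exact Submodule.zero_mem _
    · exact mem_listSpan hg) hu)

theorem IsWalk.step {Y G V : Fin M → ℝ} {Gs : List (Fin M → ℝ)} {hits : List (Fin M)} {i : Fin M}
    (hG : G i ≠ 0) (hmin : ∀ p, G p ≠ 0 → (Y i / G i) ^ 2 ≤ (Y p / G p) ^ 2)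
    (h : IsWalk (eliminate i G Y) (Gs.map (eliminate i G)) V hits) :
    IsWalk Y (G :: Gs) V (i :: hits) where
  conforms := h.conforms.trans (conforms_of_firstHit hmin)
  mem := by
    have h1 := eliminate_span_le (mem_listSpan List.mem_cons_self)
      (fun g hg => mem_listSpan (List.mem_cons_of_mem _ hg)) h.mem
    have h2 := Submodule.smul_mem _ (Y i / G i)
      (mem_listSpan (List.mem_cons_self (a := G) (l := Gs)))
    have h3 := Submodule.sub_mem _ h1 h2
    have e : V - eliminate i G Y - (Y i / G i) • G = V - Y := by rw [eliminate]; abel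
    rwa [e] at h3
  vanish := by
    intro j hj
    rcases List.mem_cons.1 hj with rfl | hj
    · have h1 := apply_eq_zero_of_mem_eliminate hG h.mem
      rw [Pi.sub_apply, eliminate_apply hG, sub_zero] at h1
      exact h1
    · exact h.vanish j hj
  unique u hu hall := h.unique u (mem_eliminate hG hu (hall i List.mem_cons_self))
    fun j hj => hall j (List.mem_cons_of_mem _ hj)

/-- The description of an elementary vector: an entry that does not vanish, its sign, and entries
that vanish. -/
abbrev Round (M : ℕ) : Type := Fin M × SignType × List (Fin M)

/-- The description `r` determines the vector `V` of the subspace `X` up to a positive factor. -/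
structure Describes (X : Submodule ℝ (Fin M → ℝ)) (V : Fin M → ℝ) (r : Round M) : Prop where
  mem : V ∈ X
  ne_zero : V r.1 ≠ 0
  sign : SignType.sign (V r.1) = r.2.1
  vanish : ∀ i ∈ r.2.2, V i = 0
  unique : ∀ u ∈ X, u r.1 = 0 → (∀ i ∈ r.2.2, u i = 0) → u = 0

/-- A decomposition of a vector into a positive combination of conforming elementary vectors with the
given descriptions. -/
inductive Decomposes (X : Submodule ℝ (Fin M → ℝ)) : (Fin M → ℝ) → List (Round M) → Prop
  | nil : Decomposes X 0 []
  | cons {x V : Fin M → ℝ} {t : ℝ} {r : Round M} {rs : List (Round M)} : Describes X V r →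
      Conforms V x → 0 < t → Conforms (x - t • V) x → Decomposes X (x - t • V) rs →
      Decomposes X x (r :: rs)

theorem describes_of_isWalk {X : Submodule ℝ (Fin M → ℝ)} {Gs : List (Fin M → ℝ)}
    (hX : X = listSpan Gs) {x V : Fin M → ℝ} (hx : x ∈ X) {j : Fin M} (hj : x j ≠ 0)
    {hits : List (Fin M)} (hw : IsWalk x (Gs.map (eliminate j x)) V hits) :
    Describes X V (j, SignType.sign (x j), hits) := by
  have hle : listSpan (Gs.map (eliminate j x)) ≤ X :=
    eliminate_span_le hx fun g hg => hX ▸ mem_listSpan hg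
  have hV : V j = x j := by
    have := apply_eq_zero_of_mem_eliminate hj hw.mem
    rw [Pi.sub_apply] at this
    linarith
  refine ⟨?_, by rwa [hV], by rw [hV], hw.vanish, fun u hu huj hall => hw.unique u ?_ hall⟩
  · have := X.add_mem (hle hw.mem) hx
    rwa [sub_add_cancel] at this
  · refine mem_eliminate hj (listSpan_le.2 (fun g hg => ?_) (hX ▸ hu)) huj
    exact mem_listSpan (List.mem_cons_of_mem _ hg)

/-- The vectors of `X` that vanish where `x` vanishes. -/
def supportSpace (X : Submodule ℝ (Fin M → ℝ)) (x : Fin M → ℝ) : Submodule ℝ (Fin M → ℝ) where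
  carrier := {u | u ∈ X ∧ ∀ p, x p = 0 → u p = 0}
  add_mem' := fun ha hb => ⟨X.add_mem ha.1 hb.1, fun p hp => by
    rw [Pi.add_apply, ha.2 p hp, hb.2 p hp, add_zero]⟩
  zero_mem' := ⟨X.zero_mem, fun _ _ => rfl⟩
  smul_mem' := fun c a ha => ⟨X.smul_mem c ha.1, fun p hp => by
    rw [Pi.smul_apply, ha.2 p hp, smul_zero]⟩

theorem mem_supportSpace {X : Submodule ℝ (Fin M → ℝ)} {x u : Fin M → ℝ} :
    u ∈ supportSpace X x ↔ u ∈ X ∧ ∀ p, x p = 0 → u p = 0 := Iff.rfl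

/-- Subtracting the largest multiple of a conforming vector that keeps the signs lowers the dimension
of the support. -/
theorem finrank_supportSpace_lt {X : Submodule ℝ (Fin M → ℝ)} {x V : Fin M → ℝ} (hV : V ∈ X)
    (hc : Conforms V x) {i : Fin M} (hi : V i ≠ 0) :
    Module.finrank ℝ (supportSpace X (x - (x i / V i) • V)) < Module.finrank ℝ (supportSpace X x) := by
  have hVx : ∀ p, x p = 0 → V p = 0 := fun p hp => by_contra fun h => hc.ne_zero h hp
  refine Submodule.finrank_lt_finrank_of_lt (SetLike.lt_iff_le_and_exists.2
    ⟨fun u hu => mem_supportSpace.2 ⟨hu.1, fun p hp => hu.2 p ?_⟩, V,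
      mem_supportSpace.2 ⟨hV, hVx⟩, fun h => hi ((mem_supportSpace.1 h).2 i ?_)⟩)
  · simp [hp, hVx p hp]
  · simp [hi]

end Decomposition

/-! ### Decision procedures with registers -/

/-- A search tree over `N` hyperplanes whose leaves carry arbitrary results. -/
inductive Gadget (N m : ℕ) (α : Type) : Type
  | ret (a : α) : Gadget N m α
  | compute (r : ℕ) (op : RealOp N m) (next : Gadget N m α) : Gadget N m α
  | branch (r : ℕ) (neg zero pos : Gadget N m α) : Gadget N m α

namespace Gadget

variable {N m : ℕ} {α β : Type}

/-- Continue at each leaf with the gadget that its result determines. -/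
def bind : Gadget N m α → (α → Gadget N m β) → Gadget N m β
  | ret a, f => f a
  | compute r op next, f => compute r op (next.bind f)
  | branch r a b c, f => branch r (a.bind f) (b.bind f) (c.bind f)

/-- The result, the final contents of the registers and the number of steps. -/
noncomputable def exec (h : Fin N → Hyperplane m) (q : Fin (m + 1) → ℝ) :
    Gadget N m α → (ℕ → ℝ) → α × (ℕ → ℝ) × ℕ
  | ret a, mem => (a, mem, 0)
  | compute r op next, mem =>
    let out := exec h q next (Function.update mem r (op.value h q mem))
    (out.1, out.2.1, out.2.2 + 1)
  | branch r neg zero pos, mem =>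
    let out :=
      if mem r < 0 then exec h q neg mem
      else if mem r = 0 then exec h q zero mem
      else exec h q pos mem
    (out.1, out.2.1, out.2.2 + 1)

theorem exec_bind (h : Fin N → Hyperplane m) (q : Fin (m + 1) → ℝ) (G : Gadget N m α)
    (f : α → Gadget N m β) (mem : ℕ → ℝ) : (G.bind f).exec h q mem =
      let o := G.exec h q mem
      let o' := (f o.1).exec h q o.2.1
      (o'.1, o'.2.1, o'.2.2 + o.2.2) := by
  induction G generalizing mem with
  | ret a => rfl
  | compute r op next ih => simp only [bind, exec, ih, add_assoc]
  | branch r a b c iha ihb ihc =>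
    simp only [bind, exec]
    split_ifs <;> simp only [iha, ihb, ihc, add_assoc]

end Gadget

/-- Programs that generate gadgets. The state is the number of registers that are in use: every
value is written to a fresh register. -/
def Prog (N m : ℕ) (α : Type) : Type := ℕ → Gadget N m (α × ℕ)

instance {N m : ℕ} : Monad (Prog N m) where
  pure a := fun k => .ret (a, k)
  bind p f := fun k => (p k).bind fun o => f o.1 o.2

namespace Prog

variable {N m : ℕ} {α β : Type}

/-- The new state `k', mem'` keeps the registers that were in use. -/
def Ext (k : ℕ) (mem : ℕ → ℝ) (k' : ℕ) (mem' : ℕ → ℝ) : Prop :=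
  k ≤ k' ∧ ∀ r < k, mem' r = mem r

theorem Ext.refl (k : ℕ) (mem : ℕ → ℝ) : Ext k mem k mem := ⟨le_rfl, fun _ _ => rfl⟩

theorem Ext.trans {k k' k'' : ℕ} {mem mem' mem'' : ℕ → ℝ} (h : Ext k mem k' mem')
    (h' : Ext k' mem' k'' mem'') : Ext k mem k'' mem'' :=
  ⟨h.1.trans h'.1, fun r hr => (h'.2 r (hr.trans_le h.1)).trans (h.2 r hr)⟩

/-- The register `r` is in use and contains `x`. -/
def IsVal (k : ℕ) (mem : ℕ → ℝ) (r : ℕ) (x : ℝ) : Prop := r < k ∧ mem r = x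

theorem IsVal.ext {k k' r : ℕ} {mem mem' : ℕ → ℝ} {x : ℝ} (h : IsVal k mem r x)
    (e : Ext k mem k' mem') : IsVal k' mem' r x :=
  ⟨h.1.trans_le e.1, (e.2 r h.1).trans h.2⟩

/-- The registers `u` contain the entries of the vector `U`. -/
def IsVec {M : ℕ} (k : ℕ) (mem : ℕ → ℝ) (u : Fin M → ℕ) (U : Fin M → ℝ) : Prop :=
  ∀ p, IsVal k mem (u p) (U p)

theorem IsVec.ext {M k k' : ℕ} {mem mem' : ℕ → ℝ} {u : Fin M → ℕ} {U : Fin M → ℝ}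
    (h : IsVec k mem u U) (e : Ext k mem k' mem') : IsVec k' mem' u U := fun p => (h p).ext e

/-- The registers `us` contain the entries of the vectors `Us`. -/
def IsVecs {M : ℕ} (k : ℕ) (mem : ℕ → ℝ) (us : List (Fin M → ℕ)) (Us : List (Fin M → ℝ)) : Prop :=
  List.Forall₂ (IsVec k mem) us Us

theorem IsVecs.ext {M k k' : ℕ} {mem mem' : ℕ → ℝ} {us : List (Fin M → ℕ)} {Us : List (Fin M → ℝ)}
    (h : IsVecs k mem us Us) (e : Ext k mem k' mem') : IsVecs k' mem' us Us :=
  h.imp fun _ _ h => h.ext e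

variable (h : Fin N → Hyperplane m) (q : Fin (m + 1) → ℝ)

/-- From the given state, the program keeps the registers in use, takes at most `B` steps and
establishes `Q`. -/
def Ok (p : Prog N m α) (k : ℕ) (mem : ℕ → ℝ) (B : ℕ) (Q : α → ℕ → (ℕ → ℝ) → Prop) : Prop :=
  let o := (p k).exec h q mem
  Q o.1.1 o.1.2 o.2.1 ∧ Ext k mem o.1.2 o.2.1 ∧ o.2.2 ≤ B

variable {h q}

theorem Ok.pure {a : α} {k : ℕ} {mem : ℕ → ℝ} {B : ℕ} {Q : α → ℕ → (ℕ → ℝ) → Prop}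
    (hQ : Q a k mem) : Ok h q (Pure.pure a) k mem B Q := ⟨hQ, .refl _ _, Nat.zero_le _⟩

theorem Ok.bind {p : Prog N m α} {f : α → Prog N m β} {k : ℕ} {mem : ℕ → ℝ} {B B' : ℕ}
    {Q : α → ℕ → (ℕ → ℝ) → Prop} {Q' : β → ℕ → (ℕ → ℝ) → Prop} (hp : Ok h q p k mem B Q)
    (hf : ∀ a k' mem', Ext k mem k' mem' → Q a k' mem' → Ok h q (f a) k' mem' B' Q') :
    Ok h q (p >>= f) k mem (B + B') Q' := by
  obtain ⟨h1, h2, h3⟩ := hp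
  obtain ⟨h4, h5, h6⟩ := hf _ _ _ h2 h1
  have e : (p >>= f) k = (p k).bind fun o => f o.1 o.2 := rfl
  simp only [Ok, e, Gadget.exec_bind]
  exact ⟨h4, h2.trans h5, by omega⟩

theorem Ok.mono {p : Prog N m α} {k : ℕ} {mem : ℕ → ℝ} {B B' : ℕ}
    {Q Q' : α → ℕ → (ℕ → ℝ) → Prop} (hp : Ok h q p k mem B Q) (hB : B ≤ B')
    (hQ : ∀ a k' mem', Ext k mem k' mem' → Q a k' mem' → Q' a k' mem') : Ok h q p k mem B' Q' :=
  ⟨hQ _ _ _ hp.2.1 hp.1, hp.2.1, hp.2.2.trans hB⟩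

/-- Execute an instruction. -/
def op (o : RealOp N m) : Prog N m ℕ := fun k => .compute k o (.ret (k, k + 1))

theorem ok_op (o : RealOp N m) {k : ℕ} {mem : ℕ → ℝ} {x : ℝ} (hx : o.value h q mem = x) :
    Ok h q (op o) k mem 1 fun r k' mem' => IsVal k' mem' r x := by
  refine ⟨⟨?_, ?_⟩, ⟨?_, fun r hr => ?_⟩, ?_⟩
  · simp [op, Gadget.exec]
  · simp [op, Gadget.exec, hx]
  · simp [op, Gadget.exec]
  · simp [op, Gadget.exec, Function.update_of_ne hr.ne]
  · simp [op, Gadget.exec]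

/-- Find the sign of a register. -/
def test (r : ℕ) : Prog N m SignType := fun k => .branch r (.ret (-1, k)) (.ret (0, k)) (.ret (1, k))

theorem ok_test {r k : ℕ} {mem : ℕ → ℝ} {x : ℝ} (hr : IsVal k mem r x) :
    Ok h q (test r) k mem 1 fun s _ _ => s = SignType.sign x := by
  obtain ⟨-, rfl⟩ := hr
  rcases lt_trichotomy (mem r) 0 with h0 | h0 | h0
  · refine ⟨?_, ?_, ?_⟩ <;> simp [test, Gadget.exec, h0, Ext]
  · refine ⟨?_, ?_, ?_⟩ <;> simp [test, Gadget.exec, h0, Ext]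
  · refine ⟨?_, ?_, ?_⟩ <;> simp [test, Gadget.exec, h0, h0.not_gt, h0.ne', Ext]

theorem ok_mul {a b k : ℕ} {mem : ℕ → ℝ} {x y : ℝ} (ha : IsVal k mem a x) (hb : IsVal k mem b y) :
    Ok h q (op (.mul a b)) k mem 1 fun r k' mem' => IsVal k' mem' r (x * y) :=
  ok_op _ (by rw [RealOp.value, ha.2, hb.2])

theorem ok_sub {a b k : ℕ} {mem : ℕ → ℝ} {x y : ℝ} (ha : IsVal k mem a x) (hb : IsVal k mem b y) :
    Ok h q (op (.sub a b)) k mem 1 fun r k' mem' => IsVal k' mem' r (x - y) :=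
  ok_op _ (by rw [RealOp.value, ha.2, hb.2])

theorem ok_div {a b k : ℕ} {mem : ℕ → ℝ} {x y : ℝ} (ha : IsVal k mem a x) (hb : IsVal k mem b y) :
    Ok h q (op (.div a b)) k mem 1 fun r k' mem' => IsVal k' mem' r (x / y) :=
  ok_op _ (by rw [RealOp.value, ha.2, hb.2])

/-- Compute a vector entry by entry. -/
def vec : ∀ {M : ℕ}, (Fin M → Prog N m ℕ) → Prog N m (Fin M → ℕ)
  | 0, _ => pure Fin.elim0
  | _ + 1, f => do
    let a ← f 0
    let v ← vec fun p => f p.succ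
    pure (Fin.cons a v)

theorem ok_vec : ∀ {M : ℕ} {f : Fin M → Prog N m ℕ} {U : Fin M → ℝ} {k : ℕ} {mem : ℕ → ℝ} {B : ℕ},
    (∀ p k' mem', Ext k mem k' mem' →
      Ok h q (f p) k' mem' B fun r k' mem' => IsVal k' mem' r (U p)) →
    Ok h q (vec f) k mem (M * B) fun v k' mem' => IsVec k' mem' v U
  | 0, _, _, _, _, _, _ => .pure fun p => p.elim0
  | M + 1, f, U, k, mem, B, hf => by
    have h1 := (hf 0 k mem (.refl _ _)).bind (β := Fin (M + 1) → ℕ) (B' := M * B)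
      (f := fun a => (vec fun p => f p.succ) >>= fun v => pure (Fin.cons a v))
      (Q' := fun v k' mem' => IsVec k' mem' v U) fun a k' mem' e ha =>
        (ok_vec (U := fun p => U p.succ) fun p k'' mem'' e' => hf p.succ k'' mem'' (e.trans e')).bind
          (B' := 0) fun v k'' mem'' e' hv => .pure fun p => by
            refine Fin.cases ?_ (fun p => ?_) p
            · exact ha.ext e'
            · exact hv p
    exact h1.mono (by rw [add_mul, one_mul, add_comm]) fun _ _ _ _ h => h

/-- The vector `u - c w`. -/
def subMul {M : ℕ} (u : Fin M → ℕ) (c : ℕ) (w : Fin M → ℕ) : Prog N m (Fin M → ℕ) :=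
  vec fun p => do
    let t ← op (.mul c (w p))
    op (.sub (u p) t)

theorem ok_subMul {M : ℕ} {u w : Fin M → ℕ} {c k : ℕ} {mem : ℕ → ℝ} {U W : Fin M → ℝ} {x : ℝ}
    (hu : IsVec k mem u U) (hc : IsVal k mem c x) (hw : IsVec k mem w W) :
    Ok h q (subMul u c w) k mem (M * 2) fun v k' mem' => IsVec k' mem' v (U - x • W) :=
  ok_vec fun p _ _ e => (ok_mul (hc.ext e) ((hw p).ext e)).bind fun _ _ _ e' ht =>
    ok_sub ((hu p).ext (e.trans e')) ht

/-- Apply a program to all elements of a list. -/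
def mapP (f : α → Prog N m β) : List α → Prog N m (List β)
  | [] => pure []
  | a :: l => do
    let b ← f a
    let l' ← mapP f l
    pure (b :: l')

theorem ok_mapP {M : ℕ} {f : (Fin M → ℕ) → Prog N m (Fin M → ℕ)} {F : (Fin M → ℝ) → Fin M → ℝ}
    {B : ℕ} : ∀ {us : List (Fin M → ℕ)} {Us : List (Fin M → ℝ)} {k : ℕ} {mem : ℕ → ℝ},
    IsVecs k mem us Us → (∀ u U k' mem', Ext k mem k' mem' → IsVec k' mem' u U →
      Ok h q (f u) k' mem' B fun v k' mem' => IsVec k' mem' v (F U)) →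
    Ok h q (mapP f us) k mem (us.length * B) fun vs k' mem' => IsVecs k' mem' vs (Us.map F)
  | [], Us, _, _, hu, _ => by
    cases hu
    exact .pure .nil
  | u :: us, Us, k, mem, hu, hf => by
    cases hu with
    | cons hu hus =>
      refine Ok.mono ((hf _ _ k mem (.refl _ _) hu).bind (B' := us.length * B) fun v k' mem' e hv =>
        (ok_mapP (IsVecs.ext hus e) fun u U k'' mem'' e' => hf u U k'' mem'' (e.trans e')).bind (B' := 0)
          (Q' := fun vs k' mem' => IsVecs k' mem' vs (_ :: List.map F _))
          fun vs k'' mem'' e' hvs => .pure (.cons (hv.ext e') hvs)) ?_ fun _ _ _ _ h => h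
      rw [List.length_cons, add_mul, one_mul]
      omega

/-- Search for the first zero on a line, among the given entries; `best` is the best entry so far,
with the register of its squared ratio. -/
def hitFrom {M : ℕ} (y g : Fin M → ℕ) : List (Fin M) → Option (Fin M × ℕ) → Prog N m (Option (Fin M))
  | [], best => pure (best.map Prod.fst)
  | p :: ps, best => do
    let s ← test (g p)
    if s = 0 then hitFrom y g ps best
    else do
      let t ← op (.div (y p) (g p))
      let sq ← op (.mul t t)
      match best with
      | none => hitFrom y g ps (some (p, sq))
      | some b => do
        let d ← op (.sub sq b.2)
        let s' ← test d
        if s' = -1 then hitFrom y g ps (some (p, sq)) else hitFrom y g ps (some b)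

/-- The entry `best` is the first hit among the entries in `S`. -/
def IsBest {M : ℕ} (k : ℕ) (mem : ℕ → ℝ) (Y G : Fin M → ℝ) (S : Fin M → Prop)
    (best : Option (Fin M × ℕ)) : Prop :=
  (best = none ∧ ∀ p, S p → G p = 0) ∨ ∃ i r, best = some (i, r) ∧ IsVal k mem r ((Y i / G i) ^ 2) ∧
    G i ≠ 0 ∧ ∀ p, S p → G p ≠ 0 → (Y i / G i) ^ 2 ≤ (Y p / G p) ^ 2

theorem IsBest.ext {M k k' : ℕ} {mem mem' : ℕ → ℝ} {Y G : Fin M → ℝ} {S : Fin M → Prop}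
    {best : Option (Fin M × ℕ)} (hb : IsBest k mem Y G S best) (e : Ext k mem k' mem') :
    IsBest k' mem' Y G S best := by
  rcases hb with hb | ⟨i, r, h1, h2, h3⟩
  · exact .inl hb
  · exact .inr ⟨i, r, h1, h2.ext e, h3⟩

theorem ok_hitFrom {M : ℕ} {y g : Fin M → ℕ} {Y G : Fin M → ℝ} : ∀ {ps : List (Fin M)}
    {S : Fin M → Prop} {best : Option (Fin M × ℕ)} {k : ℕ} {mem : ℕ → ℝ},
    IsVec k mem y Y → IsVec k mem g G → IsBest k mem Y G S best → (∀ p, S p ∨ p ∈ ps) →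
    Ok h q (hitFrom y g ps best) k mem (ps.length * 5) fun o _ _ => IsFirstHit Y G o
  | [], S, best, k, mem, _, _, hb, hS => .pure <| by
    have hS : ∀ p, S p := fun p => (hS p).resolve_right (by simp)
    rcases hb with ⟨rfl, h0⟩ | ⟨i, r, rfl, -, h2, h3⟩
    · exact .inl ⟨rfl, fun p => h0 p (hS p)⟩
    · exact .inr ⟨i, rfl, h2, fun p => h3 p (hS p)⟩
  | p :: ps, S, best, k, mem, hy, hg, hb, hS => by
    have hS' : ∀ p', (S p' ∨ p' = p) ∨ p' ∈ ps := fun p' => by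
      have := hS p'; rw [List.mem_cons] at this; tauto
    refine Ok.mono (B := 1 + (4 + ps.length * 5)) ((ok_test (hg p)).bind fun s k1 mem1 e1 hs => ?_)
      (by rw [List.length_cons]; omega) fun _ _ _ _ h => h
    subst hs
    split_ifs with h0
    · rw [sign_eq_zero_iff] at h0
      refine Ok.mono (ok_hitFrom (hy.ext e1) (hg.ext e1) (S := fun p' => S p' ∨ p' = p) ?_ hS')
        (by omega) fun _ _ _ _ h => h
      rcases hb.ext e1 with ⟨rfl, h1⟩ | ⟨i, r, h1, h2, h3, h4⟩
      · refine .inl ⟨rfl, fun p' hp' => hp'.elim (h1 p') ?_⟩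
        rintro rfl; exact h0
      · refine .inr ⟨i, r, h1, h2, h3, fun p' hp' => hp'.elim (h4 p') ?_⟩
        rintro rfl; exact fun h => absurd h0 h
    · rw [sign_eq_zero_iff] at h0
      refine Ok.mono (B := 1 + (1 + (2 + ps.length * 5)))
        ((ok_div ((hy p).ext e1) ((hg p).ext e1)).bind fun t k2 mem2 e2 ht =>
          (ok_mul ht ht).bind fun sq k3 mem3 e3 hsq => ?_) (by omega) fun _ _ _ _ h => h
      rw [← pow_two] at hsq
      have e13 := e1.trans (e2.trans e3)
      rcases hb.ext e13 with ⟨rfl, h1⟩ | ⟨i, r, rfl, h2, h3, h4⟩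
      · refine Ok.mono (ok_hitFrom (hy.ext e13) (hg.ext e13) (S := fun p' => S p' ∨ p' = p)
          (.inr ⟨p, sq, rfl, hsq, h0, fun p' hp' hne => ?_⟩) hS') (by omega) fun _ _ _ _ h => h
        rcases hp' with hp' | rfl
        · exact absurd (h1 p' hp') hne
        · exact le_rfl
      · refine Ok.mono (B := 1 + (1 + ps.length * 5)) ((ok_sub hsq h2).bind fun d k4 mem4 e4 hd =>
          (ok_test hd).bind fun s' k5 mem5 e5 hs' => ?_) (by omega) fun _ _ _ _ h => h
        have e15 := e13.trans (e4.trans e5)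
        subst hs'
        split_ifs with hlt
        · rw [sign_eq_neg_one_iff, sub_neg] at hlt
          refine ok_hitFrom (hy.ext e15) (hg.ext e15) (S := fun p' => S p' ∨ p' = p)
            (.inr ⟨p, sq, rfl, hsq.ext (e4.trans e5), h0, fun p' hp' hne => ?_⟩) hS'
          rcases hp' with hp' | rfl
          · exact hlt.le.trans (h4 p' hp' hne)
          · exact le_rfl
        · rw [sign_eq_neg_one_iff, sub_neg, not_lt] at hlt
          refine ok_hitFrom (hy.ext e15) (hg.ext e15) (S := fun p' => S p' ∨ p' = p)
            (.inr ⟨i, r, rfl, h2.ext (e4.trans e5), h3, fun p' hp' hne => ?_⟩) hS'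
          rcases hp' with hp' | rfl
          · exact h4 p' hp' hne
          · exact hlt

/-- The entry whose zero on the line through `y` with the direction `g` is nearest to `y`, if `g` is not
zero. -/
def hit {M : ℕ} (y g : Fin M → ℕ) : Prog N m (Option (Fin M)) := hitFrom y g (List.finRange M) none

theorem ok_hit {M : ℕ} {y g : Fin M → ℕ} {Y G : Fin M → ℝ} {k : ℕ} {mem : ℕ → ℝ}
    (hy : IsVec k mem y Y) (hg : IsVec k mem g G) :
    Ok h q (hit y g) k mem (M * 5) fun o _ _ => IsFirstHit Y G o := by
  have := ok_hitFrom (h := h) (q := q) hy hg (S := fun _ => False) (best := none)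
    (ps := List.finRange M) (.inl ⟨rfl, fun _ h => h.elim⟩) fun p => .inr (List.mem_finRange p)
  rwa [List.length_finRange] at this

/-- Eliminate the `i`-th entry from a list of vectors. -/
def elim {M : ℕ} (i : Fin M) (g : Fin M → ℕ) : List (Fin M → ℕ) → Prog N m (List (Fin M → ℕ)) :=
  mapP fun g' => do
    let c ← op (.div (g' i) (g i))
    subMul g' c g

theorem ok_elim {M : ℕ} {i : Fin M} {g : Fin M → ℕ} {G : Fin M → ℝ} {us : List (Fin M → ℕ)}
    {Us : List (Fin M → ℝ)} {k : ℕ} {mem : ℕ → ℝ} (hg : IsVec k mem g G) (hu : IsVecs k mem us Us) :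
    Ok h q (elim i g us) k mem (us.length * (1 + M * 2)) fun vs k' mem' =>
      IsVecs k' mem' vs (Us.map (eliminate i G)) :=
  ok_mapP hu fun _ _ _ _ e hu => (ok_div (hu i) ((hg i).ext e)).bind fun _ _ _ e' hc =>
    ok_subMul (hu.ext e') hc (hg.ext (e.trans e'))

/-- Walk from `y` in the directions `gs`, one after the other, until entries vanish. -/
def walk {M : ℕ} : ℕ → List (Fin M → ℕ) → (Fin M → ℕ) → Prog N m ((Fin M → ℕ) × List (Fin M))
  | 0, _, y => pure (y, [])
  | _ + 1, [], y => pure (y, [])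
  | f + 1, g :: gs, y => do
    let o ← hit y g
    match o with
    | none => walk f gs y
    | some i => do
      let c ← op (.div (y i) (g i))
      let y' ← subMul y c g
      let gs' ← elim i g gs
      let o' ← walk f gs' y'
      pure (o'.1, i :: o'.2)

theorem ok_walk {M D : ℕ} : ∀ {f : ℕ} {gs : List (Fin M → ℕ)} {Gs : List (Fin M → ℝ)}
    {y : Fin M → ℕ} {Y : Fin M → ℝ} {k : ℕ} {mem : ℕ → ℝ}, IsVecs k mem gs Gs → IsVec k mem y Y →
    gs.length ≤ f → f ≤ D → Ok h q (walk f gs y) k mem (f * (M * 5 + (1 + (M * 2 + D * (1 + M * 2)))))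
      fun o k' mem' => ∃ V, IsVec k' mem' o.1 V ∧ IsWalk Y Gs V o.2 ∧ o.2.length ≤ f
  | 0, [], Gs, y, Y, k, mem, hg, hy, _, _ => by
    cases hg
    exact .pure ⟨Y, hy, .nil Y, le_rfl⟩
  | 0, _ :: _, Gs, y, Y, k, mem, hg, hy, hl, _ => by simp at hl
  | f + 1, [], Gs, y, Y, k, mem, hg, hy, _, _ => by
    cases hg
    exact .pure ⟨Y, hy, .nil Y, Nat.zero_le _⟩
  | f + 1, g :: gs, _, y, Y, k, mem, .cons (b := G) (l₂ := Gs) hg hgs, hy, hl, hf => by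
    rw [List.length_cons] at hl
    refine Ok.mono (B := M * 5 + (1 + (M * 2 + (D * (1 + M * 2) +
      (f * (M * 5 + (1 + (M * 2 + D * (1 + M * 2)))) + 0)))))
      ((ok_hit hy hg).bind fun o k1 mem1 e1 ho => ?_)
      (by rw [add_mul, one_mul]; omega) fun _ _ _ _ h => h
    rcases ho with ⟨rfl, h0⟩ | ⟨i, rfl, hG, hmin⟩
    · refine Ok.mono (ok_walk (IsVecs.ext hgs e1) (hy.ext e1) (by omega) (by omega : f ≤ D)) (by omega) ?_
      rintro o k2 mem2 - ⟨V, h1, h2, h3⟩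
      exact ⟨V, h1, h2.skip h0, h3.trans (Nat.le_succ f)⟩
    · refine (ok_div ((hy i).ext e1) ((hg i).ext e1)).bind fun c k2 mem2 e2 hc =>
        (ok_subMul ((hy.ext e1).ext e2) hc (hg.ext (e1.trans e2))).bind fun y' k3 mem3 e3 hy' => ?_
      have e13 := e1.trans (e2.trans e3)
      refine Ok.bind (Q := fun vs k' mem' => IsVecs k' mem' vs (Gs.map (eliminate i G)) ∧
        vs.length = gs.length) (Ok.mono (ok_elim (i := i) (hg.ext e13) (IsVecs.ext hgs e13))
          (Nat.mul_le_mul_right _ (by omega)) fun vs _ _ _ hv => ⟨hv, ?_⟩)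
          fun gs' k4 mem4 e4 hgs' => ?_
      · rw [hv.length_eq, List.length_map, hgs.length_eq]
      · refine (ok_walk hgs'.1 (hy'.ext e4) (by omega) (by omega : f ≤ D)).bind ?_
        rintro o k5 mem5 - ⟨V, h1, h2, h3⟩
        exact .pure ⟨V, h1, h2.step hG hmin, by simpa using h3⟩

/-- The first non-zero entry and its sign. -/
def findNonzero {M : ℕ} (x : Fin M → ℕ) : List (Fin M) → Prog N m (Option (Fin M × SignType))
  | [] => pure none
  | p :: ps => do
    let s ← test (x p)
    if s = 0 then findNonzero x ps else pure (some (p, s))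

theorem ok_findNonzero {M : ℕ} {x : Fin M → ℕ} {X : Fin M → ℝ} : ∀ {ps : List (Fin M)} {k : ℕ}
    {mem : ℕ → ℝ}, IsVec k mem x X → Ok h q (findNonzero x ps) k mem ps.length fun o _ _ =>
      (o = none ∧ ∀ p ∈ ps, X p = 0) ∨ ∃ p, o = some (p, SignType.sign (X p)) ∧ X p ≠ 0
  | [], _, _, _ => .pure (.inl ⟨rfl, by simp⟩)
  | p :: ps, k, mem, hx => by
    refine Ok.mono (B := 1 + ps.length) ((ok_test (hx p)).bind fun s k1 mem1 e1 hs => ?_)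
      (by rw [List.length_cons]; omega) fun _ _ _ _ h => h
    subst hs
    split_ifs with h0
    · rw [sign_eq_zero_iff] at h0
      refine Ok.mono (ok_findNonzero (hx.ext e1)) le_rfl ?_
      rintro o _ _ - (⟨rfl, h1⟩ | h1)
      · refine .inl ⟨rfl, fun p' hp' => ?_⟩
        rcases List.mem_cons.1 hp' with rfl | hp'
        · exact h0
        · exact h1 p' hp'
      · exact .inr h1
    · rw [sign_eq_zero_iff] at h0
      exact .pure (.inr ⟨p, rfl, h0⟩)

/-- Decompose the vector `x` of the span of `gens` into elementary vectors; `D` bounds the number of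
generators. -/
def decompose {M : ℕ} (D : ℕ) (gens : List (Fin M → ℕ)) : ℕ → (Fin M → ℕ) → Prog N m (List (Round M))
  | 0, _ => pure []
  | f + 1, x => do
    let o ← findNonzero x (List.finRange M)
    match o with
    | none => pure []
    | some js => do
      let gens' ← elim js.1 x gens
      let w ← walk D gens' x
      let o' ← hit x w.1
      match o' with
      | none => pure [(js.1, js.2, w.2)]
      | some i => do
        let c ← op (.div (x i) (w.1 i))
        let x' ← subMul x c w.1
        let rest ← decompose D gens f x'
        pure ((js.1, js.2, w.2) :: rest)

/-- Each round lowers the dimension of the support, so that a bound for this dimension is also one for the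
number of rounds. -/
theorem ok_decompose {M D : ℕ} {gens : List (Fin M → ℕ)} {Gs : List (Fin M → ℝ)} : ∀ {f : ℕ}
    {x : Fin M → ℕ} {X : Fin M → ℝ} {k : ℕ} {mem : ℕ → ℝ}, IsVecs k mem gens Gs → gens.length ≤ D →
    IsVec k mem x X → X ∈ listSpan Gs → Module.finrank ℝ (supportSpace (listSpan Gs) X) ≤ f →
    Ok h q (decompose D gens f x) k mem (f * (M + (D * (1 + M * 2) +
      (D * (M * 5 + (1 + (M * 2 + D * (1 + M * 2)))) + (M * 5 + (1 + M * 2))))))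
      fun rs _ _ => Decomposes (listSpan Gs) X rs ∧ rs.length ≤ f ∧ ∀ r ∈ rs, r.2.2.length ≤ D
  | 0, x, X, k, mem, _, _, hx, hX, hf => .pure <| by
    rw [Nat.le_zero, Submodule.finrank_eq_zero] at hf
    have : X ∈ supportSpace (listSpan Gs) X := mem_supportSpace.2 ⟨hX, fun _ h => h⟩
    rw [hf, Submodule.mem_bot] at this
    exact ⟨this ▸ .nil, by simp⟩
  | f + 1, x, X, k, mem, hg, hD, hx, hX, hf => by
    set B := M + (D * (1 + M * 2) +
      (D * (M * 5 + (1 + (M * 2 + D * (1 + M * 2)))) + (M * 5 + (1 + M * 2)))) with hB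
    refine Ok.mono (B := M + (D * (1 + M * 2) + (D * (M * 5 + (1 + (M * 2 + D * (1 + M * 2)))) +
      (M * 5 + (1 + (M * 2 + (f * B + 0))))))) ((Ok.mono (ok_findNonzero hx) (by simp)
        fun _ _ _ _ h => h).bind fun o k1 mem1 e1 ho => ?_)
      (by rw [add_mul, one_mul]; omega) fun _ _ _ _ h => h
    rcases ho with ⟨rfl, h0⟩ | ⟨j, rfl, hj⟩
    · have : X = 0 := funext fun p => h0 p (List.mem_finRange p)
      exact .pure ⟨this ▸ .nil, by simp⟩
    · refine Ok.bind (Q := fun vs k' mem' => IsVecs k' mem' vs (Gs.map (eliminate j X)) ∧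
        vs.length = gens.length) (Ok.mono (ok_elim (i := j) (hx.ext e1) (hg.ext e1))
          (Nat.mul_le_mul_right _ hD) fun vs _ _ _ hv => ⟨hv, ?_⟩) fun gs' k2 mem2 e2 hgs' => ?_
      · rw [hv.length_eq, List.length_map, hg.length_eq]
      have e12 := e1.trans e2
      refine (ok_walk hgs'.1 (hx.ext e12) (by omega) le_rfl).bind ?_
      rintro w k3 mem3 e3 ⟨V, hV, hw, hl⟩
      have e13 := e12.trans e3
      have hdesc := describes_of_isWalk rfl hX hj hw
      refine (ok_hit (hx.ext e13) hV).bind fun o k4 mem4 e4 ho => ?_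
      rcases ho with ⟨rfl, h0⟩ | ⟨i, rfl, hVi, hmin⟩
      · exact absurd (h0 j) hdesc.ne_zero
      · have e14 := e13.trans e4
        refine (ok_div ((hx i).ext e14) ((hV i).ext e4)).bind fun c k5 mem5 e5 hc =>
          (ok_subMul (hx.ext (e14.trans e5)) hc (hV.ext (e4.trans e5))).bind fun x' k6 mem6 e6 hx' => ?_
        have hlt := finrank_supportSpace_lt hdesc.mem hw.conforms hVi
        refine (ok_decompose (hg.ext (e14.trans (e5.trans e6))) hD hx'
          (Submodule.sub_mem _ hX (Submodule.smul_mem _ _ hdesc.mem)) (by omega : _ ≤ f)).bind ?_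
        rintro rs k7 mem7 - ⟨h1, h2, h3⟩
        refine .pure ⟨.cons hdesc hw.conforms ?_ (conforms_of_firstHit hmin) h1, by simpa using h2, ?_⟩
        · -- the ratio is positive because `V` conforms to `X`
          have hs := hw.conforms i hVi
          rcases lt_or_gt_of_ne hVi with hneg | hpos
          · rw [sign_neg hneg] at hs
            exact div_pos_of_neg_of_neg (sign_eq_neg_one_iff.1 hs.symm) hneg
          · rw [sign_pos hpos] at hs
            exact div_pos (sign_eq_one_iff.1 hs.symm) hpos
        · intro r hr
          rcases List.mem_cons.1 hr with rfl | hr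
          · exact hl
          · exact h3 r hr

end Prog

namespace Prog

variable {N m : ℕ} {h : Fin N → Hyperplane m} {q : Fin (m + 1) → ℝ}

/-- The forms of the `k`-th unit vector. -/
def unitEntry (z one : ℕ) (k : Fin (m + 1)) : Fin (N + 1) → Prog N m ℕ :=
  Fin.cases (pure z) fun i => Fin.lastCases (pure one) (fun j => do
    let a ← op (.slope i j)
    op (.sub z a)) k

/-- The forms of the origin. -/
def originEntry (z one : ℕ) : Fin (N + 1) → Prog N m ℕ :=
  Fin.cases (pure one) fun i => do
    let a ← op (.icpt i)
    op (.sub z a)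

theorem ok_unitEntry {z one k : ℕ} {mem : ℕ → ℝ} (h0 : IsVal k mem z 0)
    (h1 : IsVal k mem one 1) (l : Fin (m + 1)) (p : Fin (N + 1)) :
    Ok h q (unitEntry z one l p) k mem 2 fun r k' mem' =>
      IsVal k' mem' r (allForms h (Pi.single l 1, 0) p) := by
  induction p using Fin.cases with
  | zero => exact .pure h0
  | succ i =>
    simp only [allForms_succ, Hyperplane.form_apply, mul_zero, sub_zero, unitEntry, Fin.cases_succ]
    induction l using Fin.lastCases with
    | last =>
      simp only [Fin.lastCases_last, Pi.single_eq_same]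
      refine .pure ?_
      simpa [Fin.castSucc_ne_last] using h1
    | cast l =>
      simp only [Fin.lastCases_castSucc]
      refine Ok.mono (B := 1 + 1) ((ok_op (x := (h i).slope l) (.slope i l) rfl).bind
        fun a k1 mem1 e1 ha => ?_) le_rfl fun _ _ _ _ h => h
      have := ok_sub (h := h) (q := q) (h0.ext e1) ha
      simpa [Pi.single_apply, (Fin.castSucc_ne_last l).symm] using this

theorem ok_originEntry {z one k : ℕ} {mem : ℕ → ℝ} (h0 : IsVal k mem z 0)
    (h1 : IsVal k mem one 1) (p : Fin (N + 1)) :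
    Ok h q (originEntry z one p) k mem 2 fun r k' mem' =>
      IsVal k' mem' r (allForms h (0, 1) p) := by
  induction p using Fin.cases with
  | zero => exact .pure h1
  | succ i =>
    simp only [allForms_succ, Hyperplane.form_apply, originEntry, Fin.cases_succ]
    refine Ok.mono (B := 1 + 1) ((ok_op (x := (h i).icpt) (.icpt i) rfl).bind
      fun a k1 mem1 e1 ha => ?_) le_rfl fun _ _ _ _ h => h
    have := ok_sub (h := h) (q := q) (h0.ext e1) ha
    simpa using this

/-- The forms of the unit vectors in the list and of the origin, and the forms of the projection of
the query point to these coordinates. -/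
def setup (z one : ℕ) : List (Fin (m + 1)) →
    Prog N m (List (Fin (N + 1) → ℕ) × (Fin (N + 1) → ℕ))
  | [] => do
    let x ← vec (originEntry z one)
    pure ([x], x)
  | l :: ls => do
    let g ← vec (unitEntry z one l)
    let c ← op (.point l)
    let c' ← op (.sub z c)
    let o ← setup z one ls
    let x ← subMul o.2 c' g
    pure (g :: o.1, x)

/-- The vectors that generate the range of `allForms`. -/
def generators (h : Fin N → Hyperplane m) (ls : List (Fin (m + 1))) : List (Fin (N + 1) → ℝ) :=
  ls.map (fun l => allForms h (Pi.single l 1, 0)) ++ [allForms h (0, 1)]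

theorem ok_setup {z one : ℕ} : ∀ {ls : List (Fin (m + 1))} {k : ℕ} {mem : ℕ → ℝ},
    IsVal k mem z 0 → IsVal k mem one 1 →
    Ok h q (setup z one ls) k mem ((ls.length + 1) * ((N + 1) * 4 + 2)) fun o k' mem' =>
      IsVecs k' mem' o.1 (generators h ls) ∧
        IsVec k' mem' o.2 (allForms h ((ls.map fun l => Pi.single l (q l)).sum, 1))
  | [], k, mem, h0, h1 => by
    refine Ok.mono ((ok_vec fun p k' mem' e => ok_originEntry (h0.ext e) (h1.ext e) p).bind
      (B' := 0) fun x k1 mem1 e1 hx => .pure ⟨.cons hx .nil, hx⟩) ?_ fun _ _ _ _ h => h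
    simp only [List.length_nil]
    omega
  | l :: ls, k, mem, h0, h1 => by
    refine Ok.mono (B := (N + 1) * 2 + (1 + (1 + ((ls.length + 1) * ((N + 1) * 4 + 2) +
      ((N + 1) * 2 + 0)))))
      ((ok_vec fun p k' mem' e => ok_unitEntry (h0.ext e) (h1.ext e) l p).bind
        fun g k1 mem1 e1 hg => (ok_op (x := q l) _ rfl).bind fun c k2 mem2 e2 hc =>
        (ok_sub (h0.ext (e1.trans e2)) hc).bind fun c' k3 mem3 e3 hc' =>
        (ok_setup (h0.ext (e1.trans (e2.trans e3))) (h1.ext (e1.trans (e2.trans e3)))).bind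
        fun o k4 mem4 e4 ho => (ok_subMul ho.2 (hc'.ext e4) (hg.ext (e2.trans (e3.trans e4)))).bind
        fun x k5 mem5 e5 hx => .pure ⟨.cons (hg.ext (e2.trans (e3.trans (e4.trans e5))))
          (IsVecs.ext ho.1 e5), ?_⟩) ?_ fun _ _ _ _ h => h
    · rw [List.length_cons]
      simp only [add_mul, one_mul]
      omega
    · have e : ((((l :: ls).map fun l => Pi.single l (q l)).sum, 1) : HVec m) =
          ((ls.map fun l => Pi.single l (q l)).sum, 1) - (0 - q l) • (Pi.single l 1, 0) := by
        ext i
        · simp [Pi.single_apply, add_comm]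
        · simp
      rw [e, map_sub, map_smul]
      exact hx

theorem sum_finRange_single (q : Fin (m + 1) → ℝ) :
    ((List.finRange (m + 1)).map fun l => (Pi.single l (q l) : Fin (m + 1) → ℝ)).sum = q := by
  rw [← List.ofFn_eq_map, List.sum_ofFn, Finset.univ_sum_single]

theorem listSpan_generators (h : Fin N → Hyperplane m) :
    listSpan (generators h (List.finRange (m + 1))) = LinearMap.range (allForms h) := by
  refine le_antisymm (listSpan_le.2 fun g hg => ?_) ?_
  · simp only [generators, List.mem_append, List.mem_map, List.mem_singleton] at hg
    rcases hg with ⟨l, -, rfl⟩ | rfl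
    · exact ⟨_, rfl⟩
    · exact ⟨_, rfl⟩
  · rintro _ ⟨v, rfl⟩
    have e : v = ∑ l, v.1 l • ((Pi.single l 1, 0) : HVec m) + v.2 • ((0, 1) : HVec m) := by
      ext i
      · simp [Prod.fst_sum, Finset.sum_apply, Pi.single_apply]
      · simp [Prod.snd_sum]
    rw [e, map_add, map_sum, map_smul]
    refine Submodule.add_mem _ (Submodule.sum_mem _ fun l _ => ?_) (Submodule.smul_mem _ _ ?_)
    · rw [map_smul]
      exact Submodule.smul_mem _ _ (mem_listSpan (by simp [generators]))
    · exact mem_listSpan (by simp [generators])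

/-- Decompose the vector of the forms of the query point. -/
def locate (N m : ℕ) : Prog N m (List (Round (N + 1))) := do
  let one ← op .one
  let z ← op (.sub one one)
  let o ← setup z one (List.finRange (m + 1))
  decompose (m + 2) o.1 (m + 2) o.2

/-- The number of steps of `locate`, summed over its parts. -/
def locateBound (N m : ℕ) : ℕ :=
  1 + (1 + ((m + 2) * ((N + 1) * 4 + 2) + (m + 2) * ((N + 1) + ((m + 2) * (1 + (N + 1) * 2) +
    ((m + 2) * ((N + 1) * 5 + (1 + ((N + 1) * 2 + (m + 2) * (1 + (N + 1) * 2)))) +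
      ((N + 1) * 5 + (1 + (N + 1) * 2)))))))

/-- The vector of the forms at the query point lies in the range of `allForms`, which has dimension at
most `m + 2`; this bounds the number of summands and the number of entries that a walk makes vanish. -/
theorem ok_locate (h : Fin N → Hyperplane m) (q : Fin (m + 1) → ℝ) (k : ℕ) (mem : ℕ → ℝ) :
    Ok h q (locate N m) k mem (locateBound N m) fun rs _ _ =>
      Decomposes (LinearMap.range (allForms h)) (allForms h (q, 1)) rs ∧ rs.length ≤ m + 2 ∧
        ∀ r ∈ rs, r.2.2.length ≤ m + 2 := by
  refine (ok_op (x := 1) _ rfl).bind fun one k1 mem1 e1 h1 => (ok_sub h1 h1).bind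
    fun z k2 mem2 e2 h0 => ?_
  rw [sub_self] at h0
  refine (Ok.mono (ok_setup h0 (h1.ext e2)) (by simp) fun _ _ _ _ h => h).bind ?_
  rintro o k3 mem3 - ⟨h2, h3⟩
  rw [sum_finRange_single] at h3
  have hlen : (generators h (List.finRange (m + 1))).length = m + 2 := by simp [generators]
  have hX : allForms h (q, 1) ∈ listSpan (generators h (List.finRange (m + 1))) := by
    rw [listSpan_generators]; exact ⟨_, rfl⟩
  have := ok_decompose (h := h) (q := q) h2 (D := m + 2) (by rw [h2.length_eq, hlen]) h3 hX
    (f := m + 2) ?_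
  · rwa [listSpan_generators] at this
  · have hle : supportSpace (listSpan (generators h (List.finRange (m + 1)))) (allForms h (q, 1)) ≤
        LinearMap.range (allForms h) := fun u hu => by
      rw [← listSpan_generators]; exact (mem_supportSpace.1 hu).1
    refine (Submodule.finrank_mono hle).trans ((LinearMap.finrank_range_le _).trans ?_)
    simp [HVec]

end Prog

/-! ### Inference of signs from a sample -/

/-- The index in a sign vector of the entry `p` with respect to the sample `T`; the entry zero is the
hyperplane at infinity. -/
def sampleIndex (T : List ℕ) (p : ℕ) : ℕ := (0 :: T.map (· + 1)).getD p 0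

/-- The descriptions of the vectors of a decomposition. -/
abbrev Label : Type := List (ℕ × SignType × List ℕ)

/-- The descriptions in a decomposition, with indices as natural numbers. -/
def labelOf {M : ℕ} (rs : List (Round M)) : Label :=
  rs.map fun r => ((r.1 : ℕ), r.2.1, r.2.2.map Fin.val)

/-- The sign vector `e` has the described signs: zero at some entries and given at one further entry. -/
def fits (T : List ℕ) (r : ℕ × SignType × List ℕ) (e : List SignType) : Bool :=
  decide (e.getD (sampleIndex T r.1) 0 = r.2.1) &&
    r.2.2.all fun p => decide (e.getD (sampleIndex T p) 0 = 0)

/-- The sign vectors in `L` of the vectors of a decomposition with respect to the sample. -/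
def lookup (L : List (List SignType)) (T : List ℕ) (l : Label) : List (List SignType) :=
  l.map fun r => (L.find? fun e => fits T r e).getD []

/-- The sign of a sum of vectors at `i`, if the vectors do not disagree. -/
def inferSign (es : List (List SignType)) (i : ℕ) : Option SignType :=
  if (es.any fun e => decide (e.getD i 0 = 1)) = true then
    if (es.any fun e => decide (e.getD i 0 = -1)) = true then none else some 1
  else if (es.any fun e => decide (e.getD i 0 = -1)) = true then some (-1) else some 0

/-- Only the zero vector in `L` vanishes on the sample. -/
def spanning (L : List (List SignType)) (T : List ℕ) : Bool :=
  L.all fun e => !((0 :: T.map (· + 1)).all fun i => decide (e.getD i 0 = 0)) ||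
    e.all fun s => decide (s = 0)

/-- The indices of the entries with respect to a sample. -/
def sampleFin {N : ℕ} (T : Fin N → Fin n) : Fin (N + 1) → Fin (n + 1) :=
  Fin.cons 0 fun a => (T a).succ

theorem sample_eq_ofFn {N : ℕ} (T : Fin N → Fin n) :
    0 :: (tupleList T).map (· + 1) = List.ofFn fun p => (sampleFin T p : ℕ) := by
  simp [tupleList, List.ofFn_succ, sampleFin, Function.comp_def]

theorem sampleIndex_eq {N : ℕ} (T : Fin N → Fin n) (p : Fin (N + 1)) :
    sampleIndex (tupleList T) p = sampleFin T p := by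
  rw [sampleIndex, sample_eq_ofFn, List.getD_eq_getElem _ _ (by simp; omega), List.getElem_ofFn]

theorem allForms_sample {N : ℕ} (h : Fin n → Hyperplane m) (T : Fin N → Fin n) (v : HVec m)
    (p : Fin (N + 1)) : allForms (h ∘ T) v p = allForms h v (sampleFin T p) := by
  induction p using Fin.cases with
  | zero => rfl
  | succ a => rfl

theorem signs_getD (h : Fin n → Hyperplane m) (v : HVec m) (i : Fin (n + 1)) :
    (signs h v).getD i 0 = SignType.sign (allForms h v i) := by
  rw [signs, List.getD_eq_getElem _ _ (by simp; omega), List.getElem_ofFn]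

theorem spanning_iff {N : ℕ} {L : List (List SignType)} {T : Fin N → Fin n} :
    spanning L (tupleList T) = true ↔
      ∀ e ∈ L, (∀ p, e.getD (sampleFin T p) 0 = 0) → ∀ s ∈ e, s = 0 := by
  rw [spanning, sample_eq_ofFn]
  simp only [List.all_eq_true, Bool.or_eq_true, Bool.not_eq_true', decide_eq_true_eq,
    ← Bool.not_eq_true, imp_iff_not_or]
  simp only [← imp_iff_not_or, List.forall_mem_ofFn_iff]

theorem signs_all_zero {h : Fin n → Hyperplane m} {v : HVec m} (hv : ∀ s ∈ signs h v, s = 0) :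
    allForms h v = 0 := by
  funext i
  rw [signs, List.forall_mem_ofFn_iff] at hv
  exact sign_eq_zero_iff.1 (hv i)

/-- A vector of minimal support in a subspace that is given by vanishing entries is elementary. -/
theorem exists_elementary {h : Fin n → Hyperplane m} {Z : Set (Fin (n + 1))} {v : HVec m}
    (hv : allForms h v ≠ 0) (hZ : ∀ i ∈ Z, allForms h v i = 0) :
    ∃ u, Elementary h u ∧ ∀ i ∈ Z, allForms h u i = 0 := by
  classical
  let supp : HVec m → ℕ := fun u => (Finset.univ.filter fun i => allForms h u i ≠ 0).card
  obtain ⟨u, ⟨hu, huZ⟩, hmin⟩ := exists_minimalFor_of_wellFoundedLT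
    (fun u => allForms h u ≠ 0 ∧ ∀ i ∈ Z, allForms h u i = 0) supp ⟨v, hv, hZ⟩
  refine ⟨u, ⟨hu, fun w hw => ?_⟩, huZ⟩
  obtain ⟨p, hp⟩ := Function.ne_iff.1 hu
  rw [Pi.zero_apply] at hp
  refine ⟨allForms h w p / allForms h u p, ?_⟩
  rw [← sub_eq_zero, ← map_smul, ← map_sub]
  by_contra hne
  set w' := w - (allForms h w p / allForms h u p) • u with hw'
  have hz : ∀ i, allForms h u i = 0 → allForms h w' i = 0 := fun i hi => by
    rw [hw', map_sub, map_smul, Pi.sub_apply, Pi.smul_apply, hi, hw i hi, smul_zero, sub_zero]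
  have hlt : supp w' < supp u := by
    refine Finset.card_lt_card (Finset.ssubset_iff_subset_ne.2 ⟨fun i hi => ?_, fun he => ?_⟩)
    · rw [Finset.mem_filter] at hi ⊢
      exact ⟨hi.1, fun h0 => hi.2 (hz i h0)⟩
    · have : p ∈ Finset.univ.filter fun i => allForms h u i ≠ 0 := by simp [hp]
      rw [← he, Finset.mem_filter] at this
      refine this.2 ?_
      rw [hw', map_sub, map_smul, Pi.sub_apply, Pi.smul_apply, smul_eq_mul, div_mul_cancel₀ _ hp,
        sub_self]
  exact hlt.not_ge (hmin ⟨hne, fun i hi => hz i (huZ i hi)⟩ hlt.le)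

section

variable {N : ℕ} {h : Fin n → Hyperplane m} {T : Fin N → Fin n}

/-- The forms of a spanning sample determine all forms. -/
theorem allForms_eq_zero_of_spanning (hn : 0 < n)
    (hT : spanning (cocircuits m (orderType h).encodeAux n) (tupleList T) = true) {v : HVec m}
    (hv : allForms (h ∘ T) v = 0) : allForms h v = 0 := by
  by_contra hne
  obtain ⟨u, hu, hZ⟩ := exists_elementary (Z := Set.range (sampleFin T)) hne (by
    rintro _ ⟨p, rfl⟩
    rw [← allForms_sample, hv, Pi.zero_apply])
  have h0 : u.2 = 0 := hZ _ ⟨0, rfl⟩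
  refine hu.1 (signs_all_zero (spanning_iff.1 hT _ (mem_cocircuits hn hu h0.ge) fun p => ?_))
  rw [signs_getD, hZ _ ⟨p, rfl⟩, sign_zero]

/-- The description of a summand with respect to a spanning sample belongs to an elementary vector of the
whole arrangement. Its sign vector is in the list of cocircuits, and it is the only one there that fits. -/
theorem find?_fits (hn : 0 < n)
    (hT : spanning (cocircuits m (orderType h).encodeAux n) (tupleList T) = true) {v : HVec m}
    {r : Round (N + 1)}
    (hr : Describes (LinearMap.range (allForms (h ∘ T))) (allForms (h ∘ T) v) r) (h0 : 0 ≤ v.2) :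
    ((cocircuits m (orderType h).encodeAux n).find? fun e => fits (tupleList T)
      ((r.1 : ℕ), r.2.1, r.2.2.map Fin.val) e).getD [] = signs h v := by
  -- the description determines the vector, also among all vectors
  have key : ∀ u : HVec m, (∀ i ∈ r.2.2, allForms (h ∘ T) u i = 0) →
      allForms h u = (allForms (h ∘ T) u r.1 / allForms (h ∘ T) v r.1) • allForms h v := by
    intro u hu
    rw [← sub_eq_zero, ← map_smul, ← map_sub]
    refine allForms_eq_zero_of_spanning hn hT (hr.unique _ ⟨_, rfl⟩ ?_ fun i hi => ?_)
    · rw [map_sub, map_smul, Pi.sub_apply, Pi.smul_apply, smul_eq_mul, div_mul_cancel₀ _ hr.ne_zero,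
        sub_self]
    · rw [map_sub, map_smul, Pi.sub_apply, Pi.smul_apply, hu i hi, hr.vanish i hi, smul_zero,
        sub_zero]
  have hel : Elementary h v := by
    refine ⟨fun h0 => hr.ne_zero ?_, fun u hu => ⟨_, key u fun i hi => ?_⟩⟩
    · rw [allForms_sample, h0, Pi.zero_apply]
    · rw [allForms_sample]
      refine hu _ ?_
      rw [← allForms_sample]
      exact hr.vanish i hi
  have hfit : ∀ u : HVec m, fits (tupleList T) ((r.1 : ℕ), r.2.1, r.2.2.map Fin.val)
      (signs h u) = true ↔ SignType.sign (allForms (h ∘ T) u r.1) = r.2.1 ∧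
        ∀ i ∈ r.2.2, allForms (h ∘ T) u i = 0 := by
    intro u
    simp only [fits, Bool.and_eq_true, decide_eq_true_eq, List.all_eq_true, List.forall_mem_map,
      sampleIndex_eq, signs_getD, ← allForms_sample, sign_eq_zero_iff]
  obtain ⟨e, he⟩ := Option.isSome_iff_exists.1 (List.find?_isSome.2
    ⟨_, mem_cocircuits hn hel h0, (hfit v).2 ⟨hr.sign, hr.vanish⟩⟩)
  obtain ⟨u, rfl⟩ := cocircuits_sound (List.mem_of_find?_eq_some he)
  have hu := (hfit u).1 (List.find?_some he)
  rw [he, Option.getD_some]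
  have hpos : 0 < allForms (h ∘ T) u r.1 / allForms (h ∘ T) v r.1 := by
    have hs := hu.1.trans hr.sign.symm
    rcases lt_or_gt_of_ne hr.ne_zero with hneg | hpos
    · rw [sign_neg hneg, sign_eq_neg_one_iff] at hs
      exact div_pos_of_neg_of_neg hs hneg
    · rw [sign_pos hpos, sign_eq_one_iff] at hs
      exact div_pos hs hpos
  have e := key u hu.2
  simp only [signs, e, Pi.smul_apply, smul_eq_mul, sign_mul, sign_pos hpos, one_mul]

/-- The decomposition of the forms of the sample lifts to one of all forms, with summands whose sign vectors
are looked up in the list of cocircuits. -/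
theorem exists_sum_of_decomposes (hn : 0 < n)
    (hT : spanning (cocircuits m (orderType h).encodeAux n) (tupleList T) = true)
    {x : Fin (N + 1) → ℝ} {rs : List (Round (N + 1))}
    (hd : Decomposes (LinearMap.range (allForms (h ∘ T))) x rs) : 0 ≤ x 0 →
    ∀ y : HVec m, allForms (h ∘ T) y = x → ∃ vs : List (HVec m),
      lookup (cocircuits m (orderType h).encodeAux n) (tupleList T) (labelOf rs) =
          vs.map (signs h) ∧
        allForms h y = (vs.map fun v => allForms h v).sum ∧
        ∀ v ∈ vs, Conforms (allForms (h ∘ T) v) x := by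
  induction hd with
  | nil =>
    intro _ y hy
    exact ⟨[], rfl, allForms_eq_zero_of_spanning hn hT hy, by simp⟩
  | @cons x V t r rs hr hc ht hc' _ ih =>
    intro h0 y hy
    obtain ⟨v, rfl⟩ := hr.mem
    have hnonneg : ∀ z : Fin (N + 1) → ℝ, Conforms z x → 0 ≤ z 0 := fun z hz => by
      by_contra hlt
      push Not at hlt
      have := hz 0 hlt.ne
      rw [sign_neg hlt, eq_comm, sign_eq_neg_one_iff] at this
      exact this.not_ge h0
    obtain ⟨vs, h1, h2, h3⟩ := ih (hnonneg _ hc') (y - t • v) (by rw [map_sub, map_smul, hy])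
    refine ⟨t • v :: vs, ?_, ?_, ?_⟩
    · rw [List.map_cons, ← h1, signs_smul ht, ← find?_fits hn hT hr (hnonneg _ hc)]
      rfl
    · rw [List.map_cons, List.sum_cons, ← h2, ← map_add, add_sub_cancel]
    · intro u hu
      rcases List.mem_cons.1 hu with rfl | hu
      · intro p hp
        rw [map_smul, Pi.smul_apply, smul_eq_mul] at hp ⊢
        rw [sign_mul, sign_pos ht, one_mul]
        exact hc p (right_ne_zero_of_mul hp)
      · exact (h3 u hu).trans hc'

theorem sum_pos_of_exists {l : List ℝ} (h0 : ∀ x ∈ l, 0 ≤ x) (h1 : ∃ x ∈ l, 0 < x) : 0 < l.sum := by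
  induction l with
  | nil => simp at h1
  | cons a l ih =>
    rw [List.forall_mem_cons] at h0
    rw [List.sum_cons]
    rcases (List.exists_mem_cons_iff ..).1 h1 with h | h
    · exact add_pos_of_pos_of_nonneg h (List.sum_nonneg h0.2)
    · exact add_pos_of_nonneg_of_pos h0.1 (ih h0.2 h)

theorem inferSign_signs {vs : List (HVec m)} {i : Fin (n + 1)} {s : SignType}
    (hs : inferSign (vs.map (signs h)) i = some s) :
    s = SignType.sign ((vs.map fun v => allForms h v).sum i) := by
  have e : (vs.map fun v => allForms h v).sum i = (vs.map fun v => allForms h v i).sum := by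
    clear hs
    induction vs with
    | nil => rfl
    | cons v vs ih => simpa using ih
  have hany : ∀ s : SignType, ((vs.map (signs h)).any fun e => decide (e.getD i 0 = s)) = true ↔
      ∃ v ∈ vs, SignType.sign (allForms h v i) = s := fun s => by
    simp only [List.any_map, List.any_eq_true, Function.comp_apply, signs_getD, decide_eq_true_eq]
  rw [e]
  simp only [inferSign, hany, sign_eq_one_iff, sign_eq_neg_one_iff] at hs
  split_ifs at hs with h1 h2 h2 <;> cases hs
  · push Not at h2
    rw [eq_comm, sign_eq_one_iff]
    exact sum_pos_of_exists (List.forall_mem_map.2 h2) (by simpa using h1)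
  · push Not at h1
    rw [eq_comm, sign_eq_neg_one_iff, ← neg_pos, List.sum_neg, List.map_map]
    exact sum_pos_of_exists (List.forall_mem_map.2 fun v hv => neg_nonneg.2 (h1 v hv)) (by simpa using h2)
  · push Not at h1 h2
    rw [eq_comm, sign_eq_zero_iff]
    exact List.sum_eq_zero (by
      simp only [List.forall_mem_map]
      exact fun v hv => le_antisymm (h1 v hv) (h2 v hv))

/-- Whether the signs that are inferred for the sample disagree. -/
def conflict (T : List ℕ) (es : List (List SignType)) : Bool :=
  (0 :: T.map (· + 1)).any fun i => (inferSign es i).isNone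

/-- At a hyperplane where the signs of the summands do not disagree, the sign of the sum follows. -/
theorem inferSign_of_decomposes (hn : 0 < n)
    (hT : spanning (cocircuits m (orderType h).encodeAux n) (tupleList T) = true)
    {q : Fin (m + 1) → ℝ} {rs : List (Round (N + 1))}
    (hd : Decomposes (LinearMap.range (allForms (h ∘ T))) (allForms (h ∘ T) (q, 1)) rs)
    {i : Fin n} {s : SignType}
    (hs : inferSign (lookup (cocircuits m (orderType h).encodeAux n) (tupleList T) (labelOf rs))
      (i + 1) = some s) : s = (h i).side q := by
  obtain ⟨vs, h1, h2, -⟩ := exists_sum_of_decomposes hn hT hd (by simp [allForms_zero]) _ rfl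
  rw [h1] at hs
  rw [inferSign_signs (i := i.succ) hs, ← h2, Hyperplane.side_eq]
  rfl

/-- The summands conform to the sum at the entries of the sample, so that their signs do not disagree
there. -/
theorem conflict_of_decomposes (hn : 0 < n)
    (hT : spanning (cocircuits m (orderType h).encodeAux n) (tupleList T) = true)
    {q : Fin (m + 1) → ℝ} {rs : List (Round (N + 1))}
    (hd : Decomposes (LinearMap.range (allForms (h ∘ T))) (allForms (h ∘ T) (q, 1)) rs) :
    conflict (tupleList T)
      (lookup (cocircuits m (orderType h).encodeAux n) (tupleList T) (labelOf rs)) = false := by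
  obtain ⟨vs, h1, -, h3⟩ := exists_sum_of_decomposes hn hT hd (by simp [allForms_zero]) _ rfl
  rw [h1, ← Bool.not_eq_true, conflict, sample_eq_ofFn, List.any_eq_true]
  rintro ⟨i, hi, hnone⟩
  rw [List.mem_ofFn] at hi
  obtain ⟨p, rfl⟩ := hi
  have hany : ∀ s : SignType, ((vs.map (signs h)).any
      fun e => decide (e.getD (sampleFin T p) 0 = s)) = true → s ≠ 0 →
        SignType.sign (allForms (h ∘ T) (q, 1) p) = s := by
    intro s hs hs0
    simp only [List.any_map, List.any_eq_true, Function.comp_apply, signs_getD,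
      decide_eq_true_eq, ← allForms_sample] at hs
    obtain ⟨v, hv, rfl⟩ := hs
    exact (h3 v hv p (by simpa using hs0)).symm
  rw [inferSign] at hnone
  split_ifs at hnone with h4 h5 h5
  · exact absurd ((hany _ h4 (by decide)).symm.trans (hany _ h5 (by decide))) (by decide)
  all_goals simp at hnone

end

/-! ### Good samples exist -/

/-- The signs of the hyperplanes that are known so far. -/
abbrev State : Type := List (Option SignType)

/-- The number of hyperplanes whose sign is not known. -/
def unresolved (s : State) : ℕ := (s.filter fun o => o.isNone).length

/-- Add the signs that can be inferred from `es`. -/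
def resolve (es : List (List SignType)) (s : State) : State :=
  (List.range s.length).map fun i => (s.getD i none).elim (inferSign es (i + 1)) some

/-- The outcome `l` for the sample `T` is impossible or resolves half of the hyperplanes. -/
def halves (L : List (List SignType)) (s : State) (T : List ℕ) (l : Label) : Bool :=
  conflict T (lookup L T l) ||
    decide (unresolved (resolve (lookup L T l) s) + unresolved (resolve (lookup L T l) s) ≤
      unresolved s)

/-- Whatever the outcome for the sample `T`, the signs at the summands can be looked up, and at least half
of the unresolved hyperplanes get resolved. -/
def good (ls : List Label) (L : List (List SignType)) (s : State) (T : List ℕ) : Bool :=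
  spanning L T && ls.all fun l => halves L s T l

section Counting

variable {R : Type} [Fintype R] {k : ℕ}

/-- Samples that miss a set of at least half of all elements, although this set depends on few of the
sampled elements, are rare: replacing any of the other elements by partners in the set gives different
samples. -/
theorem card_avoiding (P : Finset (Fin k)) (C : (Fin k → R) → Finset R)
    (hC : ∀ S S', (∀ a ∈ P, S a = S' a) → C S = C S') (bad : Finset (Fin k → R))
    (hb : ∀ S ∈ bad, (∀ a, S a ∉ C S) ∧ Fintype.card R ≤ 2 * (C S).card) :
    bad.card * 2 ^ (k - P.card) ≤ Fintype.card R ^ k := by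
  classical
  have hι : ∀ S ∈ bad, ∃ ι : R → R, (∀ x ∉ C S, ι x ∈ C S) ∧ ∀ x ∉ C S, ∀ y ∉ C S, ι x = ι y → x = y := by
    intro S hS
    have hle : Fintype.card {x // x ∉ C S} ≤ Fintype.card {x // x ∈ C S} := by
      rw [Fintype.card_subtype_compl, Fintype.card_coe]
      have := (hb S hS).2
      omega
    obtain ⟨e⟩ := Function.Embedding.nonempty_of_card_le hle
    refine ⟨fun x => if hx : x ∈ C S then x else e ⟨x, hx⟩, fun x hx => ?_, fun x hx y hy hxy => ?_⟩
    · simp only [hx, dif_neg, not_false_eq_true]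
      exact (e _).2
    · simp only [hx, hy, dif_neg, not_false_eq_true] at hxy
      exact congrArg Subtype.val (e.injective (Subtype.ext hxy))
  have hι' : ∀ Q : Finset R, ∃ ι : R → R, (∃ S ∈ bad, C S = Q) →
      (∀ x ∉ Q, ι x ∈ Q) ∧ ∀ x ∉ Q, ∀ y ∉ Q, ι x = ι y → x = y := by
    intro Q
    by_cases hQ : ∃ S ∈ bad, C S = Q
    · obtain ⟨S, hS, rfl⟩ := hQ
      obtain ⟨ι, h⟩ := hι S hS
      exact ⟨ι, fun _ => h⟩
    · exact ⟨fun x => x, fun h => absurd h hQ⟩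
  choose ι hι using hι'
  let F : bad × ({a // a ∉ P} → Bool) → Fin k → R := fun x a =>
    if ha : a ∈ P then x.1.1 a else if x.2 ⟨a, ha⟩ = true then ι (C x.1.1) (x.1.1 a) else x.1.1 a
  have hF : Function.Injective F := by
    rintro ⟨⟨S, hS⟩, f⟩ ⟨⟨S', hS'⟩, f'⟩ he
    have hP : ∀ a ∈ P, S a = S' a := fun a ha => by
      have := congrFun he a
      simpa only [F, ha, dif_pos] using this
    have hCC := hC S S' hP
    have hboth : ∀ a, ∀ ha : a ∉ P, f ⟨a, ha⟩ = f' ⟨a, ha⟩ ∧ S a = S' a := fun a ha => by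
      have h1 := congrFun he a
      simp only [F, ha, dif_neg, not_false_eq_true] at h1
      have hS1 := (hb S hS).1 a
      have hS2 := (hb S' hS').1 a
      obtain ⟨h2, h3⟩ := hι (C S) ⟨S, hS, rfl⟩
      rw [← hCC] at hS2 h1
      split_ifs at h1 with h4 h5 h5
      · exact ⟨h4.trans h5.symm, h3 _ hS1 _ hS2 h1⟩
      · exact absurd (h1 ▸ h2 _ hS1) hS2
      · exact absurd (h1 ▸ h2 _ hS2) hS1
      · exact ⟨by rw [Bool.not_eq_true] at h4 h5; rw [h4, h5], h1⟩
    have e1 : S = S' := funext fun a => by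
      by_cases ha : a ∈ P
      · exact hP a ha
      · exact (hboth a ha).2
    have e2 : f = f' := funext fun a => (hboth a.1 a.2).1
    subst e1 e2
    rfl
  have := Fintype.card_le_of_injective F hF
  simpa [Fintype.card_prod, Fintype.card_pi, Fintype.card_subtype_compl] using this

/-- A union bound over the indices `l`, by `card_avoiding`: fewer than `2 ^ (k - κ)` sets that depend on at most
`κ` sampled elements each are all hit or small for some sample. -/
theorem exists_hitting_sample [Nonempty R] {ι : Type} [Fintype ι] {κ : ℕ} (P : ι → Finset (Fin k))
    (hP : ∀ l, (P l).card ≤ κ) (C : ι → (Fin k → R) → Finset R)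
    (hC : ∀ l S S', (∀ a ∈ P l, S a = S' a) → C l S = C l S')
    (hι : Fintype.card ι < 2 ^ (k - κ)) :
    ∃ S, ∀ l, (∃ a, S a ∈ C l S) ∨ 2 * (C l S).card ≤ Fintype.card R := by
  classical
  by_contra! hcon
  let bad : ι → Finset (Fin k → R) := fun l =>
    Finset.univ.filter fun S => (∀ a, S a ∉ C l S) ∧ Fintype.card R < 2 * (C l S).card
  have h1 : Fintype.card R ^ k ≤ ∑ l, (bad l).card := by
    have : (Finset.univ : Finset (Fin k → R)) ⊆ Finset.univ.biUnion bad := fun S _ => by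
      obtain ⟨l, hl⟩ := hcon S
      exact Finset.mem_biUnion.2 ⟨l, Finset.mem_univ l, by simpa [bad] using hl⟩
    have := (Finset.card_le_card this).trans Finset.card_biUnion_le
    simpa using this
  have h2 : ∀ l, (bad l).card * 2 ^ (k - κ) ≤ Fintype.card R ^ k := fun l =>
    (Nat.mul_le_mul_left _ (Nat.pow_le_pow_right two_pos (Nat.sub_le_sub_left (hP l) k))).trans
      (card_avoiding (P l) (C l) (hC l) (bad l) fun S hS => by
        simp only [bad, Finset.mem_filter] at hS
        exact ⟨hS.2.1, hS.2.2.le⟩)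
  have h3 : Fintype.card R ^ k * 2 ^ (k - κ) ≤ Fintype.card ι * Fintype.card R ^ k := by
    refine (Nat.mul_le_mul_right _ h1).trans ?_
    rw [Finset.sum_mul]
    refine (Finset.sum_le_sum fun l _ => h2 l).trans ?_
    simp
  have h4 : 0 < Fintype.card R ^ k := Nat.pow_pos Fintype.card_pos
  rw [mul_comm] at h3
  exact absurd (Nat.le_of_mul_le_mul_right h3 h4) hι.not_ge

end Counting

/-! ### Codes of labels as elements of a finite type -/

/-- The entries of a tuple that are present. All lists of length at most `k` arise in this way, and the
tuples form a finite type if the entries do. -/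
def optionList {α : Type} {k : ℕ} (f : Fin k → Option α) : List α := (List.ofFn f).reduceOption

theorem length_optionList {α : Type} {k : ℕ} (f : Fin k → Option α) : (optionList f).length ≤ k :=
  (List.reduceOption_length_le _).trans_eq (List.length_ofFn ..)

theorem exists_optionList {α : Type} : ∀ {k : ℕ} {l : List α}, l.length ≤ k →
    ∃ f : Fin k → Option α, optionList f = l
  | 0, l, hl => ⟨fun _ => none, by simpa [optionList, eq_comm] using hl⟩
  | k + 1, [], _ => ⟨fun _ => none, by simp [optionList, List.reduceOption]⟩
  | k + 1, a :: l, hl => by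
    obtain ⟨f, rfl⟩ := exists_optionList (Nat.le_of_succ_le_succ hl)
    exact ⟨Fin.cons (some a) f, by simp [optionList, List.ofFn_succ]⟩

/-- Codes for the decompositions with at most `D` summands that refer to at most `D` zero entries each. -/
abbrev LabelCode (M D : ℕ) : Type := Fin D → Option (Fin M × SignType × (Fin D → Option (Fin M)))

/-- The decomposition with the given code. -/
def LabelCode.decode {M D : ℕ} (c : LabelCode M D) : List (Round M) :=
  (optionList c).map fun r => (r.1, r.2.1, optionList r.2.2)

theorem LabelCode.exists_decode {M D : ℕ} {rs : List (Round M)} (h1 : rs.length ≤ D)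
    (h2 : ∀ r ∈ rs, r.2.2.length ≤ D) : ∃ c : LabelCode M D, c.decode = rs := by
  have : ∃ l : List (Fin M × SignType × (Fin D → Option (Fin M))),
      (l.map fun r => (r.1, r.2.1, optionList r.2.2)) = rs := by
    clear h1
    induction rs with
    | nil => exact ⟨[], rfl⟩
    | cons r rs ih =>
      rw [List.forall_mem_cons] at h2
      obtain ⟨l, rfl⟩ := ih h2.2
      obtain ⟨f, hf⟩ := exists_optionList h2.1
      exact ⟨(r.1, r.2.1, f) :: l, by simp [hf]⟩
  obtain ⟨l, rfl⟩ := this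
  rw [List.length_map] at h1
  obtain ⟨c, rfl⟩ := exists_optionList h1
  exact ⟨c, rfl⟩

theorem LabelCode.card_le {M D b : ℕ} (hM : M + 1 ≤ 2 ^ b) :
    Fintype.card (LabelCode M D) ≤ 2 ^ ((b * (D + 1) + 2) * D) := by
  have h3 : Fintype.card SignType = 3 := rfl
  rw [Fintype.card_fun, Fintype.card_option, Fintype.card_prod, Fintype.card_prod, Fintype.card_fun,
    Fintype.card_option, Fintype.card_fin, Fintype.card_fin, h3, pow_mul]
  refine Nat.pow_le_pow_left ?_ D
  have h1 : (M + 1) * (M + 1) ^ D ≤ 2 ^ (b * (D + 1)) := by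
    rw [← pow_succ', pow_mul]
    exact Nat.pow_le_pow_left hM _
  have h2 : 0 < (M + 1) ^ D := Nat.pow_pos (Nat.succ_pos M)
  rw [pow_add]
  nlinarith

/-- The positions of the sample that the outcome refers to. -/
def Label.used (l : Label) : List ℕ := l.flatMap fun r => r.1 :: r.2.2

theorem LabelCode.length_used {M D : ℕ} (c : LabelCode M D) :
    (labelOf c.decode).used.length ≤ D * (D + 1) := by
  have : ∀ l : List (Fin M × SignType × (Fin D → Option (Fin M))),
      (labelOf (l.map fun r => (r.1, r.2.1, optionList r.2.2))).used.length ≤ l.length * (D + 1) := by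
    intro l
    induction l with
    | nil => simp [Label.used, labelOf]
    | cons r l ih =>
      have := length_optionList r.2.2
      simp only [Label.used, labelOf, List.map_cons, List.flatMap_cons, List.length_append,
        List.length_cons, List.length_map, add_mul, one_mul] at ih ⊢
      omega
  exact (this _).trans (Nat.mul_le_mul_right _ (length_optionList c))

theorem used_lt {M : ℕ} (rs : List (Round M)) : ∀ p ∈ (labelOf rs).used, p < M := by
  intro p hp
  simp only [Label.used, labelOf, List.mem_flatMap, List.mem_map] at hp
  obtain ⟨_, ⟨r, -, rfl⟩, hp⟩ := hp
  rcases List.mem_cons.1 hp with rfl | hp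
  · exact r.1.2
  · obtain ⟨i, -, rfl⟩ := List.mem_map.1 hp
    exact i.2

theorem lookup_congr {L : List (List SignType)} {T T' : List ℕ} {l : Label}
    (hT : ∀ p ∈ l.used, sampleIndex T p = sampleIndex T' p) : lookup L T l = lookup L T' l := by
  refine List.map_congr_left fun r hr => ?_
  have hr' : ∀ p ∈ r.1 :: r.2.2, sampleIndex T p = sampleIndex T' p := fun p hp =>
    hT p (List.mem_flatMap.2 ⟨r, hr, hp⟩)
  rw [List.forall_mem_cons] at hr'
  have : (fun e => fits T r e) = fun e => fits T' r e := funext fun e => by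
    rw [fits, fits, hr'.1]
    congr 1
    rw [Bool.eq_iff_iff, List.all_eq_true, List.all_eq_true]
    exact forall₂_congr fun p hp => by rw [hr'.2 p hp]
  rw [this]

/-! ### Halving the number of unresolved hyperplanes -/

theorem card_unresolved (s : State) :
    Fintype.card {i : Fin s.length // s.getD i none = none} = unresolved s := by
  rw [Fintype.card_subtype, Finset.card_filter]
  induction s with
  | nil => rfl
  | cons o s ih =>
    rw [List.length_cons, Fin.sum_univ_succ]
    simp only [Fin.val_zero, List.getD_cons_zero, Fin.val_succ, List.getD_cons_succ, ih]
    cases o <;> simp [unresolved, add_comm]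

theorem length_resolve (es : List (List SignType)) (s : State) : (resolve es s).length = s.length := by
  simp [resolve]

theorem resolve_getD {es : List (List SignType)} {s : State} {i : ℕ} (hi : i < s.length) :
    (resolve es s).getD i none = (s.getD i none).elim (inferSign es (i + 1)) some := by
  rw [List.getD_eq_getElem _ _ (by rwa [length_resolve])]
  simp [resolve]

theorem unresolved_resolve (es : List (List SignType)) (s : State) : unresolved (resolve es s) =
    (Finset.univ.filter fun i : {i : Fin s.length // s.getD i none = none} =>
      inferSign es (i.1 + 1) = none).card := by
  classical
  rw [← card_unresolved, ← Fintype.card_subtype]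
  refine Fintype.card_congr (Equiv.symm ?_)
  refine (Equiv.subtypeSubtypeEquivSubtypeInter (fun i : Fin s.length => s.getD i none = none)
    fun i => inferSign es (i + 1) = none).trans ?_
  refine (finCongr (length_resolve es s).symm).subtypeEquiv fun i => ?_
  rw [finCongr_apply, Fin.val_cast, resolve_getD i.2]
  cases s.getD i none <;> simp

/-- A few hyperplanes determine all forms. -/
theorem exists_spanning (h : Fin n → Hyperplane m) (hn : 0 < n) : ∃ B : Fin (m + 2) → Fin n,
    ∀ v : HVec m, v.2 = 0 → (∀ a, (h (B a)).form v = 0) → allForms h v = 0 := by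
  obtain ⟨K, hK⟩ := (LinearMap.ker (allForms h)).exists_isCompl
  set K' := K ⊓ LinearMap.ker (LinearMap.snd ℝ (Fin (m + 1) → ℝ) ℝ) with hK'
  obtain ⟨I, hI⟩ := exists_separating_subfamily (fun i : Fin n => (h i).form) _ K' rfl
    fun y hy hall => by
      have : y ∈ LinearMap.ker (allForms h) ⊓ K :=
        ⟨allForms_eq_iff.2 ⟨LinearMap.mem_ker.1 hy.2, hall⟩, hy.1⟩
      rwa [hK.inf_eq_bot, Submodule.mem_bot] at this
  have hdim : Module.finrank ℝ K' ≤ m + 2 := (Submodule.finrank_le K').trans (by simp)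
  refine ⟨fun a => if ha : (a : ℕ) < Module.finrank ℝ K' then I ⟨a, ha⟩ else ⟨0, hn⟩,
    fun v hv0 hv => ?_⟩
  obtain ⟨b, hb, y, hy, rfl⟩ := Submodule.mem_sup.1 (hK.sup_eq_top ▸ Submodule.mem_top : v ∈ _ ⊔ _)
  have hb' := allForms_eq_iff.1 (LinearMap.mem_ker.1 hb)
  have hy0 : y = 0 := by
    refine hI y ⟨hy, ?_⟩ fun a => ?_
    · have h1 : b.2 + y.2 = 0 := hv0
      rw [hb'.1, Pi.zero_apply, zero_add] at h1
      exact h1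
    · have h1 := hv ⟨a, a.2.trans_le hdim⟩
      simpa [hb'.2] using h1
  rw [hy0, add_zero]
  exact hb

/-- The size of the samples. -/
abbrev sampleSize (m : ℕ) : ℕ := (m + 4) ^ 4 + (m + 2)

theorem labelCode_card_lt (m : ℕ) : Fintype.card (LabelCode (sampleSize m + 1) (m + 2)) <
    2 ^ ((m + 4) ^ 4 - (m + 2) * (m + 3)) := by
  have hb : sampleSize m + 1 + 1 ≤ 2 ^ (4 * (m + 4) + 1) := by
    have h1 : (m + 4) ^ 4 ≤ 2 ^ (4 * (m + 4)) := by
      rw [mul_comm, pow_mul]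
      exact Nat.pow_le_pow_left Nat.lt_two_pow_self.le 4
    have h2 : m + 4 ≤ (m + 4) ^ 4 := Nat.le_self_pow (by norm_num) _
    rw [sampleSize, pow_succ 2 (4 * (m + 4))]
    omega
  refine (LabelCode.card_le hb).trans_lt (Nat.pow_lt_pow_right (by norm_num) ?_)
  rw [Nat.lt_sub_iff_add_lt]
  ring_nf
  nlinarith

/-- A sample with two parts is good: some of its members span the forms, and the others, chosen by
`exists_hitting_sample` among the unresolved hyperplanes, hit the unresolved hyperplanes that an
outcome leaves open whenever these are more than half. A member that an outcome leaves open makes the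
outcome conflicting, hence impossible. -/
theorem exists_good {h : Fin n → Hyperplane m} (hn : 0 < n) {s : State} (hs : s.length = n)
    (hu : 0 < unresolved s) {ls : List Label} (hls : ∀ l ∈ ls,
      ∃ rs : List (Round (sampleSize m + 1)), l = labelOf rs ∧ rs.length ≤ m + 2 ∧
        ∀ r ∈ rs, r.2.2.length ≤ m + 2) :
    ∃ T : Fin (sampleSize m) → Fin n,
      good ls (cocircuits m (orderType h).encodeAux n) s (tupleList T) = true := by
  classical
  subst hs
  obtain ⟨B, hB⟩ := exists_spanning h hn
  set L := cocircuits m (orderType h).encodeAux s.length with hL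
  let R := {i : Fin s.length // s.getD i none = none}
  have hR : Fintype.card R = unresolved s := card_unresolved s
  have : Nonempty R := Fintype.card_pos_iff.1 (by rw [hR]; exact hu)
  let tup : (Fin ((m + 4) ^ 4) → R) → Fin (sampleSize m) → Fin s.length := fun S =>
    Fin.append (fun a => (S a).1) B
  obtain ⟨S, hS⟩ := exists_hitting_sample (R := R) (ι := LabelCode (sampleSize m + 1) (m + 2))
    (κ := (m + 2) * (m + 3)) (k := (m + 4) ^ 4)
    (fun c => Finset.univ.filter fun a => (a : ℕ) + 1 ∈ (labelOf c.decode).used) (fun c => by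
      refine le_trans ?_ c.length_used
      refine le_trans ?_ (List.toFinset_card_le _)
      refine Finset.card_le_card_of_injOn (fun a => (a : ℕ) + 1) (fun a ha => ?_) fun a _ b _ hab => ?_
      · simpa using ha
      · exact Fin.ext (Nat.succ_injective hab))
    (fun c S => Finset.univ.filter fun i : R =>
      inferSign (lookup L (tupleList (tup S)) (labelOf c.decode)) (i.1 + 1) = none)
    (fun c S S' hSS => by
      have : lookup L (tupleList (tup S)) (labelOf c.decode) =
          lookup L (tupleList (tup S')) (labelOf c.decode) := by
        refine lookup_congr fun p hp => ?_
        obtain ⟨p, rfl⟩ : ∃ p' : Fin (sampleSize m + 1), p = p' := ⟨⟨p, used_lt _ p hp⟩, rfl⟩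
        rw [sampleIndex_eq, sampleIndex_eq]
        induction p using Fin.cases with
        | zero => rfl
        | succ a =>
          simp only [sampleFin, Fin.cons_succ, tup]
          congr 2
          induction a using Fin.addCases with
          | left a =>
            rw [Fin.append_left, Fin.append_left, hSS a (Finset.mem_filter.2 ⟨Finset.mem_univ a, hp⟩)]
          | right a => rw [Fin.append_right, Fin.append_right]
      simp only [this]) (labelCode_card_lt m)
  refine ⟨tup S, ?_⟩
  rw [good, Bool.and_eq_true, spanning_iff, List.all_eq_true]
  constructor
  · intro e he hz
    obtain ⟨v, rfl⟩ := cocircuits_sound he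
    have hv : allForms h v = 0 := hB v
        (by
          have := hz 0
          rwa [signs_getD, sign_eq_zero_iff] at this)
        fun a => by
          have := hz (Fin.natAdd ((m + 4) ^ 4) a).succ
          rw [signs_getD, sign_eq_zero_iff, sampleFin, Fin.cons_succ, allForms_succ] at this
          simpa only [tup, Fin.append_right] using this
    intro t ht
    rw [signs, hv, List.mem_ofFn] at ht
    obtain ⟨i, rfl⟩ := ht
    exact sign_zero
  · intro l hl
    obtain ⟨rs, rfl, h1, h2⟩ := hls l hl
    obtain ⟨c, rfl⟩ := LabelCode.exists_decode h1 h2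
    rw [halves, Bool.or_eq_true, decide_eq_true_eq]
    rcases hS c with ⟨a, ha⟩ | hle
    · left
      rw [conflict, sample_eq_ofFn, List.any_eq_true]
      refine ⟨_, (List.mem_ofFn ..).2 ⟨(Fin.castAdd (m + 2) a).succ, rfl⟩, ?_⟩
      rw [sampleFin, Fin.cons_succ, Option.isNone_iff_eq_none]
      simp only [tup, Fin.append_left]
      exact (Finset.mem_filter.1 ha).2
    · right
      rw [unresolved_resolve, ← hR, ← two_mul]
      exact hle

/-! ### The search tree -/

/-- The operation with the hyperplanes of a sample in place of its hyperplanes. -/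
def RealOp.rename {N : ℕ} (T : Fin N → Fin n) : RealOp N m → RealOp n m
  | .one => .one
  | .point j => .point j
  | .slope i j => .slope (T i) j
  | .icpt i => .icpt (T i)
  | .add a b => .add a b
  | .sub a b => .sub a b
  | .mul a b => .mul a b
  | .div a b => .div a b

theorem RealOp.value_rename {N : ℕ} (T : Fin N → Fin n) (h : Fin n → Hyperplane m)
    (q : Fin (m + 1) → ℝ) (mem : ℕ → ℝ) (op : RealOp N m) :
    (op.rename T).value h q mem = op.value (h ∘ T) q mem := by
  cases op <;> rfl

namespace Gadget

variable {N : ℕ} {α β : Type}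

/-- The results at the leaves, whether or not they can be reached. -/
def leaves : Gadget N m α → List α
  | ret a => [a]
  | compute _ _ next => next.leaves
  | branch _ a b c => a.leaves ++ (b.leaves ++ c.leaves)

theorem exec_mem_leaves (h : Fin N → Hyperplane m) (q : Fin (m + 1) → ℝ) (G : Gadget N m α)
    (mem : ℕ → ℝ) : (G.exec h q mem).1 ∈ G.leaves := by
  induction G generalizing mem with
  | ret a => simp [exec, leaves]
  | compute r op next ih => exact ih _
  | branch r a b c iha ihb ihc =>
    simp only [exec, leaves, List.mem_append]
    split_ifs
    · exact .inl (iha _)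
    · exact .inr (.inl (ihb _))
    · exact .inr (.inr (ihc _))

theorem leaves_bind (G : Gadget N m α) (f : α → Gadget N m β) :
    (G.bind f).leaves = G.leaves.flatMap fun a => (f a).leaves := by
  induction G with
  | ret a => simp [leaves, bind]
  | compute r op next ih => exact ih
  | branch r a b c iha ihb ihc => simp [leaves, bind, iha, ihb, ihc]

/-- Run the gadget on the hyperplanes of a sample and continue with the trees given by `f`. -/
def instantiate (T : Fin N → Fin n) : Gadget N m α → (α → SearchTree n m) → SearchTree n m
  | ret a, f => f a
  | compute r op next, f => .compute r (op.rename T) (next.instantiate T f)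
  | branch r a b c, f => .branch r (a.instantiate T f) (b.instantiate T f) (c.instantiate T f)

theorem run_instantiate (h : Fin n → Hyperplane m) (q : Fin (m + 1) → ℝ) (T : Fin N → Fin n)
    (G : Gadget N m α) (f : α → SearchTree n m) (mem : ℕ → ℝ) : (G.instantiate T f).run h q mem =
      let o := G.exec (h ∘ T) q mem
      let o' := (f o.1).run h q o.2.1
      (o'.1, o'.2 + o.2.2) := by
  induction G generalizing mem with
  | ret a => rfl
  | compute r op next ih =>
    simp only [instantiate, SearchTree.run, exec, ih, RealOp.value_rename, add_assoc]
  | branch r a b c iha ihb ihc =>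
    simp only [instantiate, SearchTree.run, exec]
    split_ifs <;> simp only [iha, ihb, ihc, add_assoc]

end Gadget

/-- The gadget that decomposes the query point with respect to a sample. -/
def locator (m : ℕ) : Gadget (sampleSize m) m Label :=
  (Prog.locate (sampleSize m) m 0).bind fun o => .ret (labelOf o.1)

/-- The outcomes of `locator` that can occur. -/
def outcomes (m : ℕ) : List Label :=
  (locator m).leaves.filter fun l =>
    decide (l.length ≤ m + 2) && l.all fun r => decide (r.2.2.length ≤ m + 2)

theorem exists_of_mem_outcomes {l : Label} (hl : l ∈ outcomes m) :
    ∃ rs : List (Round (sampleSize m + 1)), l = labelOf rs ∧ rs.length ≤ m + 2 ∧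
      ∀ r ∈ rs, r.2.2.length ≤ m + 2 := by
  rw [outcomes, List.mem_filter, locator, Gadget.leaves_bind, List.mem_flatMap] at hl
  obtain ⟨⟨o, -, ho⟩, hb⟩ := hl
  rw [Gadget.leaves, List.mem_singleton] at ho
  subst ho
  refine ⟨o.1, rfl, ?_⟩
  simpa [labelOf] using hb

theorem exec_locator (h : Fin (sampleSize m) → Hyperplane m) (q : Fin (m + 1) → ℝ) (mem : ℕ → ℝ) :
    ∃ rs : List (Round (sampleSize m + 1)), ((locator m).exec h q mem).1 = labelOf rs ∧
      labelOf rs ∈ outcomes m ∧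
      Decomposes (LinearMap.range (allForms h)) (allForms h (q, 1)) rs ∧
      ((locator m).exec h q mem).2.2 ≤ Prog.locateBound (sampleSize m) m := by
  obtain ⟨⟨h1, h2, h3⟩, -, h4⟩ := Prog.ok_locate h q 0 mem
  have e : (locator m).exec h q mem =
      (labelOf ((Prog.locate (sampleSize m) m 0).exec h q mem).1.1,
        ((Prog.locate (sampleSize m) m 0).exec h q mem).2.1,
        ((Prog.locate (sampleSize m) m 0).exec h q mem).2.2) := by
    rw [locator, Gadget.exec_bind]
    simp [Gadget.exec]
  refine ⟨_, congrArg Prod.fst e, ?_, h1, by rw [e]; exact h4⟩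
  rw [outcomes, List.mem_filter]
  refine ⟨?_, by simpa [labelOf] using ⟨h2, fun _ _ _ hr => h3 _ hr⟩⟩
  have := (locator m).exec_mem_leaves h q mem
  rwa [e] at this

/-- The first good sample in an exhaustive search, if there is one. -/
def chooseSample (m : ℕ) (L : List (List SignType)) (s : State) : Option (List ℕ) :=
  (tuples s.length (sampleSize m)).find? fun T => good (outcomes m) L s T

/-- A list of indices as a tuple; the reduction modulo `n` has no effect on indices below `n`. -/
def toTuple [NeZero n] (N : ℕ) (T : List ℕ) : Fin N → Fin n := fun a => Fin.ofNat n (T.getD a 0)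

theorem toTuple_tupleList [NeZero n] {N : ℕ} (T : Fin N → Fin n) : toTuple N (tupleList T) = T := by
  funext a
  simp [toTuple, tupleList]

/-- The face that a state stands for; hyperplanes whose sign is not known count as zero. -/
def faceOf (s : State) : Fin n → SignType := fun i => (s.getD i none).getD 0

/-- The search tree of depth `k`, in units of gadgets, for a query in the state `s`. -/
def buildTree [NeZero n] (L : List (List SignType)) : ℕ → State → SearchTree n m
  | 0, s => .leaf (faceOf s)
  | k + 1, s => (chooseSample m L s).elim (.leaf (faceOf s)) fun T =>
      (locator m).instantiate (toTuple _ T) fun l => buildTree L k (resolve (lookup L T l) s)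

/-- The signs in the state are those of `q`. -/
def State.Correct (h : Fin n → Hyperplane m) (q : Fin (m + 1) → ℝ) (s : State) : Prop :=
  s.length = n ∧ ∀ (i : Fin n) (t : SignType), s.getD i none = some t → t = (h i).side q

theorem getD_ne_none_of_unresolved {s : State} (hs : unresolved s = 0) {i : ℕ} (hi : i < s.length) :
    s.getD i none ≠ none := by
  rw [← card_unresolved, Fintype.card_eq_zero_iff] at hs
  exact fun h => hs.elim ⟨⟨i, hi⟩, h⟩

theorem State.Correct.faceOf_eq {h : Fin n → Hyperplane m} {q : Fin (m + 1) → ℝ} {s : State}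
    (hs : s.Correct h q) (hu : unresolved s = 0) : faceOf s = fun i => (h i).side q := by
  funext i
  obtain ⟨t, ht⟩ := Option.ne_none_iff_exists'.1
    (getD_ne_none_of_unresolved hu (i := i) (hs.1.symm ▸ i.2))
  rw [faceOf, ht, Option.getD_some]
  exact hs.2 i t ht

/-- Each level halves the number of unresolved hyperplanes, since there is a good sample as long as this
number is positive. -/
theorem run_buildTree [NeZero n] {h : Fin n → Hyperplane m} {q : Fin (m + 1) → ℝ} :
    ∀ {k : ℕ} {s : State} {mem : ℕ → ℝ}, s.Correct h q → unresolved s < 2 ^ k →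
      ((buildTree (cocircuits m (orderType h).encodeAux n) k s).run h q mem).1 =
          (fun i => (h i).side q) ∧
        ((buildTree (cocircuits m (orderType h).encodeAux n) k s).run h q mem).2 ≤
          k * Prog.locateBound (sampleSize m) m + 1
  | 0, s, mem, hs, hu => ⟨hs.faceOf_eq (by simpa using hu), by simp [buildTree, SearchTree.run]⟩
  | k + 1, s, mem, hs, hu => by
    have hn : 0 < n := Nat.pos_of_neZero n
    rw [buildTree]
    cases hc : chooseSample m (cocircuits m (orderType h).encodeAux n) s with
    | none =>
      have hu0 : unresolved s = 0 := by
        by_contra hne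
        obtain ⟨T, hT⟩ := exists_good hn hs.1 (Nat.pos_of_ne_zero hne)
          (h := h) (ls := outcomes m) fun l hl => exists_of_mem_outcomes hl
        rw [chooseSample, List.find?_eq_none] at hc
        refine hc _ ?_ hT
        rw [hs.1]
        exact mem_tuples.2 ⟨T, rfl⟩
      exact ⟨hs.faceOf_eq hu0, by simp [SearchTree.run]⟩
    | some T =>
      have hT := List.mem_of_find?_eq_some hc
      rw [hs.1] at hT
      obtain ⟨T, rfl⟩ := mem_tuples.1 hT
      have hg := List.find?_some hc
      rw [good, Bool.and_eq_true, List.all_eq_true] at hg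
      rw [Option.elim_some, Gadget.run_instantiate, toTuple_tupleList]
      obtain ⟨rs, h1, h2, h3, h4⟩ := exec_locator (h ∘ T) q mem
      simp only [h1]
      have hh := hg.2 _ h2
      rw [halves, conflict_of_decomposes hn hg.1 h3, Bool.false_or, decide_eq_true_eq] at hh
      have hcor : State.Correct h q (resolve (lookup (cocircuits m (orderType h).encodeAux n)
          (tupleList T) (labelOf rs)) s) := by
        refine ⟨(length_resolve _ _).trans hs.1, fun i t ht => ?_⟩
        rw [resolve_getD (hs.1.symm ▸ i.2)] at ht
        cases hi : s.getD i none with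
        | some t' =>
          rw [hi, Option.elim_some] at ht
          exact hs.2 i t (hi.trans ht)
        | none =>
          rw [hi, Option.elim_none] at ht
          exact inferSign_of_decomposes hn hg.1 h3 ht
      obtain ⟨h5, h6⟩ := run_buildTree (k := k) (mem := ((locator m).exec (h ∘ T) q mem).2.1) hcor
        (by rw [pow_succ] at hu; omega)
      exact ⟨h5, by rw [add_mul, one_mul]; omega⟩

/-- The pairs `(2 ^ k, k)`, up to the first power of two above `n`. -/
def doubling (n : ℕ) (p : ℕ × ℕ) : ℕ × ℕ := if decide (p.1 ≤ n) = true then (p.1 + p.1, p.2 + 1) else p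

/-- The depth of the tree: the least `k` such that `n < 2 ^ k`. -/
def depth (n : ℕ) : ℕ := ((doubling n)^[n] (1, 0)).2

theorem doubling_spec (n k : ℕ) : let p := (doubling n)^[k] (1, 0)
    p.1 = 2 ^ p.2 ∧ p.2 ≤ k ∧ (n < p.1 ∨ p.2 = k) ∧ p.1 ≤ 2 * n + 1 := by
  induction k with
  | zero => simp
  | succ k ih =>
    rw [Function.iterate_succ_apply']
    obtain ⟨h1, h2, h3, h4⟩ := ih
    set p := (doubling n)^[k] (1, 0)
    simp only [doubling, decide_eq_true_eq]
    split_ifs with h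
    · exact ⟨by rw [pow_succ, ← h1, mul_two], by simpa, .inr (by simp; omega), by simp; omega⟩
    · exact ⟨h1, h2.trans k.le_succ, .inl (by omega), h4⟩

theorem lt_two_pow_depth (n : ℕ) : n < 2 ^ depth n := by
  obtain ⟨h1, h2, h3, h4⟩ := doubling_spec n n
  rw [depth, ← h1]
  rcases h3 with h3 | h3
  · exact h3
  · rw [h1, h3]
    exact Nat.lt_two_pow_self

theorem two_pow_depth_le (n : ℕ) : 2 ^ depth n ≤ 2 * n + 1 := by
  obtain ⟨h1, h2, h3, h4⟩ := doubling_spec n n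
  rw [depth, ← h1]
  exact h4

/-- The state in which no sign is known. -/
def initialState (n : ℕ) : State := List.replicate n none

theorem initialState_correct (h : Fin n → Hyperplane m) (q : Fin (m + 1) → ℝ) :
    (initialState n).Correct h q := by
  refine ⟨List.length_replicate .., fun i t ht => ?_⟩
  simp [initialState] at ht

theorem unresolved_le_length (s : State) : unresolved s ≤ s.length := List.length_filter_le _ _

/-- The search structure that is built from the representation `x` of an order type. -/
def searchStructure (n m : ℕ) (x : SExp) : SearchTree n m :=
  if hn : n = 0 then .leaf fun _ => 0
  else
    haveI : NeZero n := ⟨hn⟩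
    buildTree (cocircuits m x n) (depth n) (initialState n)

theorem run_searchStructure (h : Fin n → Hyperplane m) (q : Fin (m + 1) → ℝ) (mem : ℕ → ℝ) :
    ((searchStructure n m (orderType h).encodeAux).run h q mem).1 = (fun i => (h i).side q) ∧
      ((searchStructure n m (orderType h).encodeAux).run h q mem).2 ≤
        depth n * Prog.locateBound (sampleSize m) m + 1 := by
  rw [searchStructure]
  split_ifs with hn
  · subst hn
    exact ⟨funext fun i => i.elim0, by simp [SearchTree.run]⟩
  · have : NeZero n := ⟨hn⟩
    exact run_buildTree (initialState_correct h q) (((unresolved_le_length _).trans_eq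
      (List.length_replicate ..)).trans_lt (lt_two_pow_depth n))

theorem depth_le_log (n : ℕ) : (depth n : ℝ) ≤ 4 * Real.log (n + 2) := by
  have h1 : (2 : ℝ) ^ depth n ≤ 2 * n + 1 := by exact_mod_cast two_pow_depth_le n
  have h2 : (2 : ℝ) ^ depth n ≤ (n + 2) ^ 2 := h1.trans (by nlinarith [(Nat.cast_nonneg n : (0 : ℝ) ≤ n)])
  have h3 := Real.log_le_log (by positivity) h2
  rw [Real.log_pow, Real.log_pow] at h3
  have h4 := Real.log_two_gt_d9
  have h5 : 0 ≤ (depth n : ℝ) := Nat.cast_nonneg _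
  push_cast at h3
  nlinarith

theorem one_le_log (n : ℕ) : (1 : ℝ) ≤ 2 * Real.log (n + 2) := by
  have h1 : Real.log 2 ≤ Real.log (n + 2) :=
    Real.log_le_log two_pos (by linarith [(Nat.cast_nonneg n : (0 : ℝ) ≤ n)])
  linarith [Real.log_two_gt_d9]

/-- The query time is polynomial in the dimension. -/
theorem exists_locateBound_le : ∃ K : ℕ, ∀ m : ℕ,
    4 * Prog.locateBound (sampleSize m) m + 2 ≤ K * (m + 1) ^ K := by
  have hm : PolyBdd fun m : ℕ => m := PolyBdd.size.mono fun m => by rw [esize_nat]; omega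
  have hN : PolyBdd fun m : ℕ => sampleSize m :=
    ((hm.add (.const 4)).pow 4).add (hm.add (.const 2))
  have hD := hm.add (.const 2)
  have hM := hN.add (.const 1)
  have hall : PolyBdd fun m : ℕ => 4 * Prog.locateBound (sampleSize m) m + 2 := by
    have c := fun k => PolyBdd.const (α := ℕ) k
    refine ((c 4).mul ?_).add (c 2)
    unfold Prog.locateBound
    exact (c 1).add ((c 1).add ((hD.mul ((hM.mul (c 4)).add (c 2))).add (hD.mul (hM.add
      ((hD.mul ((c 1).add (hM.mul (c 2)))).add ((hD.mul ((hM.mul (c 5)).add ((c 1).add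
        ((hM.mul (c 2)).add (hD.mul ((c 1).add (hM.mul (c 2)))))))).add
          ((hM.mul (c 5)).add ((c 1).add (hM.mul (c 2))))))))))
  obtain ⟨c, hc⟩ := hall
  refine ⟨c * 2 ^ c, fun m => (hc m).trans ?_⟩
  have e : esize m + 1 = 2 * (m + 1) := by rw [esize_nat]; ring
  rw [e, mul_pow, ← mul_assoc]
  exact Nat.mul_le_mul_left _ (Nat.pow_le_pow_right (Nat.succ_pos m)
    (Nat.le_mul_of_pos_right _ (by positivity)))

/-! ### The preprocessing runs in polynomial time -/

namespace PolyTime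

open Enc

variable {α : Type} [Enc α]

theorem lineTbl {x : α → SExp} (hx : PolyTime x) : ∀ m, PolyTime fun a => lineTbl m (x a)
  | 0 => hx
  | _ + 1 => hx.sexp_fst

theorem foldl_nth {x : α → SExp} {I : α → List ℕ} (hx : PolyTime x) (hI : PolyTime I) :
    PolyTime fun a => (I a).foldl SExp.nth (x a) := by
  refine foldl (f := fun _ => SExp.nth) hI hx (PolyTime.snd.fst'.nth PolyTime.snd.snd') hx.bdd
    fun a k => ?_
  have : ∀ (l : List ℕ) (y : SExp), esize (l.foldl SExp.nth y) ≤ esize y := by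
    intro l
    induction l with
    | nil => exact fun y => le_rfl
    | cons i l ih => exact fun y => (ih _).trans (SExp.size_nth y i)
  exact this _ _

theorem isLineB {t : α → SExp} {I : α → List ℕ} (ht : PolyTime t) (hI : PolyTime I) :
    PolyTime fun a => isLineB (t a) (I a) := (foldl_nth ht.sexp_fst hI).truthy

theorem leB {t : α → SExp} {I : α → List ℕ} {i j : α → ℕ} (ht : PolyTime t) (hI : PolyTime I)
    (hi : PolyTime i) (hj : PolyTime j) : PolyTime fun a => leB (t a) (I a) (i a) (j a) :=
  (((foldl_nth ht.sexp_snd hI).nth hi).nth hj).truthy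

theorem signFrom {t : α → SExp} {I : α → List ℕ} {i j : α → ℕ} {s : α → SignType} (ht : PolyTime t)
    (hI : PolyTime I) (hi : PolyTime i) (hj : PolyTime j) (hs : PolyTime s) :
    PolyTime fun a => signFrom (t a) (I a) (i a) (j a) (s a) :=
  (ht.leB hI hj hj).ite ((ht.leB hI hi hj).ite ((ht.leB hI hj hi).ite (const 0) hs) hs.sign_neg) hs

theorem leftSign : ∀ (m : ℕ) {α : Type} [Enc α] {x : α → SExp} {I : α → List ℕ} {j : α → ℕ},
    PolyTime x → PolyTime I → PolyTime j → PolyTime fun a => leftSign m (x a) (I a) (j a)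
  | 0, _, _, _, _, _, _, _, _ => const _
  | m + 1, _, _, _, _, _, hx, hI, hj => (hx.sexp_snd.lineTbl m).signFrom hI.tail
      (hI.head?.getD (const 0)) hj (leftSign m hx.sexp_snd hI.tail hj)

theorem tuples {n : α → ℕ} (hn : PolyTime n) : ∀ k, PolyTime fun a => tuples (n a) k
  | 0 => const _
  | k + 1 => hn.range.flatMap (f := fun a i => (_root_.tuples (n a) k).map fun I => i :: I)
      (((tuples hn k).comp PolyTime.fst).map (f := fun p I => p.2 :: I)
        (PolyTime.fst.snd'.cons PolyTime.snd))

theorem directionSigns (m : ℕ) {x : α → SExp} {n : α → ℕ} {I : α → List ℕ} (hx : PolyTime x)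
    (hn : PolyTime n) (hI : PolyTime I) : PolyTime fun a => directionSigns m (x a) (n a) (I a) :=
  (const 0).cons (hn.range.map
    ((((hx.lineTbl m).comp PolyTime.fst).leB (hI.comp PolyTime.fst) PolyTime.snd PolyTime.snd).ite
      (leftSign m (hx.comp PolyTime.fst) (hI.comp PolyTime.fst) PolyTime.snd).sign_neg (const 0)))

theorem vertexSigns (m : ℕ) {x : α → SExp} {n : α → ℕ} {I : α → List ℕ} {i : α → ℕ}
    (hx : PolyTime x) (hn : PolyTime n) (hI : PolyTime I) (hi : PolyTime i) :
    PolyTime fun a => vertexSigns m (x a) (n a) (I a) (i a) :=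
  (const 1).cons (hn.range.map (((hx.lineTbl m).comp PolyTime.fst).signFrom
    (hI.comp PolyTime.fst) (hi.comp PolyTime.fst) PolyTime.snd
    (leftSign m (hx.comp PolyTime.fst) (hI.comp PolyTime.fst) PolyTime.snd)))

theorem ownCocircuits (m : ℕ) {x : α → SExp} {n : α → ℕ} (hx : PolyTime x) (hn : PolyTime n) :
    PolyTime fun a => ownCocircuits m (x a) (n a) := by
  have hx' : PolyTime fun p : α × List ℕ => x p.1 := hx.comp PolyTime.fst
  have hn' : PolyTime fun p : α × List ℕ => n p.1 := hn.comp PolyTime.fst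
  have hd := directionSigns m hx' hn' PolyTime.snd
  have hle : PolyTime fun p : (α × List ℕ) × ℕ =>
      _root_.leB (_root_.lineTbl m (x p.1.1)) p.1.2 p.2 p.2 :=
    ((hx'.lineTbl m).comp PolyTime.fst).leB PolyTime.fst.snd' PolyTime.snd PolyTime.snd
  have hv : PolyTime fun p : (α × List ℕ) × ℕ => _root_.vertexSigns m (x p.1.1) (n p.1.1) p.1.2 p.2 :=
    vertexSigns m (hx'.comp PolyTime.fst) (hn'.comp PolyTime.fst) PolyTime.fst.snd' PolyTime.snd
  have hf := hn'.range.filter (f := fun (p : α × List ℕ) (i : ℕ) => _root_.leB (_root_.lineTbl m (x p.1)) p.2 i i) hle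
  have hvs := hf.map (f := fun (p : α × List ℕ) (i : ℕ) => _root_.vertexSigns m (x p.1) (n p.1) p.2 i) hv
  have hneg := hd.map (f := fun _ (s : SignType) => -s) PolyTime.snd.sign_neg
  have hall := ((hx'.lineTbl m).isLineB PolyTime.snd).ite (hd.cons (hneg.cons hvs)) (const [])
  unfold _root_.ownCocircuits
  exact PolyTime.flatMap (hn.tuples m) hall

theorem cocircuits : ∀ (m : ℕ) {x : α → SExp} {n : α → ℕ}, PolyTime x → PolyTime n →
    PolyTime fun a => cocircuits m (x a) (n a)
  | 0, _, _, hx, hn => ownCocircuits 0 hx hn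
  | m + 1, _, _, hx, hn => (ownCocircuits (m + 1) hx hn).append (cocircuits m hx.sexp_snd hn)

theorem sampleIndex {T : α → List ℕ} {p : α → ℕ} (hT : PolyTime T) (hp : PolyTime p) :
    PolyTime fun a => sampleIndex (T a) (p a) :=
  ((const 0).cons (hT.map (f := fun _ i => i + 1) PolyTime.snd.succ)).list_getD rfl hp

theorem signAt_eq (s : SignType) {e : α → List SignType} {i : α → ℕ} (he : PolyTime e)
    (hi : PolyTime i) : PolyTime fun a => decide ((e a).getD (i a) 0 = s) :=
  (he.list_getD rfl hi).sign_eq s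

/-- Equality of signs. -/
theorem sign_eq_sign {s t : α → SignType} (hs : PolyTime s) (ht : PolyTime t) :
    PolyTime fun a => decide (s a = t a) :=
  ((ht.sign_eq 0).ite (hs.sign_eq 0) ((ht.sign_eq 1).ite (hs.sign_eq 1) (hs.sign_eq (-1)))).of_enc _
    id (fun _ => rfl) fun a => by rw [id]; cases t a <;> rfl

theorem fits {T : α → List ℕ} {r : α → ℕ × SignType × List ℕ} {e : α → List SignType}
    (hT : PolyTime T) (hr : PolyTime r) (he : PolyTime e) :
    PolyTime fun a => fits (T a) (r a) (e a) :=
  ((he.list_getD rfl (hT.sampleIndex hr.fst')).sign_eq_sign hr.snd'.fst').and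
    (hr.snd'.snd'.all (f := fun a p => decide ((e a).getD (_root_.sampleIndex (T a) p) 0 = 0))
      (signAt_eq 0 (he.comp PolyTime.fst) ((hT.comp PolyTime.fst).sampleIndex PolyTime.snd)))

theorem lookup {L : α → List (List SignType)} {T : α → List ℕ} {l : α → Label}
    (hL : PolyTime L) (hT : PolyTime T) (hl : PolyTime l) :
    PolyTime fun a => lookup (L a) (T a) (l a) := by
  have h1 : PolyTime fun p : (α × ℕ × SignType × List ℕ) × List SignType =>
      _root_.fits (T p.1.1) p.1.2 p.2 :=
    (hT.comp (PolyTime.fst.comp PolyTime.fst)).fits PolyTime.fst.snd' PolyTime.snd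
  have h2 := (hL.comp (PolyTime.fst (α := α) (β := ℕ × SignType × List ℕ))).find?
    (f := fun p e => _root_.fits (T p.1) p.2 e) h1
  have h3 := h2.getD (const [])
  unfold _root_.lookup
  exact hl.map (f := fun a r => ((L a).find? fun e => _root_.fits (T a) r e).getD []) h3

theorem inferSign {es : α → List (List SignType)} {i : α → ℕ} (hes : PolyTime es) (hi : PolyTime i) :
    PolyTime fun a => inferSign (es a) (i a) := by
  have h : ∀ s : SignType, PolyTime fun a => (es a).any fun e => decide (e.getD (i a) 0 = s) :=
    fun s => hes.any (f := fun a e => decide (e.getD (i a) 0 = s))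
      (signAt_eq s PolyTime.snd (hi.comp PolyTime.fst))
  exact (h 1).ite ((h (-1)).ite (const none) (const (Option.some 1)))
    ((h (-1)).ite (const (Option.some (-1))) (const (Option.some 0)))

theorem resolve {es : α → List (List SignType)} {s : α → State} (hes : PolyTime es)
    (hs : PolyTime s) : PolyTime fun a => resolve (es a) (s a) :=
  hs.length.range.map (f := fun a i => ((s a).getD i none).elim (_root_.inferSign (es a) (i + 1))
    Option.some) (option_elim (k := fun _ t => Option.some t) 0
      ((hs.comp PolyTime.fst).list_getD rfl PolyTime.snd)
      ((hes.comp PolyTime.fst).inferSign PolyTime.snd.succ) PolyTime.snd.some)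

theorem unresolved {s : α → State} (hs : PolyTime s) : PolyTime fun a => unresolved (s a) :=
  (hs.filter (β := Option SignType) (f := fun _ o => o.isNone)
    (PolyTime.snd.isSome.not.of_enc _ id (fun _ => rfl) fun p => by simp)).length

theorem conflict {T : α → List ℕ} {es : α → List (List SignType)} (hT : PolyTime T)
    (hes : PolyTime es) : PolyTime fun a => conflict (T a) (es a) :=
  ((const 0).cons (hT.map (f := fun _ i => i + 1) PolyTime.snd.succ)).any
    (f := fun a i => (_root_.inferSign (es a) i).isNone)
    (((hes.comp PolyTime.fst).inferSign PolyTime.snd).isSome.not.of_enc _ id (fun _ => rfl)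
      fun p => by simp)

theorem halves {L : α → List (List SignType)} {s : α → State} {T : α → List ℕ} {l : α → Label}
    (hL : PolyTime L) (hs : PolyTime s) (hT : PolyTime T) (hl : PolyTime l) :
    PolyTime fun a => halves (L a) (s a) (T a) (l a) := by
  have h := hL.lookup hT hl
  have hu := (h.resolve hs).unresolved
  exact (hT.conflict h).or ((hu.add hu).nat_le hs.unresolved)

theorem spanning {L : α → List (List SignType)} {T : α → List ℕ} (hL : PolyTime L)
    (hT : PolyTime T) :
    PolyTime fun a => spanning (L a) (T a) := by
  have h1 : PolyTime fun p : α × List SignType => 0 :: (T p.1).map (· + 1) :=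
    (const 0).cons ((hT.comp PolyTime.fst).map (f := fun _ i => i + 1) PolyTime.snd.succ)
  have h2 := h1.all (f := fun p i => decide (p.2.getD i 0 = 0))
    (signAt_eq 0 PolyTime.fst.snd' PolyTime.snd)
  have h3 := (PolyTime.snd (α := α) (β := List SignType)).all (f := fun _ s => decide (s = 0))
    (PolyTime.snd.sign_eq 0)
  unfold _root_.spanning
  exact hL.all (f := fun (a : α) (e : List SignType) => !((0 :: (T a).map (· + 1)).all fun i => decide (e.getD i 0 = 0)) ||
    e.all fun s => decide (s = 0)) (h2.not.or h3)

theorem good (ls : List Label) {L : α → List (List SignType)} {s : α → State} {T : α → List ℕ}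
    (hL : PolyTime L) (hs : PolyTime s) (hT : PolyTime T) :
    PolyTime fun a => good ls (L a) (s a) (T a) :=
  (hL.spanning hT).and ((const ls).all (f := fun a l => _root_.halves (L a) (s a) (T a) l)
    ((hL.comp PolyTime.fst).halves (hs.comp PolyTime.fst) (hT.comp PolyTime.fst) PolyTime.snd))

theorem chooseSample (m : ℕ) {L : α → List (List SignType)} {s : α → State} (hL : PolyTime L)
    (hs : PolyTime s) : PolyTime fun a => chooseSample m (L a) (s a) :=
  (hs.length.tuples _).find? (f := fun a T => _root_.good (outcomes m) (L a) (s a) T)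
    (good _ (hL.comp PolyTime.fst) (hs.comp PolyTime.fst) PolyTime.snd)

theorem depth {n : α → ℕ} (hn : PolyTime n) : PolyTime fun a => depth (n a) := by
  refine snd' (f := fun a => (doubling (n a))^[n a] (1, 0)) (iterate hn (const (1, 0)) ?_
    (φ := fun a => 8 * n a + 10) ?_ fun a k hk => ?_)
  · exact (PolyTime.snd.fst'.nat_le (hn.comp PolyTime.fst)).ite
      ((PolyTime.snd.fst'.add PolyTime.snd.fst').pair PolyTime.snd.snd'.succ) PolyTime.snd
  · refine (((PolyBdd.const 8).mul (hn.bdd.mono fun a => ?_)).add (.const 10))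
    rw [esize_nat]
    omega
  · obtain ⟨-, h2, -, h4⟩ := doubling_spec (n a) k
    rw [← Prod.mk.eta (p := (doubling (n a))^[k] (1, 0)), esize_pair, esize_nat, esize_nat]
    omega

end PolyTime

/-! ### Search trees as words -/

section Words

open Enc

/-- A symbol is a state, which stands for a subtree that is still to be built, or an instruction: a
comparison (`true`) or a computation (`false`), with its representation without the subtrees. -/
abbrev Symb : Type := Option State × Bool × List SExp

/-- Symbols for the nodes of a gadget: an outcome, or a register and, for a computation, the
instruction, marked by `true` if its first argument is the index of a sampled hyperplane. -/
abbrev Template : Type := Option Label × ℕ × Option (Bool × List ℕ)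

/-- The symbol that stands for the subtree of a state. -/
def stateSymb (s : State) : Symb := (some s, false, [])

/-- The entries of the representation of an operation, marked by `true` if the second one (the argument) is
the index of a sampled hyperplane. -/
def RealOp.template {N : ℕ} : RealOp N m → Bool × List ℕ
  | .one => (false, [0])
  | .point j => (false, [1, j])
  | .slope i j => (true, [2, i, j])
  | .icpt i => (true, [3, i])
  | .add a b => (false, [4, a, b])
  | .sub a b => (false, [5, a, b])
  | .mul a b => (false, [6, a, b])
  | .div a b => (false, [7, a, b])

/-- Replace the index in the sample by the index of the hyperplane, where the mark asks for it. -/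
def fillSample (T : List ℕ) (o : Bool × List ℕ) : List ℕ :=
  if o.1 = true then o.2.head?.getD 0 :: T.getD (o.2.tail.head?.getD 0) 0 :: o.2.tail.tail else o.2

theorem encode_rename {N : ℕ} (T : Fin N → Fin n) (op : RealOp N m) :
    (op.rename T).encode = enc (fillSample (tupleList T) op.template) := by
  cases op <;> simp [RealOp.rename, RealOp.encode, RealOp.template, fillSample, enc, tupleList]

/-- The nodes of a gadget, each before its subtrees. -/
def Gadget.template {N : ℕ} : Gadget N m Label → List Template
  | ret l => [(some l, 0, none)]
  | compute r op next => (none, r, some op.template) :: next.template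
  | branch r a b c => (none, r, none) :: (a.template ++ (b.template ++ c.template))

/-- The symbol for a node of the gadget that is run on the sample `T` in the state `s`: an outcome becomes the
state that it leads to. -/
def Template.fill (L : List (List SignType)) (s : State) (T : List ℕ) (y : Template) : Symb :=
  y.1.elim (none, y.2.2.elim (true, [enc 2, enc y.2.1]) fun o =>
    (false, [enc 1, enc y.2.1, enc (fillSample T o)])) fun l => stateSymb (resolve (lookup L T l) s)

/-- Replace a state by the gadget for it. -/
def expand (m : ℕ) (L : List (List SignType)) (y : Symb) : List Symb :=
  y.1.elim [y] fun s => (chooseSample m L s).elim [y] fun T =>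
    (locator m).template.map (Template.fill L s T)

/-- One more level of gadgets: all states in the word are replaced. -/
def expandAll (m : ℕ) (L : List (List SignType)) (w : List Symb) : List Symb := w.flatMap (expand m L)

/-- The representation of the leaf for a state. -/
def leafExp (s : State) : SExp := enc [enc 0, enc (s.map fun o => o.getD 0)]

/-- Read a word from right to left and build the trees on a stack. -/
def build (st : List SExp) (y : Symb) : List SExp :=
  y.1.elim (if y.2.1 = true then
      enc (y.2.2 ++ [st.head?.getD .nil, st.tail.head?.getD .nil, st.tail.tail.head?.getD .nil]) ::
        st.tail.tail.tail
    else enc (y.2.2 ++ [st.head?.getD .nil]) :: st.tail) fun s => leafExp s :: st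

/-- The representation of the search tree: the states of the word after `depth n` levels become leaves, and the
word is parsed. -/
def treeExp (m : ℕ) (L : List (List SignType)) (n : ℕ) : SExp :=
  ((((expandAll m L)^[depth n] [stateSymb (List.replicate n none)]).reverse.foldl build []).head?).getD
    .nil

theorem encode_leaf {s : State} (hs : s.length = n) :
    (SearchTree.leaf (n := n) (m := m) (faceOf s)).encode = leafExp s := by
  subst hs
  have : (List.ofFn fun i : Fin s.length => SExp.ofSign (faceOf s i)) =
      (s.map fun o => o.getD 0).map SExp.ofSign := by
    refine List.ext_getElem (by simp) fun i h1 h2 => ?_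
    simp only [List.length_ofFn] at h1
    simp [faceOf]
  rw [SearchTree.encode, SExp.ofFamily, this]
  rfl

theorem expandAll_iterate_append (L : List (List SignType)) (k : ℕ) (w w' : List Symb) :
    (expandAll m L)^[k] (w ++ w') = (expandAll m L)^[k] w ++ (expandAll m L)^[k] w' := by
  induction k generalizing w w' with
  | zero => rfl
  | succ k ih =>
    simp only [Function.iterate_succ_apply]
    rw [← ih, expandAll, List.flatMap_append]
    rfl

theorem expandAll_iterate_of_fixed {L : List (List SignType)} (k : ℕ) {y : Symb}
    (hy : expand m L y = [y]) : (expandAll m L)^[k] [y] = [y] :=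
  Function.iterate_fixed (by simp [expandAll, hy]) k

theorem expandAll_iterate_cons {L : List (List SignType)} (k : ℕ) {y : Symb} (hy : y.1 = none)
    (w : List Symb) : (expandAll m L)^[k] (y :: w) = y :: (expandAll m L)^[k] w := by
  rw [← List.singleton_append, expandAll_iterate_append,
    expandAll_iterate_of_fixed k (by rw [expand, hy]; rfl)]
  rfl

/-- Parsing commutes with expanding: after `k` levels, the word of a state is parsed to the tree of depth
`k` for this state. -/
theorem foldr_build [NeZero n] (L : List (List SignType)) : ∀ (k : ℕ) {s : State} (st : List SExp),
    s.length = n → ((expandAll m L)^[k] [stateSymb s]).foldr (fun y st => build st y) st =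
      (buildTree (n := n) (m := m) L k s).encode :: st := by
  intro k
  induction k with
  | zero =>
    intro s st hs
    rw [buildTree, encode_leaf hs]
    rfl
  | succ k ih =>
    intro s st hs
    rw [buildTree]
    cases hc : chooseSample m L s with
    | none =>
      rw [expandAll_iterate_of_fixed _ (by simp [expand, stateSymb, hc]), Option.elim_none,
        encode_leaf hs]
      rfl
    | some T =>
      have hT := List.mem_of_find?_eq_some hc
      rw [hs] at hT
      obtain ⟨T, rfl⟩ := mem_tuples.1 hT
      have e : expandAll m L [stateSymb s] =
          (locator m).template.map (Template.fill L s (tupleList T)) := by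
        simp [expandAll, expand, stateSymb, hc]
      rw [Option.elim_some, Function.iterate_succ_apply, e, toTuple_tupleList]
      have key : ∀ (G : Gadget (sampleSize m) m Label) (st : List SExp),
          ((expandAll m L)^[k] (G.template.map (Template.fill L s (tupleList T)))).foldr
            (fun y st => build st y) st = (G.instantiate T fun l =>
              buildTree L k (resolve (lookup L (tupleList T) l) s)).encode :: st := by
        intro G
        induction G with
        | ret l =>
          intro st
          exact ih st ((length_resolve _ _).trans hs)
        | compute r op next ihn =>
          intro st
          rw [Gadget.template, List.map_cons, expandAll_iterate_cons k rfl, List.foldr_cons, ihn,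
            Gadget.instantiate, SearchTree.encode, encode_rename]
          rfl
        | branch r a b c iha ihb ihc =>
          intro st
          rw [Gadget.template, List.map_cons, expandAll_iterate_cons k rfl, List.foldr_cons,
            List.map_append, List.map_append, expandAll_iterate_append, expandAll_iterate_append,
            List.foldr_append, List.foldr_append, ihc, ihb, iha, Gadget.instantiate,
            SearchTree.encode]
          rfl
      exact key (locator m) st

/-- The word describes the tree of `buildTree`, so that the preprocessing constructs the search structure. -/
theorem treeExp_eq (x : SExp) : treeExp m (cocircuits m x n) n = (searchStructure n m x).encode := by
  rw [searchStructure]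
  split_ifs with hn
  · subst hn
    rfl
  · have : NeZero n := ⟨hn⟩
    rw [treeExp, List.foldl_reverse, foldr_build (n := n) _ _ _ (List.length_replicate ..)]
    rfl

/-! ### The size of the words -/

theorem esize_state (s : State) : esize s ≤ 8 * s.length + 1 := by
  have := esize_le_of_forall s 7 fun o _ => by
    cases o with
    | none => rw [esize_none]; norm_num
    | some t => rw [esize_some]; have := esize_sign t; omega
  omega

theorem esize_stateSymb (s : State) : esize (stateSymb s) ≤ 8 * s.length + 7 := by
  have := esize_state s
  have h1 : esize (stateSymb s) = (esize s + 2) + (esize false + esize ([] : List SExp) + 1) + 1 := rfl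
  have h2 : esize false = 1 := rfl
  rw [h1, h2, esize_nil]
  omega

/-- A symbol that can occur in words for `n` hyperplanes, with instructions of size at most `S`. -/
def Symb.Small (n S : ℕ) (y : Symb) : Prop :=
  (y.1 = none ∧ esize y ≤ S) ∨ ∃ s : State, s.length = n ∧ y = stateSymb s

theorem expand_small {L : List (List SignType)} {S : ℕ}
    (hS : ∀ y, esize y ≤ 8 * n + 7 → esize (expand m L y) ≤ S) {y : Symb} (hy : y.Small n S) :
    (∀ z ∈ expand m L y, Symb.Small n S z) ∧ (expand m L y).length ≤ (locator m).template.length + 1 := by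
  rcases hy with ⟨h0, h1⟩ | ⟨s, hs, rfl⟩
  · have e : expand m L y = [y] := by rw [expand, h0]; rfl
    rw [e]
    exact ⟨by simpa using .inl ⟨h0, h1⟩, by simp⟩
  · cases hc : chooseSample m L s with
    | none =>
      have e : expand m L (stateSymb s) = [stateSymb s] := by simp [expand, stateSymb, hc]
      rw [e]
      exact ⟨by simpa using .inr ⟨s, hs, rfl⟩, by simp⟩
    | some T =>
      have e : expand m L (stateSymb s) = (locator m).template.map (Template.fill L s T) := by
        simp [expand, stateSymb, hc]
      refine ⟨fun z hz => ?_, by rw [e, List.length_map]; exact Nat.le_succ _⟩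
      have hle := (esize_mem_le hz).trans (hS _ (hs ▸ esize_stateSymb s))
      rw [e, List.mem_map] at hz
      obtain ⟨⟨o, t⟩, -, rfl⟩ := hz
      cases o with
      | none => exact .inl ⟨rfl, hle⟩
      | some l => exact .inr ⟨_, (length_resolve _ _).trans hs, rfl⟩

theorem expandAll_iterate_small {L : List (List SignType)} {S : ℕ}
    (hS : ∀ y, esize y ≤ 8 * n + 7 → esize (expand m L y) ≤ S) (k : ℕ) :
    (∀ z ∈ (expandAll m L)^[k] [stateSymb (List.replicate n none)], Symb.Small n S z) ∧
      ((expandAll m L)^[k] [stateSymb (List.replicate n none)]).length ≤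
        ((locator m).template.length + 1) ^ k := by
  induction k with
  | zero => exact ⟨by simpa using .inr ⟨_, List.length_replicate .., rfl⟩, by simp⟩
  | succ k ih =>
    rw [Function.iterate_succ_apply']
    set w := (expandAll m L)^[k] [stateSymb (List.replicate n none)]
    refine ⟨fun z hz => ?_, ?_⟩
    · obtain ⟨y, hy, hz⟩ := List.mem_flatMap.1 hz
      exact (expand_small hS (ih.1 y hy)).1 z hz
    · have : ∀ w : List Symb, (∀ y ∈ w, Symb.Small n S y) →
          (expandAll m L w).length ≤ w.length * ((locator m).template.length + 1) := by
        intro w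
        induction w with
        | nil => simp [expandAll]
        | cons y w ihw =>
          intro hw
          rw [List.forall_mem_cons] at hw
          have h1 := ihw hw.2
          have h2 := (expand_small hS hw.1).2
          rw [expandAll] at h1
          rw [expandAll, List.flatMap_cons, List.length_append, List.length_cons, add_mul, one_mul]
          omega
      rw [pow_succ]
      exact (this w ih.1).trans (Nat.mul_le_mul_right _ ih.2)

theorem esize_take_le {α : Type} [Enc α] (l : List α) (k : ℕ) : esize (l.take k) ≤ esize l := by
  have h1 := esize_append (l.take k) (l.drop k)
  have h2 := esize_pos (l.drop k)
  rw [List.take_append_drop] at h1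
  omega

theorem esize_leafExp (s : State) : esize (leafExp s) ≤ 6 * esize s + 10 := by
  have h1 := esize_le_of_forall (s.map fun o => o.getD 0) 5 fun t _ => esize_sign t
  have h2 : esize (leafExp s) = 1 + (esize (s.map fun o => o.getD 0) + 1 + 1) + 1 := rfl
  have h3 := length_lt_esize s
  rw [List.length_map] at h1
  omega

theorem esize_head_tail (st : List SExp) :
    esize (st.head?.getD .nil) + esize st.tail ≤ esize st + 1 := by
  cases st with
  | nil => exact le_rfl
  | cons a st =>
    rw [esize_cons]
    simp only [List.head?_cons, Option.getD_some, List.tail_cons]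
    omega

theorem esize_build (st : List SExp) (y : Symb) : esize (build st y) ≤ esize st + (6 * esize y + 20) := by
  obtain ⟨o, b, pre⟩ := y
  have hp : esize ((o, b, pre) : Symb) = esize o + (esize b + esize pre + 1) + 1 := rfl
  have h1 := esize_head_tail st
  cases o with
  | some s =>
    have h2 : esize (build st (some s, b, pre)) = esize (leafExp s) + esize st + 1 := rfl
    have h3 := esize_leafExp s
    rw [esize_some] at hp
    omega
  | none =>
    cases b with
    | false =>
      have h2 : esize (build st (none, false, pre)) =
          esize (pre ++ [st.head?.getD .nil]) + esize st.tail + 1 := rfl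
      have h3 := esize_append pre [st.head?.getD .nil]
      rw [esize_cons, esize_nil] at h3
      omega
    | true =>
      have h2 : esize (build st (none, true, pre)) = esize (pre ++ [st.head?.getD .nil,
        st.tail.head?.getD .nil, st.tail.tail.head?.getD .nil]) + esize st.tail.tail.tail + 1 := rfl
      have h3 := esize_append pre [st.head?.getD .nil, st.tail.head?.getD .nil,
        st.tail.tail.head?.getD .nil]
      have h4 := esize_head_tail st.tail
      have h5 := esize_head_tail st.tail.tail
      rw [esize_cons, esize_cons, esize_cons, esize_nil] at h3
      omega

theorem esize_foldl_build (w : List Symb) (st : List SExp) :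
    esize (w.foldl build st) ≤ esize st + 26 * esize w := by
  induction w generalizing st with
  | nil => exact Nat.le_add_right _ _
  | cons y w ih =>
    have h1 := ih (build st y)
    have h2 := esize_build st y
    rw [List.foldl_cons, esize_cons]
    omega

end Words

namespace PolyTime

open Enc

variable {α : Type} [Enc α]

theorem fillSample {T : α → List ℕ} {o : α → Bool × List ℕ} (hT : PolyTime T) (ho : PolyTime o) :
    PolyTime fun a => fillSample (T a) (o a) :=
  ho.fst'.ite ((ho.snd'.head?.getD (const 0)).cons ((hT.list_getD rfl
    (ho.snd'.tail.head?.getD (const 0))).cons ho.snd'.tail.tail)) ho.snd'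

theorem fill {L : α → List (List SignType)} {s : α → State} {T : α → List ℕ} {y : α → Template}
    (hL : PolyTime L) (hs : PolyTime s) (hT : PolyTime T) (hy : PolyTime y) :
    PolyTime fun a => Template.fill (L a) (s a) (T a) (y a) := by
  have h1 : PolyTime fun p : α × Label => stateSymb (_root_.resolve (_root_.lookup (L p.1) (T p.1) p.2) (s p.1)) :=
    ((((hL.comp PolyTime.fst).lookup (hT.comp PolyTime.fst) PolyTime.snd).resolve
      (hs.comp PolyTime.fst)).some).pair (const (false, []))
  have hr : PolyTime fun a => enc (y a).2.1 := hy.snd'.fst'.enc_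
  have h2 : PolyTime fun p : α × Bool × List ℕ =>
      (false, [enc 1, enc (y p.1).2.1, enc (_root_.fillSample (T p.1) p.2)]) :=
    (const false).pair ((const (enc 1)).cons ((hr.comp PolyTime.fst).cons
      ((((hT.comp PolyTime.fst).fillSample PolyTime.snd).enc_).cons (const []))))
  have h3 : PolyTime fun a => (true, [enc 2, enc (y a).2.1]) :=
    (const true).pair ((const (enc 2)).cons (hr.cons (const [])))
  have h4 := option_elim (k := fun (a : α) (o : Bool × List ℕ) =>
    (false, [enc 1, enc (y a).2.1, enc (_root_.fillSample (T a) o)])) (false, []) hy.snd'.snd' h3 h2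
  exact option_elim (k := fun (a : α) (l : Label) =>
    stateSymb (_root_.resolve (_root_.lookup (L a) (T a) l) (s a))) [] hy.fst'
      ((const none).pair h4) h1

theorem expand (m : ℕ) {L : α → List (List SignType)} {y : α → Symb} (hL : PolyTime L)
    (hy : PolyTime y) : PolyTime fun a => expand m (L a) (y a) := by
  have hc : PolyTime fun p : α × State => _root_.chooseSample m (L p.1) p.2 :=
    chooseSample m (hL.comp PolyTime.fst) PolyTime.snd
  have hy1 : PolyTime fun a => [y a] := hy.cons (const [])
  have h1 : PolyTime fun p : ((α × State) × List ℕ) × Template =>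
      Template.fill (L p.1.1.1) p.1.1.2 p.1.2 p.2 :=
    fill (hL.comp (PolyTime.fst.comp (PolyTime.fst.comp PolyTime.fst))) PolyTime.fst.fst'.snd'
      PolyTime.fst.snd' PolyTime.snd
  have h2 := (const (α := (α × State) × List ℕ) (locator m).template).map
    (f := fun (p : (α × State) × List ℕ) (y : Template) => Template.fill (L p.1.1) p.1.2 p.2 y) h1
  have h3 := option_elim (k := fun (p : α × State) (T : List ℕ) =>
    (locator m).template.map fun y => Template.fill (L p.1) p.2 T y) [] hc (hy1.comp PolyTime.fst) h2
  exact option_elim (k := fun (a : α) (s : State) => (_root_.chooseSample m (L a) s).elim [y a]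
    fun T => (locator m).template.map fun y => Template.fill (L a) s T y) [] hy.fst' hy1 h3

theorem leafExp {s : α → State} (hs : PolyTime s) : PolyTime fun a => leafExp (s a) := by
  have h1 : PolyTime fun a => (s a).map fun o => o.getD 0 :=
    hs.map (f := fun _ (o : Option SignType) => o.getD 0) (PolyTime.snd.getD (const 0))
  exact ((const (enc 0)).cons (h1.enc_.cons (const []))).enc_

theorem build {st : α → List SExp} {y : α → Symb} (hst : PolyTime st) (hy : PolyTime y) :
    PolyTime fun a => build (st a) (y a) := by
  have hd : ∀ {l : α → List SExp}, PolyTime l → PolyTime fun a => (l a).head?.getD .nil :=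
    fun hl => hl.head?.getD (const _)
  have h1 := (hy.snd'.snd'.append ((hd hst).cons ((hd hst.tail).cons
    ((hd hst.tail.tail).cons (const []))))).enc_.cons hst.tail.tail.tail
  have h2 := (hy.snd'.snd'.append ((hd hst).cons (const []))).enc_.cons hst.tail
  have h3 : PolyTime fun p : α × State => _root_.leafExp p.2 :: st p.1 :=
    PolyTime.snd.leafExp.cons (hst.comp PolyTime.fst)
  exact option_elim (k := fun (a : α) (s : State) => _root_.leafExp s :: st a) [] hy.fst'
    (hy.snd'.fst'.ite h1 h2) h3

/-- The intermediate words have polynomial size, since each of the `depth n` levels multiplies the number of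
symbols at most by the number of nodes of a gadget, which depends on the dimension only, and `depth n` is
logarithmic. -/
theorem iterate_expandAll (m : ℕ) {L : α → List (List SignType)} {n : α → ℕ} (hL : PolyTime L)
    (hn : PolyTime n) : PolyTime fun a =>
      (expandAll m (L a))^[_root_.depth (n a)] [stateSymb (List.replicate (n a) none)] := by
  have hs : PolyTime fun a => (List.replicate (n a) none : State) :=
    (hn.range.map (f := fun _ _ => (none : Option SignType)) (const _)).of_enc _ id (fun _ => rfl)
      fun a => by simp
  have hi : PolyTime fun a => [stateSymb (List.replicate (n a) none)] :=
    (hs.some.pair (const (false, []))).cons (const [])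
  have he : PolyTime fun p : List (List SignType) × Symb => _root_.expand m p.1 p.2 :=
    expand m PolyTime.fst PolyTime.snd
  have hf : PolyTime fun p : α × List Symb => expandAll m (L p.1) p.2 :=
    PolyTime.snd.flatMap (f := fun (p : α × List Symb) (y : Symb) => _root_.expand m (L p.1) y)
      (expand m (hL.comp (PolyTime.fst.comp PolyTime.fst)) PolyTime.snd)
  obtain ⟨c, hc⟩ := he.bdd
  have hn' : PolyBdd n := hn.bdd.mono fun a => by rw [esize_nat]; omega
  have k := fun k => PolyBdd.const (α := α) k
  have hS : PolyBdd fun a => c * (esize (L a) + (8 * n a + 7) + 1 + 1) ^ c :=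
    (k c).mul ((((hL.bdd.add (((k 8).mul hn').add (k 7))).add (k 1)).add (k 1)).pow c)
  have hφ : PolyBdd fun a => (2 * n a + 1) ^ ((locator m).template.length + 1) *
      (c * (esize (L a) + (8 * n a + 7) + 1 + 1) ^ c + (8 * n a + 7) + 1) + 1 :=
    ((((k 2).mul hn').add (k 1)).pow _ |>.mul ((hS.add (((k 8).mul hn').add (k 7))).add (k 1))).add
      (k 1)
  refine iterate hn.depth hi hf hφ fun a j hj => ?_
  obtain ⟨h1, h2⟩ := expandAll_iterate_small (m := m) (n := n a) (L := L a)
    (S := c * (esize (L a) + (8 * n a + 7) + 1 + 1) ^ c) (fun y hy => by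
      refine (hc (L a, y)).trans (Nat.mul_le_mul_left _ (Nat.pow_le_pow_left ?_ _))
      rw [esize_pair]
      omega) j
  refine (esize_le_of_forall _ (c * (esize (L a) + (8 * n a + 7) + 1 + 1) ^ c + (8 * n a + 7))
    fun y hy => ?_).trans (Nat.add_le_add_right (Nat.mul_le_mul_right _ (h2.trans ?_)) 1)
  · rcases h1 y hy with h | ⟨s, hs, rfl⟩
    · exact h.2.trans (Nat.le_add_right _ _)
    · exact (hs ▸ esize_stateSymb s).trans (Nat.le_add_left _ _)
  · -- the number of symbols grows by a constant factor in each of logarithmically many steps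
    set W := (locator m).template.length + 1
    calc W ^ j ≤ W ^ _root_.depth (n a) := Nat.pow_le_pow_right (Nat.succ_pos _) hj
      _ ≤ (2 ^ W) ^ _root_.depth (n a) := Nat.pow_le_pow_left Nat.lt_two_pow_self.le _
      _ = (2 ^ _root_.depth (n a)) ^ W := by rw [← pow_mul, ← pow_mul, mul_comm]
      _ ≤ (2 * n a + 1) ^ W := Nat.pow_le_pow_left (two_pow_depth_le _) _

theorem treeExp (m : ℕ) {L : α → List (List SignType)} {n : α → ℕ} (hL : PolyTime L)
    (hn : PolyTime n) : PolyTime fun a => treeExp m (L a) (n a) := by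
  have hw := (iterate_expandAll m hL hn).reverse
  have h1 := foldl (i := fun _ => ([] : List SExp)) (f := fun _ => _root_.build) hw (const [])
    (PolyTime.snd.fst'.build PolyTime.snd.snd') ((PolyBdd.const 1).add ((PolyBdd.const 26).mul hw.bdd))
    fun a k => (esize_foldl_build _ _).trans
      (Nat.add_le_add_left (Nat.mul_le_mul_left _ (esize_take_le _ _)) _)
  exact h1.head?.getD (const _)

end PolyTime

/-! ### The size of the order type -/

theorem size_ofList_le (l : List SExp) (B : ℕ) (h : ∀ x ∈ l, x.size ≤ B) :
    (SExp.ofList l).size ≤ l.length * (B + 1) + 1 := by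
  have := esize_le_of_forall l B h
  rw [esize, Enc.enc] at this
  simpa [instEncList, Enc.enc] using this

theorem size_ofFamily_le (f : Fin n → SExp) (B : ℕ) (h : ∀ i, (f i).size ≤ B) :
    (SExp.ofFamily f).size ≤ n * (B + 1) + 1 := by
  have := size_ofList_le (List.ofFn f) B (List.forall_mem_ofFn_iff.2 h)
  rwa [List.length_ofFn] at this

/-- Bounds for the size of a table with `k` indices below `n`. -/
def tableBound (n B : ℕ) : ℕ → ℕ
  | 0 => B
  | k + 1 => n * (tableBound n B k + 1) + 1

theorem size_ofTable_le : ∀ (k : ℕ) (f : (Fin k → Fin n) → SExp) (B : ℕ), (∀ I, (f I).size ≤ B) →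
    (SExp.ofTable k f).size ≤ tableBound n B k
  | 0, _, _, h => h _
  | k + 1, _, B, h => size_ofFamily_le _ _ fun _ => size_ofTable_le k _ B fun _ => h _

theorem polyBdd_tableBound {B : ℕ → ℕ} (hB : PolyBdd B) :
    ∀ k, PolyBdd fun n => tableBound n (B n) k
  | 0 => hB
  | k + 1 => ((PolyBdd.size.mono fun n => by rw [esize_nat]; omega).mul
      ((polyBdd_tableBound hB k).add (.const 1))).add (.const 1)

theorem exists_size_lineTable_le (m : ℕ) : ∃ φ : ℕ → ℕ, PolyBdd φ ∧
    ∀ (n : ℕ) (T : LineTable n m), T.encode.size ≤ φ n := by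
  have hb : ∀ b, (SExp.ofBool b).size ≤ 3 := esize_bool
  have hn : PolyBdd fun n : ℕ => n := PolyBdd.size.mono fun n => by rw [esize_nat]; omega
  have h1 : PolyBdd fun n => n * ((n * (3 + 1) + 1) + 1) + 1 :=
    (hn.mul (((hn.mul (.const (3 + 1))).add (.const 1)).add (.const 1))).add (.const 1)
  refine ⟨_, ((polyBdd_tableBound (.const 3) m).add (polyBdd_tableBound h1 m)).add (.const 1),
    fun n T => ?_⟩
  exact Nat.add_le_add_right (Nat.add_le_add (size_ofTable_le m _ 3 fun I => hb _)
    (size_ofTable_le m _ _ fun I => size_ofFamily_le _ _ fun i => size_ofFamily_le _ _ fun j => hb _)) 1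

theorem exists_size_encodeAux_le : ∀ m : ℕ, ∃ φ : ℕ → ℕ, PolyBdd φ ∧
    ∀ (n : ℕ) (T : ArrOrderType n m), T.encodeAux.size ≤ φ n
  | 0 => exists_size_lineTable_le 0
  | m + 1 => by
    obtain ⟨φ, h1, h2⟩ := exists_size_lineTable_le (m + 1)
    obtain ⟨ψ, h3, h4⟩ := exists_size_encodeAux_le m
    exact ⟨_, (h1.add h3).add (.const 1), fun n T =>
      Nat.add_le_add_right (Nat.add_le_add (h2 n T.1) (h4 n T.2)) 1⟩

theorem PolyBdd.exists_le {φ : ℕ → ℕ} (h : PolyBdd φ) : ∃ c, ∀ n, φ n ≤ c * (n + 1) ^ c := by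
  obtain ⟨c, hc⟩ := h
  refine ⟨c * 2 ^ c, fun n => (hc n).trans ?_⟩
  have e : esize n + 1 = 2 * (n + 1) := by rw [esize_nat]; ring
  rw [e, mul_pow, ← mul_assoc]
  exact Nat.mul_le_mul_left _ (Nat.pow_le_pow_right (Nat.succ_pos n)
    (Nat.le_mul_of_pos_right _ (by positivity)))

theorem mainTheorem6 :
    -- `K` is absolute: the query constant `K * d ^ K` is polynomial in the dimension `d = m + 1`
    ∃ K : ℕ, ∀ m : ℕ, 1 ≤ m →
      -- for each fixed dimension, one preprocessing program and one polynomial `c * (n + 1) ^ c`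
      ∃ (prep : Code) (c : ℕ), ∀ n : ℕ,
        -- the structure is a function of the order type alone
        ∃ build : ArrOrderType n m → SearchTree n m,
          ∀ h : Fin n → Hyperplane m, Function.Injective h →
            (∃ t : ℕ, t ≤ c * (n + 1) ^ c ∧
              prep.Run (orderType h).encode (build (orderType h)).encode t) ∧
            (build (orderType h)).encode.size ≤ c * (n + 1) ^ c ∧
            ∀ q : Fin (m + 1) → ℝ,
              q ∈ arrangementFace h ((build (orderType h)).answer h q) ∧
              ((build (orderType h)).queryTime h q : ℝ) ≤
                K * ((m + 1 : ℕ) : ℝ) ^ K * Real.log (n + 2) := by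
  obtain ⟨K, hK⟩ := exists_locateBound_le
  refine ⟨K, fun m _ => ?_⟩
  have hP : PolyTime fun a : ℕ × SExp => treeExp m (cocircuits m a.2 a.1) a.1 :=
    PolyTime.treeExp m (PolyTime.cocircuits m PolyTime.snd PolyTime.fst) PolyTime.fst
  obtain ⟨⟨c₁, hsize⟩, prep, τ, ⟨c₂, hτ⟩, hrun⟩ := hP
  obtain ⟨φ, hφ, henc⟩ := exists_size_encodeAux_le m
  -- the size of the input is polynomial in `n`
  have hin : PolyBdd fun n : ℕ => esize n + φ n + 1 := (PolyBdd.size.add hφ).add (.const 1)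
  obtain ⟨c, hc⟩ := (((PolyBdd.const c₁).mul ((hin.add (.const 1)).pow c₁)).add
    ((PolyBdd.const c₂).mul ((hin.add (.const 1)).pow c₂))).exists_le
  refine ⟨prep, c, fun n => ⟨fun T => searchStructure n m T.encodeAux, fun h _ => ?_⟩⟩
  have hx : esize ((n, (orderType h).encodeAux) : ℕ × SExp) ≤ esize n + φ n + 1 :=
    Nat.add_le_add_right (Nat.add_le_add_left (henc n _) _) 1
  have hpow : ∀ d, d * (esize ((n, (orderType h).encodeAux) : ℕ × SExp) + 1) ^ d ≤
      d * (esize n + φ n + 1 + 1) ^ d := fun d =>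
    Nat.mul_le_mul_left _ (Nat.pow_le_pow_left (Nat.add_le_add_right hx 1) d)
  refine ⟨?_, ?_, fun q => ?_⟩
  · obtain ⟨t, ht, hr⟩ := hrun (n, (orderType h).encodeAux)
    beta_reduce at hr
    rw [treeExp_eq] at hr
    exact ⟨t, ht.trans (((hτ _).trans (hpow c₂)).trans ((Nat.le_add_left _ _).trans (hc n))), hr⟩
  · have h1 := hsize (n, (orderType h).encodeAux)
    beta_reduce at h1
    rw [treeExp_eq] at h1
    exact (h1.trans (hpow c₁)).trans ((Nat.le_add_right _ _).trans (hc n))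
  · obtain ⟨h1, h2⟩ := run_searchStructure h q fun _ => 0
    refine ⟨fun i => (congrFun h1 i).symm, ?_⟩
    set B := Prog.locateBound (sampleSize m) m
    have h3 : ((searchStructure n m (orderType h).encodeAux).queryTime h q : ℝ) ≤ depth n * B + 1 := by
      exact_mod_cast h2
    have h4 : ((4 * B + 2 : ℕ) : ℝ) ≤ K * ((m + 1 : ℕ) : ℝ) ^ K := by exact_mod_cast hK m
    have h5 := depth_le_log n
    have h6 := one_le_log n
    have h7 : (depth n : ℝ) * B ≤ 4 * Real.log (n + 2) * B :=
      mul_le_mul_of_nonneg_right h5 (Nat.cast_nonneg B)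
    have h8 : ((4 * B + 2 : ℕ) : ℝ) * Real.log (n + 2) ≤
        K * ((m + 1 : ℕ) : ℝ) ^ K * Real.log (n + 2) :=
      mul_le_mul_of_nonneg_right h4 (by linarith)
    push_cast at h8 ⊢
    linarith
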